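/- **Setting.** Let $M$ be a two-dimensional manifold; we work in local coordinates $x=(x^1,x^2)$ over an open set $\Omega$, with $y=(y^1,y^2)$ the components of tangent vectors and summation over repeated indices. Let $a_{ij}(x)$ be a smooth Riemannian metric with inverse $a^{ij}$ and Christoffel symbols $a^k{}_{nj}$, let $\tilde b_i(x), n_i(x)$ be smooth covector fields, orthonormal with respect to $a$, let $c\in(0,1)$ be a constant, let $g=g(x)$ be a smooth function with values in $(-2,2)$, and let $C_1$ be a real constant (for instance $C_1=-1/c$). Indices of $\tilde b_i,n_i$ are raised with $a^{ij}$. Put $$b_i=c\tilde b_i,\quad b=b_iy^i,\quad n=n_iy^i,\quad S^2=a_{ij}y^iy^j,\quad q=\sqrt{S^2-b^2},\quad h=\sqrt{1-g^2/4},\quad G=g/h,$$ $$B=b^2+gbq+q^2,\quad B_1=\tfrac1{c^2}(b+gc^2q),\quad \nu=q+(1-c^2)gb,\quad \tfrac1X=2+\tfrac{(1-c^2)B}{q\nu},$$ and let the Finsleroid-regular metric function be $K=\sqrt B\,e^{-Gf/2}$, where $f=-\arctan\frac G2+\arctan\frac{q+gb/2}{hb}$ for $b>0$, the same plus $\pi$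 for $b<0$, and $f=\frac\pi2-\arctan\frac G2$ for $b=0$. Put $l^k=y^k/K$, $l_k=\partial K/\partial y^k$, $y_k=Kl_k$, $g_{ij}=\partial y_i/\partial y^j$, $C_{ijk}=\frac12\partial g_{ij}/\partial y^k$, $A_{ijk}=KC_{ijk}$ (indices raised by $g^{ij}$), $$T=\tfrac1c\sqrt{\tfrac{\nu}{q}}\,\tfrac{K^2}{B},\qquad m_k=\tfrac1KT(bn_k-nb_k),\qquad m^k=g^{kn}m_n,\qquad I=-\tfrac{gc}{2X}\tfrac{n}{\sqrt{q\nu}},$$ $$p_n=cn^h\Bigl(\tfrac{\partial\tilde b_h}{\partial x^n}-a^k{}_{nh}\tilde b_k\Bigr),\qquad k_n=-C_1p_n,\qquad U=\tfrac{C_1}{c}\sqrt{q/\nu}.$$ The operator $\partial^*_n=\frac{\partial g}{\partial x^n}\frac{\partial}{\partial g}$ differentiates only through the explicit dependence on $g$, at fixed $x$, $y$, $a_{ij}$, $b_i$, $n_i$. **The angle function.** $\theta(x,y)$ is defined by $K\,\partial\theta/\partial y^n=m_n$, $\theta(x,b^i(x))=0$ and continuation in $y$ around the origin. Like the Euclidean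 polar angle it is multivalued on $T_xM\setminus0$. Explicitly, if $y$ is a positive multiple of $\cos\tau\,\tilde b^i+\sin\tau\, n^i$, then $\theta=\Theta(g(x),\tau)$ with $\Theta(g,\tau)=\int_0^\tau \frac{\sqrt{\nu/q}}{B}\,ds$, the integrand being taken at $b=c\cos s$, $q=\sqrt{1-c^2\cos^2s}$. For each real $\alpha$, let the branch $\theta_\alpha$ be the one obtained by choosing $\tau\in(\alpha-\pi,\alpha+\pi)$; it is defined for the $y\neq0$ that do not lie on the ray $\tau=\alpha+\pi$. Let $\theta^{\max}(x)=\Theta(g(x),2\pi)$ be the increment of the angle over a full turn. ($\partial^*_n\theta$ is taken at fixed $\tau$.) **The connection.** For a given branch put $$N^k_n=\Bigl[\bigl(\tfrac1{c^2}b-Uc^2B_1\bigr)n^k+n\bigl(U-\tfrac1{c^2}\bigr)b^k\Bigr]p_n-l^k\partial^*_nK-Km^k\partial^*_n\theta-a^k{}_{nj}y^j,$$ $d_n=\partial_{x^n}+N^k_n\partial_{y^k}$, $N^k_{nm}=\partial N^k_n/\partial y^m$, $N^k_{nmi}=\partial N^k_{nm}/\partial y^i$, $D^k{}_{in}=-N^k_{in}$,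 $M^n{}_{ij}=d_iN^n_j-d_jN^n_i$, $$E_k{}^n{}_{ij}=d_iD^n{}_{jk}-d_jD^n{}_{ik}+D^m{}_{jk}D^n{}_{im}-D^m{}_{ik}D^n{}_{jm},\qquad \rho_k{}^n{}_{ij}=E_k{}^n{}_{ij}-M^h{}_{ij}C^n{}_{hk},$$ $\rho_{knij}=g_{nm}\rho_k{}^m{}_{ij}$, and $M_{ij}=\partial k_j/\partial x^i-\partial k_i/\partial x^j$. **Theorem.** 1. For $x\in\Omega$ and $y\ne0$: $q,B,\nu,K>0$, $K$ is positively homogeneous of degree one in $y$, $(g_{ij})$ is positive definite, $g_{ij}=l_il_j+m_im_j$, $A_{ijk}=I\,m_im_jm_k$, and, if $\tilde b_1n_2-\tilde b_2n_1>0$, then $m_1=-\sqrt{\det(g_{ij})}\,l^2$ and $m_2=\sqrt{\det(g_{ij})}\,l^1$. 2. $K$, $T$, $I$, $l^k$, $l_k$, $m^k$, $m_k$, $g_{ij}$, $g^{ij}$, $A_{ijk}$, $\partial K/\partial x^n$ and $\partial^*_nK$ are $C^\infty$ in $(x,y)$ for $x\in\Omega$ and all $y\neq0$. 3. For every branch $\theta=\theta_\alpha$,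 the functions $\theta$, $\partial\theta/\partial x^n$, $\partial^*_n\theta$, $N^k_n$, $N^k_{nm}$, $N^k_{nmi}$, $Z_n$ (defined in 5), $M^n{}_{ij}$, $\rho_k{}^n{}_{ij}$, $\rho_{knij}$ are $C^\infty$ in $(x,y)$ on the domain of the branch. Hence they are $C^\infty$ in $y$ near every $y\in T_xM\setminus0$, for every determination of the angle there. 4. $b^i(x)$ lies in the domain of $\theta_0$, $\theta_0(x,b^i(x))=0$, and $\theta^{\max}>0$. Every branch satisfies $K\partial\theta_\alpha/\partial y^n=m_n$ and is positively homogeneous of degree zero in $y$. The branches $\theta_\alpha$ and $\theta_{\alpha+2\pi}$ have the same domain, and $\theta_{\alpha+2\pi}=\theta_\alpha+\theta^{\max}$. 5. For every branch, on its domain, $$\frac{\partial K}{\partial x^n}=\partial^*_nK+\frac KB\,g\,n\,q\,p_n+a^k{}_{nj}y^jl_k,\qquad \frac{\partial\theta}{\partial x^n}=\partial^*_n\theta-\frac1{K^2}TS^2p_n+a^k{}_{nj}y^j\frac{\partial\theta}{\partial y^k},$$ $$N^k_n=-l^k\frac{\partial K}{\partial x^n}-Km^k\Bigl(\frac{\partial\theta}{\partial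 x^n}-k_n\Bigr),\qquad d_nK=0,\qquad d_n\theta=-C_1p_n,$$ $$N^k_n=-\Bigl(\frac{gnq}{B}\,l^k+\Bigl(C_1-\frac1c\sqrt{\frac\nu q}\,\frac{S^2}{B}\Bigr)m^k\Bigr)Kp_n-l^k\partial^*_nK-Km^k\partial^*_n\theta-a^k{}_{nj}y^j,$$ and, with $P^*_n=\partial^*_n\theta+C_1p_n$, $$N^k_{nm}=\bigl(-l_mm^k+l^km_m+I\,m^km_m\bigr)P^*_n-l^k\partial^*_nl_m-m^k\partial^*_nm_m+\tfrac1{c^2}(b_mn^k-n_mb^k)p_n-a^k{}_{nm},$$ $$N^k_{nmi}=\frac1KZ_nm^km_mm_i,\qquad y_kN^k_{nmi}=0,$$ $$Z_n=-\frac34g(1-c^2)^2B^2\frac1{q^3\nu^3}\,(2b\nu+gc^2n^2)\,P^*_n+\frac12nc\,\partial^*_n\Bigl(g\,\frac1X\,\frac1{\sqrt{q\nu}}\Bigr).$$ 6. For every branch, on its domain, $M^n{}_{ij}=Km^nM_{ij}$, $\rho_k{}^n{}_{ij}=(l^nm_k-l_km^n)M_{ij}$, and $$\rho_{knij}=T\,(b_nn_k-b_kn_n)\,M_{ij}.$$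 7. Fix $x\in\Omega$ and $n$. The branches of $\partial\theta/\partial x^n$ are restrictions of one $C^\infty$ function of $y\in T_xM\setminus0$ if and only if $\partial\theta^{\max}/\partial x^n=0$ at $x$. The same holds for the coefficients $N^k_n$, $k=1,2$. The condition holds whenever $\partial g/\partial x^n=0$ at $x$. In particular, if $g$ is constant, then $\partial\theta/\partial x^n$ and $N^k_n$ are single-valued and globally $C^\infty$ in $y$ on $T_xM\setminus0$. -/

import Mathlib

open scoped ContDiff

namespace Finsleroid

/-- Coordinates `(x^1, x^2)` of a point of a chart of the surface `M`, and likewise components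
`(y^1, y^2)` of a tangent vector or `(w_1, w_2)` of a covector. -/
abbrev Pt := Fin 2 → ℝ

/-- The partial derivative `∂f/∂z^n` of a scalar function of two real variables. -/
noncomputable def pd (f : Pt → ℝ) (n : Fin 2) (z : Pt) : ℝ := fderiv ℝ f z (Pi.single n 1)

/-- `SmoothOn F W`: the function `F(x, y)` is of class `C^∞` on `W`, jointly in `(x, y)`. -/
def SmoothOn (F : Pt → Pt → ℝ) (W : Set (Pt × Pt)) : Prop :=
  ContDiffOn ℝ ∞ (fun z : Pt × Pt => F z.1 z.2) W

/-! ### Scalar model functions of the Finsleroid charge `γ` and of the values of `b`, `q` -/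

/-- `h = √(1 - g²/4)`. -/
noncomputable def hFun (γ : ℝ) : ℝ := √(1 - γ ^ 2 / 4)

/-- `G = g / h`. -/
noncomputable def GFun (γ : ℝ) : ℝ := γ / hFun γ

/-- `B = b² + g b q + q²`. -/
noncomputable def BFun (γ b q : ℝ) : ℝ := b ^ 2 + γ * b * q + q ^ 2

/-- `L = q + (g/2) b`. -/
noncomputable def LFun (γ b q : ℝ) : ℝ := q + γ / 2 * b

/-- `f = - arctan (G/2) + arctan (L/(hb))` for `b > 0`, the same plus `π` for `b < 0`, and the
common limit `π/2 - arctan (G/2)` of the two expressions for `b = 0` (where `L = q > 0`). -/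
noncomputable def fFun (γ b q : ℝ) : ℝ :=
  if 0 < b then -Real.arctan (GFun γ / 2) + Real.arctan (LFun γ b q / (hFun γ * b))
  else if b < 0 then
    Real.pi - Real.arctan (GFun γ / 2) + Real.arctan (LFun γ b q / (hFun γ * b))
  else Real.pi / 2 - Real.arctan (GFun γ / 2)

/-- `K = √B · exp (- G f / 2)`. -/
noncomputable def KFun (γ b q : ℝ) : ℝ :=
  √(BFun γ b q) * Real.exp (-(1 / 2) * GFun γ * fFun γ b q)

/-- `ν = q + (1 - c²) g b`. -/
noncomputable def nuFun (c γ b q : ℝ) : ℝ := q + (1 - c ^ 2) * γ * b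

/-- `1/X = 2 + (1 - c²) B / (q ν)`. -/
noncomputable def invXFun (c γ b q : ℝ) : ℝ :=
  2 + (1 - c ^ 2) * BFun γ b q / (q * nuFun c γ b q)

/-- The one-form `K⁻¹ m_n dy^n` evaluated on the velocity of the Riemannian unit circle
`s ↦ cos s · b̃^i + sin s · n^i` of a tangent space.  Along this circle `b = c cos s`,
`q = √(1 - b²)`, and the value is `√(ν/q) / B`. -/
noncomputable def angleDensity (c γ s : ℝ) : ℝ :=
  √(nuFun c γ (c * Real.cos s) √(1 - (c * Real.cos s) ^ 2) / √(1 - (c * Real.cos s) ^ 2)) /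
    BFun γ (c * Real.cos s) √(1 - (c * Real.cos s) ^ 2)

/-- The Finsleroid angle, as a function on the universal cover of the punctured tangent space:
the integral of `K⁻¹ m_n dy^n` from the direction of `b̃^i` to the direction of
`cos τ · b̃^i + sin τ · n^i`, where the real number `τ` counts turns. -/
noncomputable def angleLift (c γ τ : ℝ) : ℝ := ∫ s in (0 : ℝ)..τ, angleDensity c γ s

end Finsleroid

open Finsleroid

/-- The data of a Finsleroid-regular space with constant `c` over a coordinate domain `Ω` of a
surface: a smooth Riemannian metric `a_{ij}(x)`, a smooth orthonormal pair of covector fields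
`b̃_i(x)`, `n_i(x)`, the constant `c ∈ (0, 1)`, and the smooth scalar `g(x) ∈ (-2, 2)`. -/
structure FinsleroidSpace where
  Ω : Set Pt
  isOpen_Ω : IsOpen Ω
  a : Pt → Matrix (Fin 2) (Fin 2) ℝ
  bt : Pt → Pt
  n : Pt → Pt
  g : Pt → ℝ
  c : ℝ
  a_smooth : ∀ i j, ContDiffOn ℝ ∞ (fun x => a x i j) Ω
  a_posDef : ∀ x ∈ Ω, (a x).PosDef
  bt_smooth : ∀ i, ContDiffOn ℝ ∞ (fun x => bt x i) Ω
  n_smooth : ∀ i, ContDiffOn ℝ ∞ (fun x => n x i) Ω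
  bt_unit : ∀ x ∈ Ω, ∑ i, ∑ j, (a x)⁻¹ i j * bt x i * bt x j = 1
  n_unit : ∀ x ∈ Ω, ∑ i, ∑ j, (a x)⁻¹ i j * n x i * n x j = 1
  bt_orth_n : ∀ x ∈ Ω, ∑ i, ∑ j, (a x)⁻¹ i j * bt x i * n x j = 0
  c_pos : 0 < c
  c_lt_one : c < 1
  g_smooth : ContDiffOn ℝ ∞ g Ω
  g_mem : ∀ x ∈ Ω, g x ∈ Set.Ioo (-2 : ℝ) 2

namespace FinsleroidSpace

variable (s : FinsleroidSpace)

/-! ### Background Riemannian objects -/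

/-- `b̃^i = a^{ij} b̃_j`. -/
noncomputable def btUp (x : Pt) (i : Fin 2) : ℝ := ∑ j, (s.a x)⁻¹ i j * s.bt x j

/-- `n^i = a^{ij} n_j`. -/
noncomputable def nUp (x : Pt) (i : Fin 2) : ℝ := ∑ j, (s.a x)⁻¹ i j * s.n x j

/-- `b_i = c b̃_i`. -/
noncomputable def bLow (x : Pt) (i : Fin 2) : ℝ := s.c * s.bt x i

/-- `b^i = c b̃^i`. -/
noncomputable def bUp (x : Pt) (i : Fin 2) : ℝ := s.c * s.btUp x i

/-- The one-form `b̃ = b̃_i y^i`. -/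
noncomputable def btForm (x y : Pt) : ℝ := ∑ i, s.bt x i * y i

/-- The one-form `b = b_i y^i`. -/
noncomputable def b (x y : Pt) : ℝ := ∑ i, s.bLow x i * y i

/-- The one-form `n = n_i y^i`. -/
noncomputable def nForm (x y : Pt) : ℝ := ∑ i, s.n x i * y i

/-- `S² = a_{ij} y^i y^j`. -/
noncomputable def Ssq (x y : Pt) : ℝ := ∑ i, ∑ j, s.a x i j * y i * y j

/-- `q = √(S² - b²)`. -/
noncomputable def q (x y : Pt) : ℝ := √(s.Ssq x y - s.b x y ^ 2)

/-- The Christoffel symbols `a^k_{nj}` of `a_{ij}`. -/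
noncomputable def christoffel (k n j : Fin 2) (x : Pt) : ℝ :=
  (1 / 2) * ∑ l, (s.a x)⁻¹ k l *
    (pd (fun x' => s.a x' l j) n x + pd (fun x' => s.a x' l n) j x
      - pd (fun x' => s.a x' n j) l x)

/-- `p_n = c n^h ∇_n b̃_h = c n^h (∂b̃_h/∂x^n - a^k_{nh} b̃_k)`. -/
noncomputable def p (n : Fin 2) (x : Pt) : ℝ :=
  s.c * ∑ h, s.nUp x h *
    (pd (fun x' => s.bt x' h) n x - ∑ k, s.christoffel k n h x * s.bt x k)

/-! ### Families depending on the value `γ` of the charge, and the operator `∂*_n` -/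

/-- The function on the tangent bundle obtained from a family by putting `γ = g(x)`. -/
def atCharge (F : ℝ → Pt → Pt → ℝ) (x y : Pt) : ℝ := F (s.g x) x y

/-- `∂*_n = (∂g/∂x^n) ∂/∂g`, the derivative through the explicit dependence on `g` only. -/
noncomputable def dStar (F : ℝ → Pt → Pt → ℝ) (n : Fin 2) (x y : Pt) : ℝ :=
  pd s.g n x * deriv (fun γ => F γ x y) (s.g x)

/-- The metric function `K`, with the charge as a parameter. -/
noncomputable def KFam (γ : ℝ) (x y : Pt) : ℝ := KFun γ (s.b x y) (s.q x y)

/-- `l_i = ∂K/∂y^i`, with the charge as a parameter. -/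
noncomputable def lLowFam (i : Fin 2) (γ : ℝ) (x y : Pt) : ℝ := pd (s.KFam γ x) i y

/-- `T = (1/c) √(ν/q) K²/B`, with the charge as a parameter. -/
noncomputable def TFam (γ : ℝ) (x y : Pt) : ℝ :=
  1 / s.c * √(nuFun s.c γ (s.b x y) (s.q x y) / s.q x y) *
    (s.KFam γ x y ^ 2 / BFun γ (s.b x y) (s.q x y))

/-- `m_i = (1/K) T (b n_i - n b_i)`, with the charge as a parameter. -/
noncomputable def mLowFam (i : Fin 2) (γ : ℝ) (x y : Pt) : ℝ :=
  1 / s.KFam γ x y * s.TFam γ x y * (s.b x y * s.n x i - s.nForm x y * s.bLow x i)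

/-- `g (1/X) / √(q ν)`, with the charge as a parameter. -/
noncomputable def xFam (γ : ℝ) (x y : Pt) : ℝ :=
  γ * invXFun s.c γ (s.b x y) (s.q x y) / √(s.q x y * nuFun s.c γ (s.b x y) (s.q x y))

/-! ### Finsler objects of the metric function `K` -/

/-- The Finsleroid-regular metric function `K(x, y)`. -/
noncomputable def K : Pt → Pt → ℝ := s.atCharge s.KFam

/-- `B = b² + g b q + q²`. -/
noncomputable def B (x y : Pt) : ℝ := BFun (s.g x) (s.b x y) (s.q x y)

/-- `B₁ = (1/c²)(b + g c² q)`. -/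
noncomputable def B₁ (x y : Pt) : ℝ :=
  1 / s.c ^ 2 * (s.b x y + s.g x * s.c ^ 2 * s.q x y)

/-- `ν = q + (1 - c²) g b`. -/
noncomputable def nu (x y : Pt) : ℝ := nuFun s.c (s.g x) (s.b x y) (s.q x y)

/-- `1/X`. -/
noncomputable def invX (x y : Pt) : ℝ := invXFun s.c (s.g x) (s.b x y) (s.q x y)

/-- `T = (1/c) √(ν/q) K²/B`. -/
noncomputable def T : Pt → Pt → ℝ := s.atCharge s.TFam

/-- `l^k = y^k / K`. -/
noncomputable def lUp (k : Fin 2) (x y : Pt) : ℝ := y k / s.K x y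

/-- `l_k = ∂K/∂y^k`. -/
noncomputable def lLow (k : Fin 2) : Pt → Pt → ℝ := s.atCharge (s.lLowFam k)

/-- `y_k = K ∂K/∂y^k`. -/
noncomputable def yLow (k : Fin 2) (x y : Pt) : ℝ := s.K x y * pd (s.K x) k y

/-- The Finsler metric tensor `g_{ij} = ∂y_i/∂y^j`. -/
noncomputable def gMat (x y : Pt) : Matrix (Fin 2) (Fin 2) ℝ :=
  Matrix.of fun i j => pd (s.yLow i x) j y

/-- `A_{ijk} = K C_{ijk}`, where `C_{ijk} = (1/2) ∂g_{ij}/∂y^k` is the Cartan tensor. -/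
noncomputable def A (i j k : Fin 2) (x y : Pt) : ℝ :=
  s.K x y * ((1 / 2) * pd (fun y' => s.gMat x y' i j) k y)

/-- `C^n_{hk} = g^{nl} C_{lhk}`. -/
noncomputable def cartanUp (n h k : Fin 2) (x y : Pt) : ℝ :=
  ∑ l, (s.gMat x y)⁻¹ n l * ((1 / 2) * pd (fun y' => s.gMat x y' l h) k y)

/-- `m_k = (1/K) T (b n_k - n b_k)`. -/
noncomputable def mLow (k : Fin 2) : Pt → Pt → ℝ := s.atCharge (s.mLowFam k)

/-- `m^k = g^{kn} m_n`. -/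
noncomputable def mUp (k : Fin 2) (x y : Pt) : ℝ := ∑ n, (s.gMat x y)⁻¹ k n * s.mLow n x y

/-- The main scalar `I = - g c (1/(2X)) n / √(q ν)`. -/
noncomputable def I (x y : Pt) : ℝ :=
  -s.g x * s.c * (s.invX x y / 2) * (s.nForm x y / √(s.q x y * s.nu x y))

/-! ### The angle function

Like the polar angle of the Euclidean plane, the angle function is determined by
`K ∂θ/∂y^n = m_n` and `θ(x, b(x)) = 0` only up to continuation around the origin of the tangent
space.  For every real `α` we take the branch of it on the tangent space slit along the ray
opposite to the direction `cos α · b̃^i + sin α · n^i`.  Every value of the multivalued angle at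
every `y ≠ 0` is taken by such a branch that is defined around `y`. -/

/-- The complex number `(b̃ + i n) exp (-i α)`. -/
noncomputable def frameCoord (α : ℝ) (x y : Pt) : ℂ :=
  ((s.btForm x y : ℂ) + Complex.I * (s.nForm x y : ℂ)) * Complex.exp (-(Complex.I * (α : ℂ)))

/-- The tangent space at `x` without the origin and the ray opposite to the direction `α`. -/
def sector (α : ℝ) (x : Pt) : Set Pt := {y | s.frameCoord α x y ∈ Complex.slitPlane}

/-- The Riemannian polar angle in `(α - π, α + π)` of `y` in the frame `(b̃^i, n^i)`. -/
noncomputable def polar (α : ℝ) (x y : Pt) : ℝ := α + (s.frameCoord α x y).arg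

/-- The branch `α` of the angle function, with the charge as a parameter. -/
noncomputable def θFam (α : ℝ) (γ : ℝ) (x y : Pt) : ℝ := angleLift s.c γ (s.polar α x y)

/-- The branch `α` of the angle function `θ(x, y)`. -/
noncomputable def θ (α : ℝ) : Pt → Pt → ℝ := s.atCharge (s.θFam α)

/-- `θ^max(x)`, the increment of the angle over a full turn. -/
noncomputable def θmax (x : Pt) : ℝ := angleLift s.c (s.g x) (2 * Real.pi)

/-- The slit tangent bundle over `Ω`. -/
def slitBundle : Set (Pt × Pt) := {z | z.1 ∈ s.Ω ∧ z.2 ≠ 0}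

/-- The domain of the branch `α`. -/
def branchDomain (α : ℝ) : Set (Pt × Pt) := {z | z.1 ∈ s.Ω ∧ z.2 ∈ s.sector α z.1}

/-! ### The connection coefficients

`C₁` is a real constant, and `α` indicates the branch of the angle function. -/

/-- `U = (C₁/c) √(q/ν)`. -/
noncomputable def U (C₁ : ℝ) (x y : Pt) : ℝ := C₁ * (1 / s.c) * √(s.q x y / s.nu x y)

/-- `∂*_n θ`. -/
noncomputable def dStarθ (α : ℝ) (n : Fin 2) : Pt → Pt → ℝ := s.dStar (s.θFam α) n

/-- The coefficients
`N^k_n = [((1/c²) b - U c² B₁) n^k + n (U - 1/c²) b^k] p_n - l^k ∂*_n K - K m^k ∂*_n θ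
- a^k_{nj} y^j`. -/
noncomputable def N (C₁ α : ℝ) (k n : Fin 2) (x y : Pt) : ℝ :=
  ((1 / s.c ^ 2 * s.b x y - s.U C₁ x y * s.c ^ 2 * s.B₁ x y) * s.nUp x k
      + s.nForm x y * (s.U C₁ x y - 1 / s.c ^ 2) * s.bUp x k) * s.p n x
    - s.lUp k x y * s.dStar s.KFam n x y
    - s.K x y * s.mUp k x y * s.dStarθ α n x y
    - ∑ j, s.christoffel k n j x * y j

/-- `d_n W = ∂W/∂x^n + N^k_n ∂W/∂y^k`. -/
noncomputable def d (C₁ α : ℝ) (n : Fin 2) (W : Pt → Pt → ℝ) (x y : Pt) : ℝ :=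
  pd (fun x' => W x' y) n x + ∑ k, s.N C₁ α k n x y * pd (W x) k y

/-- `N^k_{nm} = ∂N^k_n/∂y^m`. -/
noncomputable def N1 (C₁ α : ℝ) (k n m : Fin 2) (x y : Pt) : ℝ := pd (s.N C₁ α k n x) m y

/-- `N^k_{nmi} = ∂N^k_{nm}/∂y^i`. -/
noncomputable def N2 (C₁ α : ℝ) (k n m i : Fin 2) (x y : Pt) : ℝ :=
  pd (s.N1 C₁ α k n m x) i y

/-- The covector field `k_n = - C₁ p_n`. -/
noncomputable def kField (C₁ : ℝ) (n : Fin 2) (x : Pt) : ℝ := -C₁ * s.p n x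

/-- `P*_n = ∂*_n θ + C₁ p_n`. -/
noncomputable def PStar (C₁ α : ℝ) (n : Fin 2) (x y : Pt) : ℝ :=
  s.dStarθ α n x y + C₁ * s.p n x

/-- `Z_n = - (3/4) g (1 - c²)² B² (1/(q³ν³)) (2bν + g c² n²) P*_n
+ (1/2) n c ∂*_n (g (1/X) (1/√(qν)))`. -/
noncomputable def Zn (C₁ α : ℝ) (n : Fin 2) (x y : Pt) : ℝ :=
  -(3 / 4) * s.g x * (1 - s.c ^ 2) ^ 2 * s.B x y ^ 2 * (1 / (s.q x y ^ 3 * s.nu x y ^ 3)) *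
      (2 * s.b x y * s.nu x y + s.g x * s.c ^ 2 * s.nForm x y ^ 2) * s.PStar C₁ α n x y
    + (1 / 2) * s.nForm x y * s.c * s.dStar s.xFam n x y

/-! ### Curvature -/

/-- The connection coefficients `D^k_{in} = - N^k_{in}`. -/
noncomputable def D (C₁ α : ℝ) (k i n : Fin 2) (x y : Pt) : ℝ := -s.N1 C₁ α k i n x y

/-- `M^n_{ij} = d_i N^n_j - d_j N^n_i`. -/
noncomputable def MUp (C₁ α : ℝ) (n i j : Fin 2) (x y : Pt) : ℝ :=
  s.d C₁ α i (s.N C₁ α n j) x y - s.d C₁ α j (s.N C₁ α n i) x y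

/-- `E_k^n_{ij} = d_i D^n_{jk} - d_j D^n_{ik} + D^m_{jk} D^n_{im} - D^m_{ik} D^n_{jm}`. -/
noncomputable def E (C₁ α : ℝ) (k n i j : Fin 2) (x y : Pt) : ℝ :=
  s.d C₁ α i (s.D C₁ α n j k) x y - s.d C₁ α j (s.D C₁ α n i k) x y
    + ∑ m, s.D C₁ α m j k x y * s.D C₁ α n i m x y
    - ∑ m, s.D C₁ α m i k x y * s.D C₁ α n j m x y

/-- The curvature tensor `ρ_k^n_{ij} = E_k^n_{ij} - M^h_{ij} C^n_{hk}`. -/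
noncomputable def rho (C₁ α : ℝ) (k n i j : Fin 2) (x y : Pt) : ℝ :=
  s.E C₁ α k n i j x y - ∑ h, s.MUp C₁ α h i j x y * s.cartanUp n h k x y

/-- `ρ_{knij} = g_{nm} ρ_k^m_{ij}`. -/
noncomputable def rhoLow (C₁ α : ℝ) (k n i j : Fin 2) (x y : Pt) : ℝ :=
  ∑ m, s.gMat x y n m * s.rho C₁ α k m i j x y

/-- `M_{ij} = ∂k_j/∂x^i - ∂k_i/∂x^j`. -/
noncomputable def Mij (C₁ : ℝ) (i j : Fin 2) (x : Pt) : ℝ :=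
  pd (s.kField C₁ j) i x - pd (s.kField C₁ i) j x

end FinsleroidSpace

/-!
For a fixed `x` let `(u, w)` be the coordinates of `y` in the orthonormal frame `(b̃^i, n^i)`, so
that `b = c u` and `q² = (1 - c²) u² + w²`, and let `γ` be the value of the charge `g`. The three
cases in the definition of `f` are a single branch of the argument of a nonvanishing complex number
(`fFun_eq_arg`), so `K` is smooth away from the origin, with
`d log K = ((u + γ c q) du + w dw) / B` (`hasDirDeriv_KM`). The angle is the primitive `Θ(γ, τ)`
taken at the polar angle `τ` of `(u, w)`; it is jointly smooth in `γ` and `τ`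
(`contDiffAt_angleLift`), and `K dθ = m` (`hasDirDeriv_angle`). Thus `log K` and `θ` behave like
the logarithm of the radius and the polar angle: `l_k`, `m_k` is an orthonormal coframe of `g_{ij}`,
and differentiation in `y` closes up on it,

* `K ∂l_i/∂y^j = m_i m_j`,
* `K ∂m_i/∂y^j = -l_i m_j + I m_i m_j`,
* `K ∂I/∂y^j = I' m_j`, where `I'` is an explicit function.

These are `lLowFam_hasDirDeriv`, `mLowFam_hasDirDeriv` and `IFam_hasDirDeriv`, proved for every value
of the charge, hence they can be differentiated by `∂*_n`, which commutes with `∂/∂y`. After clearing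
denominators each of them is a polynomial identity modulo the relations that define `q`, `B`, `ν`.

In `x`, an orthonormal frame of a Riemannian metric in dimension two can only rotate:
`∇_n b̃_h = (p_n / c) n_h` and `∇_n n_h = -(p_n / c) b̃_h` (`nabla_frame_eq`). This gives the
derivatives of `K` and `θ` in `x`, and `N^k_n` turns out to be the unique vector with `d_n K = 0` and
`d_n θ = k_n` (`N_eq_gradient`). Differentiating `N` twice in `y` by the rules above, all terms cancel
except `K N^k_{nmi} = (I' P*_n - ∂*_n I) m^k m_m m_i`, and the bracket is `Z_n` (`N1_hasDirDeriv`).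

The commutator of `d_i` and `d_j` is the vertical field `M^k_{ij} ∂/∂y^k` (`d_commutator`). Applied to
`K` and to `θ`, where `d_n K` and `d_n θ` do not depend on `y`, it gives the components of `M` along
`l` and `m`, that is `M^n_{ij} = K m^n M_{ij}` (`MUp_eq`). Since `E_k^n_{ij} = -∂M^n_{ij}/∂y^k`
(`E_eq`), the curvature tensor follows.

Two determinations of `∂*_n θ` at a point differ by an integer multiple of `∂θ^max/∂x^n`
(`dStarθ_branch`), and all other terms in `∂θ/∂x^n` and `N^k_n` do not depend on the branch. If
`∂θ^max/∂x^n = 0`, the smooth branches glue; otherwise the branches `α` and `α + 2π` disagree.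
-/

namespace Finsleroid

/-! ### Directional derivatives -/

section DirDeriv

variable {E : Type*} [NormedAddCommGroup E] [NormedSpace ℝ E]

/-- The function `f` is differentiable at `z`, and its derivative at `z` in the direction `e`
is `v`. -/
def HasDirDeriv (f : E → ℝ) (z e : E) (v : ℝ) : Prop :=
  DifferentiableAt ℝ f z ∧ fderiv ℝ f z e = v

variable {f f₁ f₂ : E → ℝ} {z e : E} {v v₁ v₂ : ℝ}

theorem HasDirDeriv.congr_val (h : HasDirDeriv f z e v₁) (hv : v₁ = v₂) :
    HasDirDeriv f z e v₂ := hv ▸ h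

theorem HasDirDeriv.congr_fun (h : HasDirDeriv f₁ z e v) (hf : f₂ =ᶠ[nhds z] f₁) :
    HasDirDeriv f₂ z e v :=
  ⟨hf.differentiableAt_iff.2 h.1, by rw [hf.fderiv_eq]; exact h.2⟩

theorem HasDirDeriv.unique (h₁ : HasDirDeriv f z e v₁) (h₂ : HasDirDeriv f z e v₂) : v₁ = v₂ :=
  h₁.2.symm.trans h₂.2

theorem hasDirDeriv_const (a : ℝ) : HasDirDeriv (fun _ : E => a) z e 0 :=
  ⟨differentiableAt_const a, by simp⟩

theorem HasDirDeriv.add (h₁ : HasDirDeriv f₁ z e v₁) (h₂ : HasDirDeriv f₂ z e v₂) :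
    HasDirDeriv (fun z => f₁ z + f₂ z) z e (v₁ + v₂) :=
  ⟨h₁.1.add h₂.1, by rw [fderiv_fun_add h₁.1 h₂.1, ← h₁.2, ← h₂.2]; rfl⟩

theorem HasDirDeriv.neg (h₁ : HasDirDeriv f₁ z e v₁) :
    HasDirDeriv (fun z => -f₁ z) z e (-v₁) :=
  ⟨h₁.1.neg, by rw [fderiv_fun_neg, ← h₁.2]; rfl⟩

theorem HasDirDeriv.sub (h₁ : HasDirDeriv f₁ z e v₁) (h₂ : HasDirDeriv f₂ z e v₂) :
    HasDirDeriv (fun z => f₁ z - f₂ z) z e (v₁ - v₂) :=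
  ⟨h₁.1.sub h₂.1, by rw [fderiv_fun_sub h₁.1 h₂.1, ← h₁.2, ← h₂.2]; rfl⟩

theorem HasDirDeriv.mul (h₁ : HasDirDeriv f₁ z e v₁) (h₂ : HasDirDeriv f₂ z e v₂) :
    HasDirDeriv (fun z => f₁ z * f₂ z) z e (v₁ * f₂ z + f₁ z * v₂) :=
  ⟨h₁.1.mul h₂.1, by
    rw [fderiv_fun_mul h₁.1 h₂.1, ← h₁.2, ← h₂.2]
    simp only [add_apply, smul_apply, smul_eq_mul]; ring⟩

theorem HasDirDeriv.const_mul (a : ℝ) (h₁ : HasDirDeriv f₁ z e v₁) :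
    HasDirDeriv (fun z => a * f₁ z) z e (a * v₁) :=
  ((hasDirDeriv_const a).mul h₁).congr_val (by ring)

theorem HasDirDeriv.mul_const (h₁ : HasDirDeriv f₁ z e v₁) (a : ℝ) :
    HasDirDeriv (fun z => f₁ z * a) z e (v₁ * a) :=
  (h₁.mul (hasDirDeriv_const a)).congr_val (by ring)

theorem HasDirDeriv.comp_hasDerivAt {φ : ℝ → ℝ} {φ' : ℝ} (h₁ : HasDirDeriv f₁ z e v₁)
    (h : HasDerivAt φ φ' (f₁ z)) : HasDirDeriv (fun z => φ (f₁ z)) z e (φ' * v₁) := by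
  have H := h.comp_hasFDerivAt z h₁.1.hasFDerivAt
  exact ⟨H.differentiableAt, by
    have := H.fderiv
    simp only [Function.comp_def] at this
    rw [this, ← h₁.2]; rfl⟩

theorem HasDirDeriv.inv (h₁ : HasDirDeriv f₁ z e v₁) (h : f₁ z ≠ 0) :
    HasDirDeriv (fun z => (f₁ z)⁻¹) z e (-v₁ / f₁ z ^ 2) :=
  (h₁.comp_hasDerivAt (hasDerivAt_inv h)).congr_val (by ring)

theorem HasDirDeriv.div (h₁ : HasDirDeriv f₁ z e v₁) (h₂ : HasDirDeriv f₂ z e v₂)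
    (h : f₂ z ≠ 0) :
    HasDirDeriv (fun z => f₁ z / f₂ z) z e ((v₁ * f₂ z - f₁ z * v₂) / f₂ z ^ 2) :=
  ((h₁.mul (h₂.inv h)).congr_val (by field_simp; ring)).congr_fun
    (Filter.Eventually.of_forall fun _ => div_eq_mul_inv _ _)

theorem HasDirDeriv.pow (h₁ : HasDirDeriv f₁ z e v₁) (n : ℕ) :
    HasDirDeriv (fun z => f₁ z ^ n) z e (n * f₁ z ^ (n - 1) * v₁) :=
  h₁.comp_hasDerivAt (hasDerivAt_pow n _)

theorem HasDirDeriv.sqrt (h₁ : HasDirDeriv f₁ z e v₁) (h : f₁ z ≠ 0) :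
    HasDirDeriv (fun z => √(f₁ z)) z e (v₁ / (2 * √(f₁ z))) :=
  (h₁.comp_hasDerivAt (Real.hasDerivAt_sqrt h)).congr_val (by ring)

theorem HasDirDeriv.sum {ι : Type*} (u : Finset ι) {F : ι → E → ℝ} {V : ι → ℝ}
    (h : ∀ i ∈ u, HasDirDeriv (F i) z e (V i)) :
    HasDirDeriv (fun z => ∑ i ∈ u, F i z) z e (∑ i ∈ u, V i) := by
  refine ⟨DifferentiableAt.fun_sum fun i hi => (h i hi).1, ?_⟩
  rw [fderiv_fun_sum fun i hi => (h i hi).1, sum_apply]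
  exact Finset.sum_congr rfl fun i hi => (h i hi).2

theorem hasDirDeriv_of_hasFDerivAt_comp {E' : Type*} [NormedAddCommGroup E'] [NormedSpace ℝ E']
    {F : E' → ℝ} {φ : E → E'} {φ' : E →L[ℝ] E'} (hF : DifferentiableAt ℝ F (φ z))
    (hφ : HasFDerivAt φ φ' z) :
    HasDirDeriv (fun z => F (φ z)) z e (fderiv ℝ F (φ z) (φ' e)) := by
  have H := hF.hasFDerivAt.comp z hφ
  refine ⟨H.differentiableAt, ?_⟩
  have := H.fderiv
  simp only [Function.comp_def] at this
  rw [this]; rfl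

theorem hasDirDeriv_coord (n m : Fin 2) (y : Pt) :
    HasDirDeriv (fun y : Pt => y m) y (Pi.single n 1) (if m = n then 1 else 0) := by
  refine ⟨by fun_prop, ?_⟩
  have : HasFDerivAt (fun y : Pt => y m) (ContinuousLinearMap.proj m : Pt →L[ℝ] ℝ) y :=
    (ContinuousLinearMap.proj m : Pt →L[ℝ] ℝ).hasFDerivAt
  rw [this.fderiv]
  simp [Pi.single_apply]

/-- Second directional derivatives of a smooth function commute. -/
theorem fderiv_fderiv_comm {f : E → ℝ} {z : E} (hf : ContDiffAt ℝ ∞ f z) (v w : E) :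
    fderiv ℝ (fun z => fderiv ℝ f z v) z w = fderiv ℝ (fun z => fderiv ℝ f z w) z v := by
  have hd : DifferentiableAt ℝ (fderiv ℝ f) z :=
    (hf.fderiv_right (m := ∞) (by simp)).differentiableAt (by simp)
  have hs := hf.isSymmSndFDerivAt (by simpa using WithTop.coe_le_coe.2 (le_top : (2 : ℕ∞) ≤ ⊤))
  have H : ∀ a : E, HasFDerivAt (fun z => fderiv ℝ f z a)
      ((ContinuousLinearMap.apply ℝ ℝ a).comp (fderiv ℝ (fderiv ℝ f) z)) z := fun a =>
    (ContinuousLinearMap.apply ℝ ℝ a).hasFDerivAt.comp z hd.hasFDerivAt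
  rw [(H v).fderiv, (H w).fderiv]
  exact hs w v

theorem contDiffOn_fderiv_apply {f : E → ℝ} {W : Set E} (hf : ContDiffOn ℝ ∞ f W)
    (hW : IsOpen W) (v : E) : ContDiffOn ℝ ∞ (fun z => fderiv ℝ f z v) W :=
  (hf.fderiv_of_isOpen hW (m := ∞) (by simp)).clm_apply contDiffOn_const

end DirDeriv

theorem HasDirDeriv.pd {f : Pt → ℝ} {n : Fin 2} {z : Pt} {v : ℝ}
    (h : HasDirDeriv f z (Pi.single n 1) v) : pd f n z = v := h.2

theorem hasDirDeriv_pd {f : Pt → ℝ} {n : Fin 2} {z : Pt} (h : DifferentiableAt ℝ f z) :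
    HasDirDeriv f z (Pi.single n 1) (Finsleroid.pd f n z) := ⟨h, rfl⟩

theorem HasDirDeriv.deriv {f : ℝ → ℝ} {z v : ℝ} (h : HasDirDeriv f z 1 v) : deriv f z = v := h.2

/-! ### Partial derivatives of smooth functions of two points -/

section Joint

variable {F : Pt → Pt → ℝ} {W : Set (Pt × Pt)} {x y : Pt}

theorem SmoothOn.contDiffAt (h : SmoothOn F W) (hW : IsOpen W) (hz : (x, y) ∈ W) :
    ContDiffAt ℝ ∞ (fun z : Pt × Pt => F z.1 z.2) (x, y) :=
  ContDiffOn.contDiffAt h (hW.mem_nhds hz)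

theorem SmoothOn.hasDirDeriv_fst (h : SmoothOn F W) (hW : IsOpen W) (hz : (x, y) ∈ W) (e : Pt) :
    HasDirDeriv (fun x' => F x' y) x e
      (fderiv ℝ (fun z : Pt × Pt => F z.1 z.2) (x, y) (e, 0)) :=
  hasDirDeriv_of_hasFDerivAt_comp (F := fun z : Pt × Pt => F z.1 z.2) (φ := fun x' => (x', y))
    ((h.contDiffAt hW hz).differentiableAt (by simp)) ((hasFDerivAt_id x).prodMk
      (hasFDerivAt_const y x))

theorem SmoothOn.hasDirDeriv_snd (h : SmoothOn F W) (hW : IsOpen W) (hz : (x, y) ∈ W) (e : Pt) :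
    HasDirDeriv (F x) y e (fderiv ℝ (fun z : Pt × Pt => F z.1 z.2) (x, y) (0, e)) :=
  hasDirDeriv_of_hasFDerivAt_comp (F := fun z : Pt × Pt => F z.1 z.2) (φ := fun y' => (x, y'))
    ((h.contDiffAt hW hz).differentiableAt (by simp)) ((hasFDerivAt_const x y).prodMk
      (hasFDerivAt_id y))

theorem SmoothOn.differentiableAt_fst (h : SmoothOn F W) (hW : IsOpen W) (hz : (x, y) ∈ W) :
    DifferentiableAt ℝ (fun x' => F x' y) x := (h.hasDirDeriv_fst hW hz 0).1

theorem SmoothOn.differentiableAt_snd (h : SmoothOn F W) (hW : IsOpen W) (hz : (x, y) ∈ W) :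
    DifferentiableAt ℝ (F x) y := (h.hasDirDeriv_snd hW hz 0).1

theorem SmoothOn.congr {F' : Pt → Pt → ℝ} (h : SmoothOn F W)
    (hF : ∀ z ∈ W, F' z.1 z.2 = F z.1 z.2) : SmoothOn F' W := ContDiffOn.congr h hF

theorem SmoothOn.fderiv_apply (h : SmoothOn F W) (hW : IsOpen W) (v : Pt × Pt) :
    SmoothOn (fun x y => fderiv ℝ (fun z : Pt × Pt => F z.1 z.2) (x, y) v) W :=
  contDiffOn_fderiv_apply h hW v

theorem SmoothOn.pd_fst (h : SmoothOn F W) (hW : IsOpen W) (n : Fin 2) :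
    SmoothOn (fun x y => pd (fun x' => F x' y) n x) W :=
  (h.fderiv_apply hW _).congr fun _ hz => (h.hasDirDeriv_fst hW hz _).2

theorem SmoothOn.pd_snd (h : SmoothOn F W) (hW : IsOpen W) (n : Fin 2) :
    SmoothOn (fun x y => pd (F x) n y) W :=
  (h.fderiv_apply hW _).congr fun _ hz => (h.hasDirDeriv_snd hW hz _).2

theorem SmoothOn.add {F₁ F₂ : Pt → Pt → ℝ} (h₁ : SmoothOn F₁ W) (h₂ : SmoothOn F₂ W) :
    SmoothOn (fun x y => F₁ x y + F₂ x y) W := ContDiffOn.add h₁ h₂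

theorem SmoothOn.sub {F₁ F₂ : Pt → Pt → ℝ} (h₁ : SmoothOn F₁ W) (h₂ : SmoothOn F₂ W) :
    SmoothOn (fun x y => F₁ x y - F₂ x y) W := ContDiffOn.sub h₁ h₂

theorem SmoothOn.neg {F₁ : Pt → Pt → ℝ} (h₁ : SmoothOn F₁ W) :
    SmoothOn (fun x y => -F₁ x y) W := ContDiffOn.neg h₁

theorem SmoothOn.mul {F₁ F₂ : Pt → Pt → ℝ} (h₁ : SmoothOn F₁ W) (h₂ : SmoothOn F₂ W) :
    SmoothOn (fun x y => F₁ x y * F₂ x y) W := ContDiffOn.mul h₁ h₂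

theorem SmoothOn.div {F₁ F₂ : Pt → Pt → ℝ} (h₁ : SmoothOn F₁ W) (h₂ : SmoothOn F₂ W)
    (h : ∀ z ∈ W, F₂ z.1 z.2 ≠ 0) :
    SmoothOn (fun x y => F₁ x y / F₂ x y) W := ContDiffOn.div h₁ h₂ h

theorem SmoothOn.pow {F₁ : Pt → Pt → ℝ} (h₁ : SmoothOn F₁ W) (n : ℕ) :
    SmoothOn (fun x y => F₁ x y ^ n) W := ContDiffOn.pow h₁ n

theorem SmoothOn.sqrt {F₁ : Pt → Pt → ℝ} (h₁ : SmoothOn F₁ W) (h : ∀ z ∈ W, F₁ z.1 z.2 ≠ 0) :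
    SmoothOn (fun x y => √(F₁ x y)) W := ContDiffOn.sqrt h₁ h

theorem SmoothOn.sum {ι : Type*} (u : Finset ι) {Φ : ι → Pt → Pt → ℝ}
    (h : ∀ i ∈ u, SmoothOn (Φ i) W) : SmoothOn (fun x y => ∑ i ∈ u, Φ i x y) W :=
  ContDiffOn.sum h

theorem smoothOn_const (a : ℝ) : SmoothOn (fun _ _ => a) W := contDiffOn_const

theorem smoothOn_coord (k : Fin 2) : SmoothOn (fun _ y => y k) W := by
  unfold SmoothOn; fun_prop

theorem SmoothOn.mono {W' : Set (Pt × Pt)} (h : SmoothOn F W) (hW : W' ⊆ W) : SmoothOn F W' :=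
  ContDiffOn.mono h hW

/-- A function of `x` alone. -/
theorem smoothOn_of_fst {f : Pt → ℝ} {Ω : Set Pt} (hf : ContDiffOn ℝ ∞ f Ω)
    (h : ∀ z ∈ W, z.1 ∈ Ω) : SmoothOn (fun x _ => f x) W :=
  hf.comp contDiffOn_fst h

theorem eventually_fst (hW : IsOpen W) (hz : (x, y) ∈ W) : ∀ᶠ x' in nhds x, (x', y) ∈ W :=
  (Continuous.prodMk_left y).continuousAt.eventually (hW.mem_nhds hz)

theorem eventually_snd (hW : IsOpen W) (hz : (x, y) ∈ W) : ∀ᶠ y' in nhds y, (x, y') ∈ W :=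
  (Continuous.prodMk_right x).continuousAt.eventually (hW.mem_nhds hz)

/-- A point of `W` stays in `W` when either of its components varies a little, so partial
derivatives only see the values in `W`. -/
theorem pd_fst_congr {F' : Pt → Pt → ℝ} (hW : IsOpen W) (hz : (x, y) ∈ W)
    (h : ∀ z ∈ W, F z.1 z.2 = F' z.1 z.2) (n : Fin 2) :
    pd (fun x' => F x' y) n x = pd (fun x' => F' x' y) n x := by
  unfold pd
  rw [Filter.EventuallyEq.fderiv_eq]
  filter_upwards [eventually_fst hW hz] with x' hx' using h _ hx'

theorem pd_snd_congr {F' : Pt → Pt → ℝ} (hW : IsOpen W) (hz : (x, y) ∈ W)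
    (h : ∀ z ∈ W, F z.1 z.2 = F' z.1 z.2) (n : Fin 2) : pd (F x) n y = pd (F' x) n y := by
  unfold pd
  rw [Filter.EventuallyEq.fderiv_eq]
  filter_upwards [eventually_snd hW hz] with y' hy' using h _ hy'

theorem SmoothOn.pd_fst_fst (h : SmoothOn F W) (hW : IsOpen W) (hz : (x, y) ∈ W) (i j : Fin 2) :
    pd (fun x' => pd (fun x'' => F x'' y) j x') i x =
      pd (fun x' => pd (fun x'' => F x'' y) i x') j x := by
  have key : ∀ i j : Fin 2, pd (fun x' => pd (fun x'' => F x'' y) j x') i x =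
      fderiv ℝ (fun z => fderiv ℝ (fun z : Pt × Pt => F z.1 z.2) z (Pi.single j 1, 0)) (x, y)
        (Pi.single i 1, 0) := fun i j => by
    rw [pd_fst_congr (F := fun x y => pd (fun x'' => F x'' y) j x) (F' := fun x y =>
      fderiv ℝ (fun z : Pt × Pt => F z.1 z.2) (x, y) (Pi.single j 1, 0)) hW hz
      fun z hz => (h.hasDirDeriv_fst hW hz _).2]
    exact ((h.fderiv_apply hW _).hasDirDeriv_fst hW hz _).2
  rw [key, key, fderiv_fderiv_comm (h.contDiffAt hW hz)]

theorem SmoothOn.pd_snd_snd (h : SmoothOn F W) (hW : IsOpen W) (hz : (x, y) ∈ W) (i j : Fin 2) :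
    pd (fun y' => pd (F x) j y') i y = pd (fun y' => pd (F x) i y') j y := by
  have key : ∀ i j : Fin 2, pd (fun y' => pd (F x) j y') i y =
      fderiv ℝ (fun z => fderiv ℝ (fun z : Pt × Pt => F z.1 z.2) z (0, Pi.single j 1)) (x, y)
        (0, Pi.single i 1) := fun i j => by
    rw [pd_snd_congr (F := fun x y => pd (F x) j y) (F' := fun x y =>
      fderiv ℝ (fun z : Pt × Pt => F z.1 z.2) (x, y) (0, Pi.single j 1)) hW hz
      fun z hz => (h.hasDirDeriv_snd hW hz _).2]
    exact ((h.fderiv_apply hW _).hasDirDeriv_snd hW hz _).2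
  rw [key, key, fderiv_fderiv_comm (h.contDiffAt hW hz)]

theorem SmoothOn.pd_fst_snd (h : SmoothOn F W) (hW : IsOpen W) (hz : (x, y) ∈ W) (i j : Fin 2) :
    pd (fun x' => pd (F x') j y) i x = pd (fun y' => pd (fun x' => F x' y') i x) j y := by
  rw [pd_fst_congr (F := fun x y => pd (F x) j y) (F' := fun x y =>
      fderiv ℝ (fun z : Pt × Pt => F z.1 z.2) (x, y) (0, Pi.single j 1)) hW hz
      fun z hz => (h.hasDirDeriv_snd hW hz _).2,
    pd_snd_congr (F := fun x y => pd (fun x' => F x' y) i x) (F' := fun x y =>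
      fderiv ℝ (fun z : Pt × Pt => F z.1 z.2) (x, y) (Pi.single i 1, 0)) hW hz
      fun z hz => (h.hasDirDeriv_fst hW hz _).2]
  refine ((h.fderiv_apply hW _).hasDirDeriv_fst hW hz _).2.trans ?_
  refine Eq.trans ?_ ((h.fderiv_apply hW _).hasDirDeriv_snd hW hz _).2.symm
  exact fderiv_fderiv_comm (h.contDiffAt hW hz) _ _

end Joint

/-! ### Families depending on the charge -/

/-- The family `F γ x y` is smooth in `(γ, x, y)` for `γ ∈ (-2, 2)` and `(x, y) ∈ W`. -/
def FamSmoothOn (F : ℝ → Pt → Pt → ℝ) (W : Set (Pt × Pt)) : Prop :=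
  ContDiffOn ℝ ∞ (fun z : ℝ × Pt × Pt => F z.1 z.2.1 z.2.2) (Set.Ioo (-2) 2 ×ˢ W)

section Family

variable {F : ℝ → Pt → Pt → ℝ} {W : Set (Pt × Pt)} {γ : ℝ} {x y : Pt}

theorem isOpen_famDomain (hW : IsOpen W) : IsOpen (Set.Ioo (-2 : ℝ) 2 ×ˢ W) :=
  isOpen_Ioo.prod hW

theorem FamSmoothOn.contDiffAt (h : FamSmoothOn F W) (hW : IsOpen W) (hγ : γ ∈ Set.Ioo (-2) 2)
    (hz : (x, y) ∈ W) :
    ContDiffAt ℝ ∞ (fun z : ℝ × Pt × Pt => F z.1 z.2.1 z.2.2) (γ, x, y) :=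
  ContDiffOn.contDiffAt h ((isOpen_famDomain hW).mem_nhds ⟨hγ, hz⟩)

theorem FamSmoothOn.hasDirDeriv_charge (h : FamSmoothOn F W) (hW : IsOpen W)
    (hγ : γ ∈ Set.Ioo (-2) 2) (hz : (x, y) ∈ W) :
    HasDirDeriv (fun γ => F γ x y) γ 1
      (fderiv ℝ (fun z : ℝ × Pt × Pt => F z.1 z.2.1 z.2.2) (γ, x, y) (1, 0, 0)) :=
  hasDirDeriv_of_hasFDerivAt_comp (F := fun z : ℝ × Pt × Pt => F z.1 z.2.1 z.2.2)
    (φ := fun γ => (γ, x, y)) ((h.contDiffAt hW hγ hz).differentiableAt (by simp))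
    ((hasFDerivAt_id γ).prodMk (hasFDerivAt_const (x, y) γ))

theorem FamSmoothOn.hasDirDeriv_fst (h : FamSmoothOn F W) (hW : IsOpen W)
    (hγ : γ ∈ Set.Ioo (-2) 2) (hz : (x, y) ∈ W) (e : Pt) :
    HasDirDeriv (fun x' => F γ x' y) x e
      (fderiv ℝ (fun z : ℝ × Pt × Pt => F z.1 z.2.1 z.2.2) (γ, x, y) (0, e, 0)) :=
  hasDirDeriv_of_hasFDerivAt_comp (F := fun z : ℝ × Pt × Pt => F z.1 z.2.1 z.2.2)
    (φ := fun x' => (γ, x', y)) ((h.contDiffAt hW hγ hz).differentiableAt (by simp))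
    ((hasFDerivAt_const γ x).prodMk ((hasFDerivAt_id x).prodMk (hasFDerivAt_const y x)))

theorem FamSmoothOn.hasDirDeriv_snd (h : FamSmoothOn F W) (hW : IsOpen W)
    (hγ : γ ∈ Set.Ioo (-2) 2) (hz : (x, y) ∈ W) (e : Pt) :
    HasDirDeriv (F γ x) y e
      (fderiv ℝ (fun z : ℝ × Pt × Pt => F z.1 z.2.1 z.2.2) (γ, x, y) (0, 0, e)) :=
  hasDirDeriv_of_hasFDerivAt_comp (F := fun z : ℝ × Pt × Pt => F z.1 z.2.1 z.2.2)
    (φ := fun y' => (γ, x, y')) ((h.contDiffAt hW hγ hz).differentiableAt (by simp))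
    ((hasFDerivAt_const γ y).prodMk ((hasFDerivAt_const x y).prodMk (hasFDerivAt_id y)))

theorem FamSmoothOn.differentiableAt_charge (h : FamSmoothOn F W) (hW : IsOpen W)
    (hγ : γ ∈ Set.Ioo (-2) 2) (hz : (x, y) ∈ W) : DifferentiableAt ℝ (fun γ => F γ x y) γ :=
  (h.hasDirDeriv_charge hW hγ hz).1

theorem FamSmoothOn.congr {F' : ℝ → Pt → Pt → ℝ} (h : FamSmoothOn F W)
    (hF : ∀ γ ∈ Set.Ioo (-2) 2, ∀ z ∈ W, F' γ z.1 z.2 = F γ z.1 z.2) : FamSmoothOn F' W :=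
  ContDiffOn.congr h fun z hz => hF z.1 hz.1 z.2 hz.2

theorem FamSmoothOn.pd_snd (h : FamSmoothOn F W) (hW : IsOpen W) (n : Fin 2) :
    FamSmoothOn (fun γ x y => pd (F γ x) n y) W :=
  FamSmoothOn.congr (F := fun γ x y =>
    fderiv ℝ (fun z : ℝ × Pt × Pt => F z.1 z.2.1 z.2.2) (γ, x, y) (0, 0, Pi.single n 1))
    (contDiffOn_fderiv_apply h (isOpen_famDomain hW) _)
    fun _ hγ _ hz => (h.hasDirDeriv_snd hW hγ hz _).2

theorem FamSmoothOn.deriv_charge (h : FamSmoothOn F W) (hW : IsOpen W) :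
    FamSmoothOn (fun γ x y => deriv (fun γ => F γ x y) γ) W :=
  FamSmoothOn.congr (F := fun γ x y =>
    fderiv ℝ (fun z : ℝ × Pt × Pt => F z.1 z.2.1 z.2.2) (γ, x, y) (1, 0, 0))
    (contDiffOn_fderiv_apply h (isOpen_famDomain hW) _)
    fun _ hγ _ hz => (h.hasDirDeriv_charge hW hγ hz).2

/-- Differentiation in `y` commutes with differentiation in the charge. -/
theorem FamSmoothOn.hasDirDeriv_deriv_charge (h : FamSmoothOn F W) (hW : IsOpen W)
    (hγ : γ ∈ Set.Ioo (-2) 2) (hz : (x, y) ∈ W) (m : Fin 2) :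
    HasDirDeriv (fun y' => deriv (fun γ => F γ x y') γ) y (Pi.single m 1)
      (deriv (fun γ => pd (F γ x) m y) γ) := by
  set Φ := fun z : ℝ × Pt × Pt => F z.1 z.2.1 z.2.2 with hΦ
  have h1 : FamSmoothOn (fun γ x y => fderiv ℝ Φ (γ, x, y) (1, 0, 0)) W :=
    contDiffOn_fderiv_apply h (isOpen_famDomain hW) _
  have h2 : FamSmoothOn (fun γ x y => fderiv ℝ Φ (γ, x, y) (0, 0, Pi.single m 1)) W :=
    contDiffOn_fderiv_apply h (isOpen_famDomain hW) _
  have h3 : deriv (fun γ => pd (F γ x) m y) γ =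
      fderiv ℝ (fun z => fderiv ℝ Φ z (0, 0, Pi.single m 1)) (γ, x, y) (1, 0, 0) := by
    refine Eq.trans (Filter.EventuallyEq.deriv_eq ?_) (h2.hasDirDeriv_charge hW hγ hz).2
    filter_upwards [isOpen_Ioo.mem_nhds hγ] with γ' hγ'
    exact (h.hasDirDeriv_snd hW hγ' hz _).2
  rw [h3, fderiv_fderiv_comm (h.contDiffAt hW hγ hz)]
  refine (h1.hasDirDeriv_snd hW hγ hz _).congr_fun ?_
  filter_upwards [eventually_snd hW hz] with y' hy'
  exact (h.hasDirDeriv_charge hW hγ hy').2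

end Family

end Finsleroid

namespace Finsleroid

/-! ### The argument of a complex number -/

section Arg

variable {E : Type*} [NormedAddCommGroup E] [NormedSpace ℝ E]
variable {f₁ f₂ : E → ℝ} {z e : E} {v₁ v₂ : ℝ}

theorem contDiffAt_arg {f₁ f₂ : E → ℝ} {z : E} (h₁ : ContDiffAt ℝ ∞ f₁ z)
    (h₂ : ContDiffAt ℝ ∞ f₂ z) (h : (⟨f₁ z, f₂ z⟩ : ℂ) ∈ Complex.slitPlane) :
    ContDiffAt ℝ ∞ (fun z => (⟨f₁ z, f₂ z⟩ : ℂ).arg) z := by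
  have h3 : ContDiffAt ℝ ∞ (fun z => (⟨f₁ z, f₂ z⟩ : ℂ)) z :=
    Complex.equivRealProdCLM.symm.contDiff.contDiffAt.comp z (h₁.prodMk h₂)
  have h4 : ContDiffAt ℝ ∞ (fun w : ℂ => (Complex.log w).im) ⟨f₁ z, f₂ z⟩ :=
    Complex.imCLM.contDiff.contDiffAt.comp _ ((Complex.contDiffAt_log h).restrict_scalars ℝ)
  simp only [Complex.log_im] at h4
  exact h4.comp z h3

theorem HasDirDeriv.arg (h₁ : HasDirDeriv f₁ z e v₁) (h₂ : HasDirDeriv f₂ z e v₂)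
    (h : (⟨f₁ z, f₂ z⟩ : ℂ) ∈ Complex.slitPlane) :
    HasDirDeriv (fun z => (⟨f₁ z, f₂ z⟩ : ℂ).arg) z e
      ((f₁ z * v₂ - f₂ z * v₁) / (f₁ z ^ 2 + f₂ z ^ 2)) := by
  have h3 := Complex.equivRealProdCLM.symm.hasFDerivAt.comp z
    (h₁.1.hasFDerivAt.prodMk h₂.1.hasFDerivAt)
  have h5 := Complex.imCLM.hasFDerivAt.comp z
    (((Complex.hasStrictDerivAt_log h).hasDerivAt.hasFDerivAt.restrictScalars ℝ).comp z h3)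
  have h6 : HasFDerivAt (fun z => (⟨f₁ z, f₂ z⟩ : ℂ).arg) _ z := h5.congr_of_eventuallyEq
    (Filter.Eventually.of_forall fun z => (Complex.log_im _).symm)
  refine ⟨h6.differentiableAt, ?_⟩
  rw [h6.fderiv, ← h₁.2, ← h₂.2]
  simp [Complex.inv_re, Complex.inv_im, Complex.normSq_apply]
  ring

end Arg

/-! ### The metric function in terms of the charge, `b` and `q` -/

theorem hFun_pos {γ : ℝ} (hγ : γ ∈ Set.Ioo (-2 : ℝ) 2) : 0 < hFun γ := by
  have := hγ.1; have := hγ.2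
  exact Real.sqrt_pos.2 (by nlinarith)

theorem hFun_sq {γ : ℝ} (hγ : γ ∈ Set.Ioo (-2 : ℝ) 2) : hFun γ ^ 2 = 1 - γ ^ 2 / 4 := by
  have := hγ.1; have := hγ.2
  exact Real.sq_sqrt (by nlinarith)

theorem BFun_pos {γ b q : ℝ} (hγ : γ ∈ Set.Ioo (-2 : ℝ) 2) (hq : 0 < q) : 0 < BFun γ b q := by
  have h1 : 0 < hFun γ ^ 2 * q ^ 2 := by have := hFun_pos hγ; positivity
  rw [hFun_sq hγ] at h1
  unfold BFun
  nlinarith [sq_nonneg (b + γ / 2 * q)]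

theorem KFun_pos {γ b q : ℝ} (hγ : γ ∈ Set.Ioo (-2 : ℝ) 2) (hq : 0 < q) : 0 < KFun γ b q :=
  mul_pos (Real.sqrt_pos.2 (BFun_pos hγ hq)) (Real.exp_pos _)

theorem LFun_slit {γ b q : ℝ} (hγ : γ ∈ Set.Ioo (-2 : ℝ) 2) (hq : 0 < q) :
    (⟨LFun γ b q, hFun γ * b⟩ : ℂ) ∈ Complex.slitPlane := by
  rw [Complex.mem_slitPlane_iff]
  by_cases hb : b = 0
  · left; simp [LFun, hb, hq]
  · right; simp [hb, (hFun_pos hγ).ne']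

/-- The three cases in the definition of `f` are one branch of the argument of `L + i h b`. -/
theorem fFun_eq_arg {γ b q : ℝ} (hγ : γ ∈ Set.Ioo (-2 : ℝ) 2) (hq : 0 < q) :
    fFun γ b q = Real.pi / 2 - Real.arctan (GFun γ / 2)
      - (⟨LFun γ b q, hFun γ * b⟩ : ℂ).arg := by
  have hh := hFun_pos hγ
  have key : ∀ φ r : ℝ, 0 < r → φ ∈ Set.Ioc (-Real.pi) Real.pi → LFun γ b q = r * Real.cos φ →
      hFun γ * b = r * Real.sin φ → (⟨LFun γ b q, hFun γ * b⟩ : ℂ).arg = φ := by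
    intro φ r hr hφ h1 h2
    rw [← Complex.arg_mul_cos_add_sin_mul_I hr hφ]
    congr 1
    apply Complex.ext <;>
      simp [h1, h2, ← Complex.ofReal_cos, ← Complex.ofReal_sin]
  unfold fFun
  set t := LFun γ b q / (hFun γ * b) with ht
  have h1 := Real.neg_pi_div_two_lt_arctan t
  have h2 := Real.arctan_lt_pi_div_two t
  have hs : 0 < √(1 + t ^ 2) := Real.sqrt_pos.2 (by positivity)
  -- In each case `φ` and `r` are polar coordinates of `L + i h b`.
  split_ifs with hb hb'
  · rw [key (Real.pi / 2 - Real.arctan t) (hFun γ * b * √(1 + t ^ 2)) (by positivity)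
      ⟨by linarith, by linarith⟩]
    · ring
    · rw [Real.cos_pi_div_two_sub, Real.sin_arctan, ht]; field_simp
    · rw [Real.sin_pi_div_two_sub, Real.cos_arctan]; field_simp
  · have hbn : b ≠ 0 := hb'.ne
    rw [key (-(Real.pi / 2) - Real.arctan t) (-(hFun γ * b) * √(1 + t ^ 2))
      (mul_pos (by nlinarith) hs) ⟨by linarith, by linarith⟩]
    · ring
    · simp only [Real.cos_sub, Real.cos_neg, Real.cos_pi_div_two, Real.sin_neg,
        Real.sin_pi_div_two, Real.sin_arctan, zero_mul, one_mul, neg_mul, ht]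
      field_simp
      ring
    · simp only [Real.sin_sub, Real.cos_neg, Real.cos_pi_div_two, Real.sin_neg,
        Real.sin_pi_div_two, Real.cos_arctan, zero_mul, one_mul, neg_mul, sub_zero]
      field_simp
  · have hb0 : b = 0 := le_antisymm (not_lt.1 hb) (not_lt.1 hb')
    rw [key 0 q hq ⟨by linarith [Real.pi_pos], Real.pi_pos.le⟩] <;> simp [hb0, LFun]

section Model

variable {E : Type*} [NormedAddCommGroup E] [NormedSpace ℝ E]

theorem contDiffAt_BFun {γ b q : E → ℝ} {z : E} (hγ : ContDiffAt ℝ ∞ γ z)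
    (hb : ContDiffAt ℝ ∞ b z) (hq : ContDiffAt ℝ ∞ q z) :
    ContDiffAt ℝ ∞ (fun z => BFun (γ z) (b z) (q z)) z := by
  unfold BFun; fun_prop

theorem contDiffAt_nuFun {γ b q : E → ℝ} {z : E} (c : ℝ) (hγ : ContDiffAt ℝ ∞ γ z)
    (hb : ContDiffAt ℝ ∞ b z) (hq : ContDiffAt ℝ ∞ q z) :
    ContDiffAt ℝ ∞ (fun z => nuFun c (γ z) (b z) (q z)) z := by
  unfold nuFun; fun_prop

theorem contDiffAt_KFun {γ b q : E → ℝ} {z : E} (hγ : ContDiffAt ℝ ∞ γ z)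
    (hb : ContDiffAt ℝ ∞ b z) (hq : ContDiffAt ℝ ∞ q z) (hγz : γ z ∈ Set.Ioo (-2 : ℝ) 2)
    (hqz : 0 < q z) : ContDiffAt ℝ ∞ (fun z => KFun (γ z) (b z) (q z)) z := by
  have hh : ContDiffAt ℝ ∞ (fun z => hFun (γ z)) z := by
    unfold hFun
    refine ContDiffAt.sqrt (by fun_prop) ?_
    rw [← hFun_sq hγz]; exact (pow_pos (hFun_pos hγz) 2).ne'
  have hG : ContDiffAt ℝ ∞ (fun z => GFun (γ z)) z := hγ.div hh (hFun_pos hγz).ne'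
  have hf : ContDiffAt ℝ ∞ (fun z => fFun (γ z) (b z) (q z)) z := by
    have h1 : ContDiffAt ℝ ∞ (fun z => Real.pi / 2 - Real.arctan (GFun (γ z) / 2)
        - (⟨LFun (γ z) (b z) (q z), hFun (γ z) * b z⟩ : ℂ).arg) z := by
      refine (contDiffAt_const.sub ((hG.div_const 2).arctan)).sub
        (contDiffAt_arg ?_ (hh.mul hb) (LFun_slit hγz hqz))
      unfold LFun; fun_prop
    refine h1.congr_of_eventuallyEq ?_
    filter_upwards [hγ.continuousAt.eventually (isOpen_Ioo.mem_nhds hγz),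
      hq.continuousAt.eventually (isOpen_Ioi.mem_nhds hqz)] with z' h1 h2
    exact fFun_eq_arg h1 h2
  unfold KFun
  exact ((contDiffAt_BFun hγ hb hq).sqrt (BFun_pos hγz hqz).ne').mul
    ((contDiffAt_const.mul hG).mul hf).exp

variable {b q : E → ℝ} {γ b' q' : ℝ} {z e : E}

theorem hasDirDeriv_BFun (hb : HasDirDeriv b z e b') (hq : HasDirDeriv q z e q') :
    HasDirDeriv (fun z => BFun γ (b z) (q z)) z e
      (2 * b z * b' + γ * (b' * q z + b z * q') + 2 * q z * q') :=
  (((hb.pow 2).add (((hasDirDeriv_const γ).mul hb).mul hq)).add (hq.pow 2)).congr_val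
    (by push_cast; ring)

theorem hasDirDeriv_nuFun (c : ℝ) (hb : HasDirDeriv b z e b') (hq : HasDirDeriv q z e q') :
    HasDirDeriv (fun z => nuFun c γ (b z) (q z)) z e (q' + (1 - c ^ 2) * γ * b') :=
  hq.add (hb.const_mul _)

/-- The logarithmic differential of `K` is `((b + g q) db + q dq) / B`. -/
theorem hasDirDeriv_KFun (hγ : γ ∈ Set.Ioo (-2 : ℝ) 2) (hb : HasDirDeriv b z e b')
    (hq : HasDirDeriv q z e q') (hqz : 0 < q z) :
    HasDirDeriv (fun z => KFun γ (b z) (q z)) z e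
      (KFun γ (b z) (q z) / BFun γ (b z) (q z) *
        ((b z + γ * q z) * b' + q z * q')) := by
  have hB := BFun_pos (b := b z) hγ hqz
  have hh := hFun_pos hγ
  have hf : HasDirDeriv (fun z => fFun γ (b z) (q z)) z e
      (hFun γ * (b z * q' - q z * b') / BFun γ (b z) (q z)) := by
    have hL : HasDirDeriv (fun z => LFun γ (b z) (q z)) z e (q' + γ / 2 * b') :=
      hq.add (hb.const_mul _)
    have hs : LFun γ (b z) (q z) ^ 2 + (hFun γ * b z) ^ 2 = BFun γ (b z) (q z) := by
      rw [mul_pow, hFun_sq hγ]; unfold LFun BFun; ring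
    have h1 := ((hasDirDeriv_const (Real.pi / 2 - Real.arctan (GFun γ / 2))).sub
      (hL.arg (hb.const_mul (hFun γ)) (LFun_slit hγ hqz)))
    rw [hs] at h1
    refine (h1.congr_val ?_).congr_fun ?_
    · unfold LFun; ring
    · filter_upwards [hq.1.continuousAt.eventually (isOpen_Ioi.mem_nhds hqz)] with z' h2
      exact fFun_eq_arg hγ h2
  refine (((hasDirDeriv_BFun hb hq).sqrt hB.ne').mul
    ((hf.const_mul (-(1 / 2) * GFun γ)).comp_hasDerivAt (Real.hasDerivAt_exp _))).congr_val ?_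
  -- In terms of `r = √B` the remaining identity is rational.
  obtain ⟨r, hr, hBr, hsr⟩ : ∃ r, r ≠ 0 ∧ BFun γ (b z) (q z) = r ^ 2 ∧
      √(BFun γ (b z) (q z)) = r :=
    ⟨_, (Real.sqrt_pos.2 hB).ne', (Real.sq_sqrt hB.le).symm, rfl⟩
  unfold KFun
  rw [hsr, hBr]
  generalize Real.exp _ = X
  unfold GFun
  field_simp
  ring

end Model

end Finsleroid

namespace Finsleroid

/-! ### Integrals depending on a parameter -/

theorem hasDerivAt_parametric_primitive {F : ℝ × ℝ → ℝ} (hF : ContDiff ℝ ∞ F) (γ τ : ℝ) :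
    HasDerivAt (fun γ => ∫ s in (0 : ℝ)..τ, F (γ, s))
      (∫ s in (0 : ℝ)..τ, fderiv ℝ F (γ, s) (1, 0)) γ := by
  have hF' : Continuous fun p => fderiv ℝ F p (1, 0) :=
    (hF.continuous_fderiv (by simp)).clm_apply continuous_const
  obtain ⟨C, hC⟩ := (isCompact_Icc.prod isCompact_uIcc :
    IsCompact (Set.Icc (γ - 1) (γ + 1) ×ˢ Set.uIcc 0 τ)).exists_bound_of_continuousOn
      hF'.continuousOn
  refine (intervalIntegral.hasDerivAt_integral_of_dominated_loc_of_deriv_le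
    (F := fun γ s => F (γ, s)) (F' := fun γ s => fderiv ℝ F (γ, s) (1, 0))
    (bound := fun _ => C) (s := Set.Icc (γ - 1) (γ + 1)) (Icc_mem_nhds (by simp) (by simp))
    (Filter.Eventually.of_forall fun γ' => ?_) ?_ ?_ ?_ intervalIntegrable_const ?_).2
  · exact (hF.continuous.comp (Continuous.prodMk_right γ')).aestronglyMeasurable
  · exact (hF.continuous.comp (Continuous.prodMk_right γ)).intervalIntegrable _ _
  · exact (hF'.comp (Continuous.prodMk_right γ)).aestronglyMeasurable
  · exact Filter.Eventually.of_forall fun s hs γ' hγ' =>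
      hC (γ', s) ⟨hγ', Set.uIoc_subset_uIcc hs⟩
  · exact Filter.Eventually.of_forall fun s _ γ' _ =>
      ((hF.differentiable (by simp) (γ', s)).hasFDerivAt.comp_hasDerivAt γ'
        ((hasDerivAt_id γ').prodMk (hasDerivAt_const γ' s)))

/-- The primitive of a smooth function is jointly smooth in the parameter and the upper limit:
its derivative is made of the integrand and of the primitive of the derivative of the integrand,
so that one order of smoothness is gained at a time. -/
theorem contDiff_parametric_primitive {F : ℝ × ℝ → ℝ} (hF : ContDiff ℝ ∞ F) :
    ContDiff ℝ ∞ fun p : ℝ × ℝ => ∫ s in (0 : ℝ)..p.2, F (p.1, s) := by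
  rw [contDiff_infty]
  intro n
  induction n generalizing F with
  | zero =>
    rw [Nat.cast_zero, contDiff_zero]
    exact intervalIntegral.continuous_parametric_intervalIntegral_of_continuous
      (f := fun (p : ℝ × ℝ) s => F (p.1, s))
      (hF.continuous.comp (by fun_prop)) continuous_snd
  | succ n ih =>
    have hF1 : ContDiff ℝ ∞ fun p => fderiv ℝ F p (1, 0) :=
      (hF.fderiv_right (m := ∞) (by simp)).clm_apply contDiff_const
    have h1 := ih hF1
    have h2 : ContDiff ℝ n F := hF.of_le (by exact_mod_cast le_top)
    rw [Nat.cast_add, Nat.cast_one, contDiff_succ_iff_hasFDerivAt]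
    refine ⟨fun p => (ContinuousLinearMap.smulRight (1 : ℝ →L[ℝ] ℝ)
        (∫ s in (0 : ℝ)..p.2, fderiv ℝ F (p.1, s) (1, 0))).coprod
        (ContinuousLinearMap.smulRight (1 : ℝ →L[ℝ] ℝ) (F p)), ?_, fun p => ?_⟩
    · have e : (fun p : ℝ × ℝ => (ContinuousLinearMap.smulRight (1 : ℝ →L[ℝ] ℝ)
          (∫ s in (0 : ℝ)..p.2, fderiv ℝ F (p.1, s) (1, 0))).coprod
          (ContinuousLinearMap.smulRight (1 : ℝ →L[ℝ] ℝ) (F p))) = fun p : ℝ × ℝ =>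
          (∫ s in (0 : ℝ)..p.2, fderiv ℝ F (p.1, s) (1, 0)) • ContinuousLinearMap.fst ℝ ℝ ℝ
            + F p • ContinuousLinearMap.snd ℝ ℝ ℝ := by
        ext p <;> simp
      rw [e]
      exact (h1.smul contDiff_const).add (h2.smul contDiff_const)
    · refine (hasStrictFDerivAt_uncurry_coprod (u := p)
        (f := fun γ τ => ∫ s in (0 : ℝ)..τ, F (γ, s))
        (f₁ := fun γ τ => ContinuousLinearMap.smulRight (1 : ℝ →L[ℝ] ℝ)
          (∫ s in (0 : ℝ)..τ, fderiv ℝ F (γ, s) (1, 0)))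
        (f₂ := fun γ τ => ContinuousLinearMap.smulRight (1 : ℝ →L[ℝ] ℝ) (F (γ, τ)))
        (Filter.Eventually.of_forall fun v => ?_) (Filter.Eventually.of_forall fun v => ?_)
        ?_ ?_).hasFDerivAt
      · exact (hasDerivAt_parametric_primitive hF v.1 v.2).hasFDerivAt
      · exact ((hF.continuous.comp (Continuous.prodMk_right v.1)).integral_hasStrictDerivAt
          0 v.2).hasDerivAt.hasFDerivAt
      · exact ((ContinuousLinearMap.smulRightL ℝ ℝ ℝ (1 : ℝ →L[ℝ] ℝ)).continuous.comp
          h1.continuous).continuousAt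
      · exact ((ContinuousLinearMap.smulRightL ℝ ℝ ℝ (1 : ℝ →L[ℝ] ℝ)).continuous.comp
          h2.continuous).continuousAt

/-! ### The angle on the universal cover -/

/-- The estimate behind it is `|(1 - c²) γ c u| ≤ 2 c (1 - c²) |u| ≤ √(1 - c²) |u| ≤ q`, as
`4 c² (1 - c²) ≤ 1`; the first inequality is strict unless `u = 0`. -/
theorem nuFun_pos {c γ u w q : ℝ} (hc : 0 < c) (hc1 : c < 1) (hγ : γ ∈ Set.Ioo (-2 : ℝ) 2)
    (hq : 0 < q) (hq2 : q ^ 2 = u ^ 2 + w ^ 2 - (c * u) ^ 2) : 0 < nuFun c γ (c * u) q := by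
  have h1 : 0 < 1 - c ^ 2 := by nlinarith
  have h2 : ((1 - c ^ 2) * γ * (c * u)) ^ 2 < q ^ 2 := by
    by_cases hu : u = 0
    · subst hu; simp; positivity
    · have hu2 : 0 < u ^ 2 := by positivity
      have h3 : γ ^ 2 < 4 := by have := hγ.1; have := hγ.2; nlinarith
      have h4 : 0 < (1 - c ^ 2) * u ^ 2 := by positivity
      have h5 : 4 * c ^ 2 * (1 - c ^ 2) ≤ 1 := by nlinarith [sq_nonneg (1 - 2 * c ^ 2)]
      have h6 : γ ^ 2 * (c ^ 2 * (1 - c ^ 2)) < 4 * (c ^ 2 * (1 - c ^ 2)) :=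
        mul_lt_mul_of_pos_right h3 (by positivity)
      have h7 : (γ ^ 2 * (c ^ 2 * (1 - c ^ 2))) * ((1 - c ^ 2) * u ^ 2) <
          1 * ((1 - c ^ 2) * u ^ 2) := mul_lt_mul_of_pos_right (by linarith) h4
      nlinarith [sq_nonneg w]
  have h3 := (abs_lt_of_sq_lt_sq h2 hq.le)
  unfold nuFun
  linarith [(abs_lt.1 h3).1]

section Angle

variable {c : ℝ}

theorem unit_q_pos (hc : 0 < c) (hc1 : c < 1) (t : ℝ) :
    0 < 1 - (c * Real.cos t) ^ 2 := by
  have h1 : c ^ 2 * Real.cos t ^ 2 ≤ c ^ 2 * 1 :=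
    mul_le_mul_of_nonneg_left (Real.cos_sq_le_one t) (by positivity)
  nlinarith

theorem unit_nu_pos (hc : 0 < c) (hc1 : c < 1) {γ : ℝ} (hγ : γ ∈ Set.Ioo (-2 : ℝ) 2) (t : ℝ) :
    0 < nuFun c γ (c * Real.cos t) √(1 - (c * Real.cos t) ^ 2) := by
  have h := unit_q_pos hc hc1 t
  refine nuFun_pos (w := Real.sin t) hc hc1 hγ (Real.sqrt_pos.2 h) ?_
  rw [Real.sq_sqrt h.le]; linarith [Real.cos_sq_add_sin_sq t]

theorem angleDensity_pos (hc : 0 < c) (hc1 : c < 1) {γ : ℝ} (hγ : γ ∈ Set.Ioo (-2 : ℝ) 2)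
    (t : ℝ) : 0 < angleDensity c γ t :=
  div_pos (Real.sqrt_pos.2 (div_pos (unit_nu_pos hc hc1 hγ t)
    (Real.sqrt_pos.2 (unit_q_pos hc hc1 t)))) (BFun_pos hγ (Real.sqrt_pos.2 (unit_q_pos hc hc1 t)))

theorem contDiffAt_angleDensity (hc : 0 < c) (hc1 : c < 1) {E : Type*} [NormedAddCommGroup E]
    [NormedSpace ℝ E] {γ τ : E → ℝ} {z : E} (hγ : ContDiffAt ℝ ∞ γ z) (hτ : ContDiffAt ℝ ∞ τ z)
    (hγz : γ z ∈ Set.Ioo (-2 : ℝ) 2) :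
    ContDiffAt ℝ ∞ (fun z => angleDensity c (γ z) (τ z)) z := by
  have h0 := unit_q_pos hc hc1 (τ z)
  have hq : ContDiffAt ℝ ∞ (fun z => √(1 - (c * Real.cos (τ z)) ^ 2)) z :=
    ContDiffAt.sqrt (contDiffAt_const.sub ((contDiffAt_const.mul hτ.cos).pow 2)) h0.ne'
  have hb : ContDiffAt ℝ ∞ (fun z => c * Real.cos (τ z)) z := contDiffAt_const.mul hτ.cos
  have hq0 := Real.sqrt_pos.2 h0
  unfold angleDensity
  exact ContDiffAt.div (ContDiffAt.sqrt ((contDiffAt_nuFun c hγ hb hq).div hq hq0.ne')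
    (div_pos (unit_nu_pos hc hc1 hγz _) hq0).ne') (contDiffAt_BFun hγ hb hq)
    (BFun_pos hγz hq0).ne'

theorem continuous_angleDensity (hc : 0 < c) (hc1 : c < 1) {γ : ℝ}
    (hγ : γ ∈ Set.Ioo (-2 : ℝ) 2) : Continuous (angleDensity c γ) :=
  continuous_iff_continuousAt.2 fun t =>
    (contDiffAt_angleDensity hc hc1 (γ := fun _ => γ) contDiffAt_const
      (contDiffAt_id (x := t)) hγ).continuousAt

theorem hasDerivAt_angleLift (hc : 0 < c) (hc1 : c < 1) {γ : ℝ} (hγ : γ ∈ Set.Ioo (-2 : ℝ) 2)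
    (τ : ℝ) : HasDerivAt (angleLift c γ) (angleDensity c γ τ) τ :=
  ((continuous_angleDensity hc hc1 hγ).integral_hasStrictDerivAt 0 τ).hasDerivAt

/-- Joint smoothness of the angle.  The substitution `γ = 2t / √(1 + t²)` reduces the parameter
interval `(-2, 2)` to the whole line. -/
theorem contDiffAt_angleLift (hc : 0 < c) (hc1 : c < 1) {E : Type*} [NormedAddCommGroup E]
    [NormedSpace ℝ E] {γ τ : E → ℝ} {z : E} (hγ : ContDiffAt ℝ ∞ γ z) (hτ : ContDiffAt ℝ ∞ τ z)
    (hγz : γ z ∈ Set.Ioo (-2 : ℝ) 2) :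
    ContDiffAt ℝ ∞ (fun z => angleLift c (γ z) (τ z)) z := by
  set ψ : ℝ → ℝ := fun t => 2 * t / √(1 + t ^ 2) with hψ
  have hpos : ∀ t : ℝ, 0 < 1 + t ^ 2 := fun t => by positivity
  have hψ_smooth : ContDiff ℝ ∞ ψ :=
    (contDiff_const.mul contDiff_id).div ((contDiff_const.add (contDiff_id.pow 2)).sqrt
      fun t => (hpos t).ne') fun t => (Real.sqrt_pos.2 (hpos t)).ne'
  have hψ_mem : ∀ t, ψ t ∈ Set.Ioo (-2 : ℝ) 2 := fun t => by
    have h1 : |t| < √(1 + t ^ 2) := by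
      rw [← Real.sqrt_sq_eq_abs]; exact Real.sqrt_lt_sqrt (sq_nonneg t) (by linarith)
    have h0 := Real.sqrt_pos.2 (hpos t)
    have h2 := abs_lt.1 h1
    constructor
    · rw [hψ, lt_div_iff₀ h0]; linarith
    · rw [hψ, div_lt_iff₀ h0]; linarith
  -- the inverse substitution
  have hψ_inv : ∀ g ∈ Set.Ioo (-2 : ℝ) 2, ψ (g / √(4 - g ^ 2)) = g := fun g hg => by
    have h4 : 0 < 4 - g ^ 2 := by have := hg.1; have := hg.2; nlinarith
    have h5 := Real.sqrt_pos.2 h4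
    have h6 : 1 + (g / √(4 - g ^ 2)) ^ 2 = (2 / √(4 - g ^ 2)) ^ 2 := by
      rw [div_pow, div_pow, Real.sq_sqrt h4.le]; field_simp; ring
    simp only [hψ]
    rw [h6, Real.sqrt_sq (by positivity)]
    field_simp
  have hF : ContDiff ℝ ∞ fun p : ℝ × ℝ => angleDensity c (ψ p.1) p.2 :=
    contDiff_iff_contDiffAt.2 fun p => contDiffAt_angleDensity hc hc1
      (hψ_smooth.contDiffAt.comp p contDiffAt_fst) contDiffAt_snd (hψ_mem _)
  have h4 : 0 < 4 - γ z ^ 2 := by have := hγz.1; have := hγz.2; nlinarith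
  have h5 : ContDiffAt ℝ ∞ (fun z => γ z / √(4 - γ z ^ 2)) z :=
    hγ.div ((contDiffAt_const.sub (hγ.pow 2)).sqrt h4.ne') (Real.sqrt_pos.2 h4).ne'
  refine ((contDiff_parametric_primitive hF).contDiffAt.comp z (h5.prodMk hτ)).congr_of_eventuallyEq
    ?_
  filter_upwards [hγ.continuousAt.eventually (isOpen_Ioo.mem_nhds hγz)] with z' hz'
  simp only [Function.comp, hψ_inv _ hz', angleLift]

theorem angleDensity_periodic (γ : ℝ) : Function.Periodic (angleDensity c γ) (2 * Real.pi) :=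
  fun t => by unfold angleDensity; rw [Real.cos_add_two_pi]

theorem angleLift_zero (γ : ℝ) : angleLift c γ 0 = 0 := intervalIntegral.integral_same

theorem angleLift_add_int_mul (hc : 0 < c) (hc1 : c < 1) {γ : ℝ} (hγ : γ ∈ Set.Ioo (-2 : ℝ) 2)
    (τ : ℝ) (k : ℤ) :
    angleLift c γ (τ + k * (2 * Real.pi)) = angleLift c γ τ + k * angleLift c γ (2 * Real.pi) := by
  have hi := fun a b => (continuous_angleDensity hc hc1 hγ).intervalIntegrable
    (μ := MeasureTheory.volume) a b
  have h1 := (angleDensity_periodic (c := c) γ).intervalIntegral_add_zsmul_eq k τ hi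
  have h2 := intervalIntegral.integral_add_adjacent_intervals (hi 0 τ)
    (hi τ (τ + k * (2 * Real.pi)))
  simp only [zsmul_eq_mul] at h1
  rw [h1, (angleDensity_periodic (c := c) γ).intervalIntegral_add_eq τ 0, zero_add] at h2
  exact h2.symm

theorem angleLift_add_two_pi (hc : 0 < c) (hc1 : c < 1) {γ : ℝ} (hγ : γ ∈ Set.Ioo (-2 : ℝ) 2)
    (τ : ℝ) :
    angleLift c γ (τ + 2 * Real.pi) = angleLift c γ τ + angleLift c γ (2 * Real.pi) := by
  simpa using angleLift_add_int_mul hc hc1 hγ τ 1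

theorem angleLift_two_pi_pos (hc : 0 < c) (hc1 : c < 1) {γ : ℝ} (hγ : γ ∈ Set.Ioo (-2 : ℝ) 2) :
    0 < angleLift c γ (2 * Real.pi) :=
  intervalIntegral.intervalIntegral_pos_of_pos_on
    ((continuous_angleDensity hc hc1 hγ).intervalIntegrable _ _)
    (fun t _ => angleDensity_pos hc hc1 hγ t) Real.two_pi_pos

end Angle

end Finsleroid

namespace Finsleroid

/-! ### Two-dimensional dual bases -/

section DualBases

variable {l m L M : Fin 2 → ℝ}

/-- In dimension two, duality on one side implies duality on the other. -/
theorem dual_complete (h1 : ∑ k, l k * L k = 1) (h2 : ∑ k, l k * M k = 0)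
    (h3 : ∑ k, m k * L k = 0) (h4 : ∑ k, m k * M k = 1) (i j : Fin 2) :
    L i * l j + M i * m j = if i = j then 1 else 0 := by
  simp only [Fin.sum_univ_two] at h1 h2 h3 h4
  have h : (!![l 0, l 1; m 0, m 1] : Matrix (Fin 2) (Fin 2) ℝ) *
      !![L 0, M 0; L 1, M 1] = 1 := by
    rw [Matrix.mul_fin_two, h1, h2, h3, h4, Matrix.one_fin_two]
  have h2 := mul_eq_one_comm.1 h
  rw [Matrix.mul_fin_two] at h2
  have h3 := congrFun (congrFun h2 i) j
  fin_cases i <;> fin_cases j <;> simpa using h3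

/-- The inverse of a symmetric matrix written in an orthonormal coframe. -/
theorem dual_inv (h1 : ∑ k, l k * L k = 1) (h2 : ∑ k, l k * M k = 0)
    (h3 : ∑ k, m k * L k = 0) (h4 : ∑ k, m k * M k = 1) {G : Matrix (Fin 2) (Fin 2) ℝ}
    (hG : ∀ i j, G i j = l i * l j + m i * m j) (i j : Fin 2) :
    G⁻¹ i j = L i * L j + M i * M j := by
  have e : (Matrix.of fun i j => L i * L j + M i * M j) * G = 1 := by
    have hc := dual_complete h1 h2 h3 h4
    simp only [Fin.sum_univ_two] at h1 h2 h3 h4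
    ext i j
    rw [Matrix.mul_apply, Matrix.one_apply, ← hc i j]
    simp only [Matrix.of_apply, hG, Fin.sum_univ_two]
    linear_combination (L i * l j) * h1 + (M i * l j) * h2 + (L i * m j) * h3
      + (M i * m j) * h4
  rw [Matrix.inv_eq_left_inv e, Matrix.of_apply]

end DualBases

end Finsleroid

namespace FinsleroidSpace

variable (s : FinsleroidSpace) {x y : Pt}

/-! ### The orthonormal frame -/

theorem a_inv_symm (hx : x ∈ s.Ω) (i j : Fin 2) : (s.a x)⁻¹ i j = (s.a x)⁻¹ j i := by
  simpa using ((s.a_posDef x hx).inv.isHermitian.apply i j).symm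

theorem a_det_ne (hx : x ∈ s.Ω) : (s.a x).det ≠ 0 := (s.a_posDef x hx).det_pos.ne'

theorem bt_btUp (hx : x ∈ s.Ω) : s.bt x 0 * s.btUp x 0 + s.bt x 1 * s.btUp x 1 = 1 := by
  have := s.bt_unit x hx
  simp only [btUp, Fin.sum_univ_two] at this ⊢
  linarith

theorem n_nUp (hx : x ∈ s.Ω) : s.n x 0 * s.nUp x 0 + s.n x 1 * s.nUp x 1 = 1 := by
  have := s.n_unit x hx
  simp only [nUp, Fin.sum_univ_two] at this ⊢
  linarith

theorem bt_nUp (hx : x ∈ s.Ω) : s.bt x 0 * s.nUp x 0 + s.bt x 1 * s.nUp x 1 = 0 := by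
  have := s.bt_orth_n x hx
  simp only [nUp, Fin.sum_univ_two] at this ⊢
  linarith

theorem n_btUp (hx : x ∈ s.Ω) : s.n x 0 * s.btUp x 0 + s.n x 1 * s.btUp x 1 = 0 := by
  have := s.bt_orth_n x hx
  simp only [btUp, Fin.sum_univ_two] at this ⊢
  rw [s.a_inv_symm hx 1 0] at *
  linarith

/-- The vectors `b̃^i`, `n^i` and the covectors `b̃_i`, `n_i` are dual bases. -/
theorem frame_complete (hx : x ∈ s.Ω) (i j : Fin 2) :
    s.btUp x i * s.bt x j + s.nUp x i * s.n x j = if i = j then 1 else 0 := by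
  refine dual_complete (l := s.bt x) (m := s.n x) (L := s.btUp x) (M := s.nUp x) ?_ ?_ ?_ ?_ i j <;>
    rw [Fin.sum_univ_two]
  exacts [s.bt_btUp hx, s.bt_nUp hx, s.n_btUp hx, s.n_nUp hx]

theorem lower_btUp (hx : x ∈ s.Ω) (i : Fin 2) : ∑ k, s.a x i k * s.btUp x k = s.bt x i := by
  have h : s.a x * (s.a x)⁻¹ = 1 := Matrix.mul_nonsing_inv _ (s.a_det_ne hx).isUnit
  have h2 : (s.a x).mulVec ((s.a x)⁻¹.mulVec (s.bt x)) = s.bt x := by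
    rw [Matrix.mulVec_mulVec, h, Matrix.one_mulVec]
  exact congrFun h2 i

theorem lower_nUp (hx : x ∈ s.Ω) (i : Fin 2) : ∑ k, s.a x i k * s.nUp x k = s.n x i := by
  have h : s.a x * (s.a x)⁻¹ = 1 := Matrix.mul_nonsing_inv _ (s.a_det_ne hx).isUnit
  have h2 : (s.a x).mulVec ((s.a x)⁻¹.mulVec (s.n x)) = s.n x := by
    rw [Matrix.mulVec_mulVec, h, Matrix.one_mulVec]
  exact congrFun h2 i

theorem a_eq (hx : x ∈ s.Ω) (i j : Fin 2) :
    s.a x i j = s.bt x i * s.bt x j + s.n x i * s.n x j := by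
  rw [← s.lower_btUp hx i, ← s.lower_nUp hx i]
  have h0 := s.frame_complete hx 0 j
  have h1 := s.frame_complete hx 1 j
  simp only [Fin.sum_univ_two]
  have h2 : s.a x i j = s.a x i 0 * (if 0 = j then 1 else 0)
      + s.a x i 1 * if 1 = j then 1 else 0 := by
    fin_cases j <;> simp
  rw [h2, ← h0, ← h1]; ring

theorem Ssq_eq (hx : x ∈ s.Ω) (y : Pt) :
    s.Ssq x y = s.btForm x y ^ 2 + s.nForm x y ^ 2 := by
  simp only [Ssq, btForm, nForm, Fin.sum_univ_two, s.a_eq hx]; ring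

theorem b_eq (x y : Pt) : s.b x y = s.c * s.btForm x y := by
  simp only [b, bLow, btForm, Fin.sum_univ_two]; ring

theorem frame_expansion (hx : x ∈ s.Ω) (y : Pt) (k : Fin 2) :
    y k = s.btForm x y * s.btUp x k + s.nForm x y * s.nUp x k := by
  have h0 := s.frame_complete hx k 0
  have h1 := s.frame_complete hx k 1
  have h2 : y k = y 0 * (if k = 0 then 1 else 0) + y 1 * if k = 1 then 1 else 0 := by
    fin_cases k <;> simp
  rw [h2, ← h0, ← h1]
  simp only [btForm, nForm, Fin.sum_univ_two]; ring

theorem Ssq_pos (hx : x ∈ s.Ω) (hy : y ≠ 0) : 0 < s.btForm x y ^ 2 + s.nForm x y ^ 2 := by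
  by_contra h
  have h1 : s.btForm x y = 0 := by nlinarith [sq_nonneg (s.btForm x y), sq_nonneg (s.nForm x y)]
  have h2 : s.nForm x y = 0 := by nlinarith [sq_nonneg (s.btForm x y), sq_nonneg (s.nForm x y)]
  exact hy (funext fun k => by rw [s.frame_expansion hx y k, h1, h2]; simp)

/-! ### Covariant derivatives of the frame -/

section Christoffel

theorem bt_hasDirDeriv (hx : x ∈ s.Ω) (i n : Fin 2) :
    HasDirDeriv (fun x' => s.bt x' i) x (Pi.single n 1) (pd (fun x' => s.bt x' i) n x) :=
  hasDirDeriv_pd (((s.bt_smooth i).contDiffAt (s.isOpen_Ω.mem_nhds hx)).differentiableAt (by simp))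

theorem n_hasDirDeriv (hx : x ∈ s.Ω) (i n : Fin 2) :
    HasDirDeriv (fun x' => s.n x' i) x (Pi.single n 1) (pd (fun x' => s.n x' i) n x) :=
  hasDirDeriv_pd (((s.n_smooth i).contDiffAt (s.isOpen_Ω.mem_nhds hx)).differentiableAt (by simp))

theorem pd_a (hx : x ∈ s.Ω) (i j n : Fin 2) :
    pd (fun x' => s.a x' i j) n x =
      pd (fun x' => s.bt x' i) n x * s.bt x j + s.bt x i * pd (fun x' => s.bt x' j) n x
      + (pd (fun x' => s.n x' i) n x * s.n x j + s.n x i * pd (fun x' => s.n x' j) n x) := by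
  refine ((((s.bt_hasDirDeriv hx i n).mul (s.bt_hasDirDeriv hx j n)).add
    ((s.n_hasDirDeriv hx i n).mul (s.n_hasDirDeriv hx j n))).congr_fun ?_).pd
  filter_upwards [s.isOpen_Ω.mem_nhds hx] with x' hx' using s.a_eq hx' i j

theorem pd_a_symm (hx : x ∈ s.Ω) (i j n : Fin 2) :
    pd (fun x' => s.a x' i j) n x = pd (fun x' => s.a x' j i) n x := by
  rw [s.pd_a hx, s.pd_a hx]; ring

theorem lower_christoffel (hx : x ∈ s.Ω) (l n j : Fin 2) :
    ∑ k, s.a x l k * s.christoffel k n j x =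
      (1 / 2) * (pd (fun x' => s.a x' l j) n x + pd (fun x' => s.a x' l n) j x
        - pd (fun x' => s.a x' n j) l x) := by
  have h : s.a x * (s.a x)⁻¹ = 1 := Matrix.mul_nonsing_inv _ (s.a_det_ne hx).isUnit
  have h2 : ∀ v : Pt, (s.a x).mulVec ((s.a x)⁻¹.mulVec v) = v := fun v => by
    rw [Matrix.mulVec_mulVec, h, Matrix.one_mulVec]
  have h3 := congrFun (h2 fun l => (1 / 2) * (pd (fun x' => s.a x' l j) n x
    + pd (fun x' => s.a x' l n) j x - pd (fun x' => s.a x' n j) l x)) l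
  rw [← h3]
  simp only [christoffel, Matrix.mulVec, dotProduct, Finset.mul_sum]
  refine Finset.sum_congr rfl fun k _ => Finset.sum_congr rfl fun m _ => by ring

/-- The Levi-Civita derivative of `a_{ij}` vanishes. -/
theorem metric_compatible (hx : x ∈ s.Ω) (l n j : Fin 2) :
    ∑ k, s.a x l k * s.christoffel k n j x + ∑ k, s.a x j k * s.christoffel k n l x =
      pd (fun x' => s.a x' l j) n x := by
  rw [s.lower_christoffel hx, s.lower_christoffel hx, s.pd_a_symm hx j l n, s.pd_a_symm hx n j l,
    s.pd_a_symm hx n l j]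
  ring

/-- The covariant derivative `∇_n b̃_h`. -/
noncomputable def nablaBt (n h : Fin 2) (x : Pt) : ℝ :=
  pd (fun x' => s.bt x' h) n x - ∑ k, s.christoffel k n h x * s.bt x k

/-- The covariant derivative `∇_n n_h`. -/
noncomputable def nablaN (n h : Fin 2) (x : Pt) : ℝ :=
  pd (fun x' => s.n x' h) n x - ∑ k, s.christoffel k n h x * s.n x k

/-- The covariant derivative of `a_{lj} = b̃_l b̃_j + n_l n_j`. -/
theorem nabla_frame (hx : x ∈ s.Ω) (n l j : Fin 2) :
    s.nablaBt n l x * s.bt x j + s.bt x l * s.nablaBt n j x + s.nablaN n l x * s.n x j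
      + s.n x l * s.nablaN n j x = 0 := by
  have h := s.metric_compatible hx l n j
  rw [s.pd_a hx] at h
  simp only [Fin.sum_univ_two, s.a_eq hx] at h
  simp only [nablaBt, nablaN, Fin.sum_univ_two]
  linear_combination -h

theorem p_eq (n : Fin 2) (x : Pt) : s.p n x = s.c * ∑ h, s.nUp x h * s.nablaBt n h x := rfl

/-- An orthonormal frame in dimension two rotates under the covariant derivative, with angular
velocity `p_n / c`. -/
theorem nabla_frame_eq (hx : x ∈ s.Ω) (n h : Fin 2) :
    s.nablaBt n h x = s.p n x / s.c * s.n x h ∧ s.nablaN n h x = -(s.p n x / s.c) * s.bt x h := by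
  have hc := s.c_pos.ne'
  have h00 := s.nabla_frame hx n 0 0
  have h01 := s.nabla_frame hx n 0 1
  have h10 := s.nabla_frame hx n 1 0
  have h11 := s.nabla_frame hx n 1 1
  have g1 := s.bt_btUp hx
  have g2 := s.n_nUp hx
  have g3 := s.bt_nUp hx
  have g4 := s.n_btUp hx
  have hp : s.p n x / s.c = s.nUp x 0 * s.nablaBt n 0 x + s.nUp x 1 * s.nablaBt n 1 x := by
    rw [p_eq, Fin.sum_univ_two]; field_simp
  rw [hp]
  set X := s.btUp x
  set Y := s.nUp x
  -- Contract `nabla_frame` with the pairs `b̃ b̃`, `n n` and `b̃ n` of frame vectors.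
  have k1 : X 0 * s.nablaBt n 0 x + X 1 * s.nablaBt n 1 x = 0 := by
    linear_combination (1 / 2) * (X 0 * X 0 * h00 + X 0 * X 1 * h01 + X 1 * X 0 * h10
      + X 1 * X 1 * h11) - (X 0 * s.nablaBt n 0 x + X 1 * s.nablaBt n 1 x) * g1
      - (X 0 * s.nablaN n 0 x + X 1 * s.nablaN n 1 x) * g4
  have k2 : Y 0 * s.nablaN n 0 x + Y 1 * s.nablaN n 1 x = 0 := by
    linear_combination (1 / 2) * (Y 0 * Y 0 * h00 + Y 0 * Y 1 * h01 + Y 1 * Y 0 * h10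
      + Y 1 * Y 1 * h11) - (Y 0 * s.nablaN n 0 x + Y 1 * s.nablaN n 1 x) * g2
      - (Y 0 * s.nablaBt n 0 x + Y 1 * s.nablaBt n 1 x) * g3
  have k3 : (Y 0 * s.nablaBt n 0 x + Y 1 * s.nablaBt n 1 x)
      + (X 0 * s.nablaN n 0 x + X 1 * s.nablaN n 1 x) = 0 := by
    linear_combination (X 0 * Y 0 * h00 + X 0 * Y 1 * h01 + X 1 * Y 0 * h10 + X 1 * Y 1 * h11)
      - (X 0 * s.nablaBt n 0 x + X 1 * s.nablaBt n 1 x) * g3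
      - (Y 0 * s.nablaBt n 0 x + Y 1 * s.nablaBt n 1 x) * g1
      - (X 0 * s.nablaN n 0 x + X 1 * s.nablaN n 1 x) * g2
      - (Y 0 * s.nablaN n 0 x + Y 1 * s.nablaN n 1 x) * g4
  have f0 := s.frame_complete hx 0 h
  have f1 := s.frame_complete hx 1 h
  have e1 : ∀ f : Fin 2 → ℝ, f h = f 0 * (if 0 = h then 1 else 0) + f 1 * if 1 = h then 1 else 0 :=
    fun f => by fin_cases h <;> simp
  constructor
  · rw [e1 fun h => s.nablaBt n h x, ← f0, ← f1]
    linear_combination s.bt x h * k1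
  · rw [e1 fun h => s.nablaN n h x, ← f0, ← f1]
    linear_combination s.n x h * k2 + s.bt x h * k3

theorem btForm_hasDirDeriv_fst (hx : x ∈ s.Ω) (y : Pt) (n : Fin 2) :
    HasDirDeriv (fun x' => s.btForm x' y) x (Pi.single n 1)
      (s.p n x / s.c * s.nForm x y + ∑ k, ∑ j, s.christoffel k n j x * y j * s.bt x k) := by
  refine (HasDirDeriv.sum Finset.univ fun i _ =>
    (s.bt_hasDirDeriv hx i n).mul_const (y i)).congr_val ?_
  have h0 := (s.nabla_frame_eq hx n 0).1
  have h1 := (s.nabla_frame_eq hx n 1).1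
  simp only [nForm, nablaBt, Fin.sum_univ_two] at *
  linear_combination y 0 * h0 + y 1 * h1

theorem nForm_hasDirDeriv_fst (hx : x ∈ s.Ω) (y : Pt) (n : Fin 2) :
    HasDirDeriv (fun x' => s.nForm x' y) x (Pi.single n 1)
      (-(s.p n x / s.c) * s.btForm x y + ∑ k, ∑ j, s.christoffel k n j x * y j * s.n x k) := by
  refine (HasDirDeriv.sum Finset.univ fun i _ =>
    (s.n_hasDirDeriv hx i n).mul_const (y i)).congr_val ?_
  have h0 := (s.nabla_frame_eq hx n 0).2
  have h1 := (s.nabla_frame_eq hx n 1).2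
  simp only [btForm, nablaN, Fin.sum_univ_two] at *
  linear_combination y 0 * h0 + y 1 * h1

theorem btForm_hasDirDeriv_snd (x y : Pt) (n : Fin 2) :
    HasDirDeriv (s.btForm x) y (Pi.single n 1) (s.bt x n) := by
  refine (HasDirDeriv.sum Finset.univ fun i _ =>
    (hasDirDeriv_coord n i y).const_mul (s.bt x i)).congr_val ?_
  simp

theorem nForm_hasDirDeriv_snd (x y : Pt) (n : Fin 2) :
    HasDirDeriv (s.nForm x) y (Pi.single n 1) (s.n x n) := by
  refine (HasDirDeriv.sum Finset.univ fun i _ =>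
    (hasDirDeriv_coord n i y).const_mul (s.n x i)).congr_val ?_
  simp

end Christoffel

/-! ### Smoothness of the background objects -/

section Background

theorem isOpen_slitBundle : IsOpen s.slitBundle :=
  (s.isOpen_Ω.preimage continuous_fst).inter (isOpen_ne.preimage continuous_snd)

variable {W : Set (Pt × Pt)}

theorem smoothOn_btForm (hW : ∀ z ∈ W, z.1 ∈ s.Ω) : SmoothOn s.btForm W :=
  SmoothOn.sum _ fun i _ => (smoothOn_of_fst (s.bt_smooth i) hW).mul (smoothOn_coord i)

theorem smoothOn_nForm (hW : ∀ z ∈ W, z.1 ∈ s.Ω) : SmoothOn s.nForm W :=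
  SmoothOn.sum _ fun i _ => (smoothOn_of_fst (s.n_smooth i) hW).mul (smoothOn_coord i)

theorem contDiffOn_inv_entry {E : Type*} [NormedAddCommGroup E] [NormedSpace ℝ E]
    {A : E → Matrix (Fin 2) (Fin 2) ℝ} {V : Set E} (h : ∀ i j, ContDiffOn ℝ ∞ (fun z => A z i j) V)
    (hA : ∀ z ∈ V, (A z).det ≠ 0) (i j : Fin 2) : ContDiffOn ℝ ∞ (fun z => (A z)⁻¹ i j) V := by
  have hd : ContDiffOn ℝ ∞ (fun x => (A x).det) V := by
    simp only [Matrix.det_fin_two]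
    exact ((h 0 0).mul (h 1 1)).sub ((h 0 1).mul (h 1 0))
  have e : ∀ x, (A x)⁻¹ i j = (A x).det⁻¹ * (A x).adjugate i j := fun x => by
    rw [Matrix.inv_def, Matrix.smul_apply, Ring.inverse_eq_inv', smul_eq_mul]
  simp only [e]
  refine (hd.inv hA).mul ?_
  simp only [Matrix.adjugate_fin_two]
  fin_cases i <;> fin_cases j
  · exact h 1 1
  · exact (h 0 1).neg
  · exact (h 1 0).neg
  · exact h 0 0

theorem contDiffOn_a_inv (i j : Fin 2) : ContDiffOn ℝ ∞ (fun x => (s.a x)⁻¹ i j) s.Ω :=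
  contDiffOn_inv_entry s.a_smooth (fun _ hx => s.a_det_ne hx) i j

theorem contDiffOn_pd {f : Pt → ℝ} {Ω : Set Pt} (hΩ : IsOpen Ω) (hf : ContDiffOn ℝ ∞ f Ω)
    (n : Fin 2) : ContDiffOn ℝ ∞ (pd f n) Ω := contDiffOn_fderiv_apply hf hΩ _

theorem contDiffOn_christoffel (k n j : Fin 2) : ContDiffOn ℝ ∞ (s.christoffel k n j) s.Ω := by
  have h := fun l j n => contDiffOn_pd s.isOpen_Ω (s.a_smooth l j) n
  exact contDiffOn_const.mul (ContDiffOn.sum fun l _ => (s.contDiffOn_a_inv k l).mul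
    (((h l j n).add (h l n j)).sub (h n j l)))

theorem contDiffOn_btUp (k : Fin 2) : ContDiffOn ℝ ∞ (fun x => s.btUp x k) s.Ω :=
  ContDiffOn.sum fun l _ => (s.contDiffOn_a_inv k l).mul (s.bt_smooth l)

theorem contDiffOn_nUp (k : Fin 2) : ContDiffOn ℝ ∞ (fun x => s.nUp x k) s.Ω :=
  ContDiffOn.sum fun l _ => (s.contDiffOn_a_inv k l).mul (s.n_smooth l)

theorem contDiffOn_p (n : Fin 2) : ContDiffOn ℝ ∞ (s.p n) s.Ω :=
  contDiffOn_const.mul (ContDiffOn.sum fun h _ => (s.contDiffOn_nUp h).mul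
    ((contDiffOn_pd s.isOpen_Ω (s.bt_smooth h) n).sub (ContDiffOn.sum fun k _ =>
      (s.contDiffOn_christoffel k n h).mul (s.bt_smooth k))))

end Background

end FinsleroidSpace

namespace Finsleroid

/-! ### The metric function in the coordinates of an orthonormal frame

The coordinates of a tangent vector with respect to the frame `(b̃^i, n^i)` are denoted by
`(u, w)`, so that `b = c u`. -/

/-- `q` in frame coordinates. -/
noncomputable def qM (c u w : ℝ) : ℝ := √(u ^ 2 + w ^ 2 - (c * u) ^ 2)

/-- `K` in frame coordinates. -/
noncomputable def KM (c γ u w : ℝ) : ℝ := KFun γ (c * u) (qM c u w)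

/-- `B` in frame coordinates. -/
noncomputable def BM (c γ u w : ℝ) : ℝ := BFun γ (c * u) (qM c u w)

/-- `ν` in frame coordinates. -/
noncomputable def nuM (c γ u w : ℝ) : ℝ := nuFun c γ (c * u) (qM c u w)

/-- `√(ν/q)` in frame coordinates. -/
noncomputable def sigM (c γ u w : ℝ) : ℝ := √(nuM c γ u w / qM c u w)

/-- The coefficient `K/B · √(ν/q)` of the covector `m`, which is `mCoef · (u dw - w du)`. -/
noncomputable def mCoef (c γ u w : ℝ) : ℝ := sigM c γ u w * (KM c γ u w / BM c γ u w)

/-- The main scalar `I` in frame coordinates. -/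
noncomputable def IM (c γ u w : ℝ) : ℝ :=
  -(c / 2) * (w * (γ * invXFun c γ (c * u) (qM c u w) / √(qM c u w * nuM c γ u w)))

/-- The derivative of the main scalar `I` along the angle. -/
noncomputable def IThM (c γ u w : ℝ) : ℝ :=
  -(3 / 4) * γ * (1 - c ^ 2) ^ 2 * BM c γ u w ^ 2 * (1 / (qM c u w ^ 3 * nuM c γ u w ^ 3)) *
      (2 * (c * u) * nuM c γ u w + γ * c ^ 2 * w ^ 2)

section Model

variable {c γ u w : ℝ}

theorem qM_arg_pos (hc : 0 < c) (hc1 : c < 1) (h : 0 < u ^ 2 + w ^ 2) :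
    0 < u ^ 2 + w ^ 2 - (c * u) ^ 2 := by
  have h1 : 0 < 1 - c ^ 2 := by nlinarith
  have h2 : 0 < c ^ 2 := by positivity
  nlinarith [mul_nonneg h1.le (sq_nonneg u), mul_nonneg h2.le (sq_nonneg w), mul_pos h1 h]

theorem qM_pos (hc : 0 < c) (hc1 : c < 1) (h : 0 < u ^ 2 + w ^ 2) : 0 < qM c u w :=
  Real.sqrt_pos.2 (qM_arg_pos hc hc1 h)

theorem qM_sq (hc : 0 < c) (hc1 : c < 1) (h : 0 < u ^ 2 + w ^ 2) :
    qM c u w ^ 2 = (1 - c ^ 2) * u ^ 2 + w ^ 2 := by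
  rw [qM, Real.sq_sqrt (qM_arg_pos hc hc1 h).le]; ring

theorem BM_eq (hc : 0 < c) (hc1 : c < 1) (h : 0 < u ^ 2 + w ^ 2) :
    BM c γ u w = u ^ 2 + w ^ 2 + (γ * c) * u * qM c u w := by
  rw [BM, BFun, qM_sq hc hc1 h]; ring

theorem nuM_eq (c γ u w : ℝ) : nuM c γ u w = qM c u w + (1 - c ^ 2) * (γ * c) * u := by
  rw [nuM, nuFun]; ring

theorem nuM_pos (hc : 0 < c) (hc1 : c < 1) (hγ : γ ∈ Set.Ioo (-2 : ℝ) 2)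
    (h : 0 < u ^ 2 + w ^ 2) : 0 < nuM c γ u w :=
  nuFun_pos (w := w) hc hc1 hγ (qM_pos hc hc1 h) (by rw [qM_sq hc hc1 h]; ring)

theorem BM_pos (hc : 0 < c) (hc1 : c < 1) (hγ : γ ∈ Set.Ioo (-2 : ℝ) 2)
    (h : 0 < u ^ 2 + w ^ 2) : 0 < BM c γ u w := BFun_pos hγ (qM_pos hc hc1 h)

theorem KM_pos (hc : 0 < c) (hc1 : c < 1) (hγ : γ ∈ Set.Ioo (-2 : ℝ) 2)
    (h : 0 < u ^ 2 + w ^ 2) : 0 < KM c γ u w := KFun_pos hγ (qM_pos hc hc1 h)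

theorem sigM_pos (hc : 0 < c) (hc1 : c < 1) (hγ : γ ∈ Set.Ioo (-2 : ℝ) 2)
    (h : 0 < u ^ 2 + w ^ 2) : 0 < sigM c γ u w :=
  Real.sqrt_pos.2 (div_pos (nuM_pos hc hc1 hγ h) (qM_pos hc hc1 h))

theorem sigM_sq (hc : 0 < c) (hc1 : c < 1) (hγ : γ ∈ Set.Ioo (-2 : ℝ) 2)
    (h : 0 < u ^ 2 + w ^ 2) : sigM c γ u w ^ 2 = nuM c γ u w / qM c u w :=
  Real.sq_sqrt (div_pos (nuM_pos hc hc1 hγ h) (qM_pos hc hc1 h)).le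

theorem sqrt_q_mul_nu (hc : 0 < c) (hc1 : c < 1) (hγ : γ ∈ Set.Ioo (-2 : ℝ) 2)
    (h : 0 < u ^ 2 + w ^ 2) : √(qM c u w * nuM c γ u w) = qM c u w * sigM c γ u w := by
  have hq := qM_pos hc hc1 h
  have hs := sigM_pos hc hc1 hγ h
  rw [Real.sqrt_eq_iff_mul_self_eq (mul_pos hq (nuM_pos hc hc1 hγ h)).le (mul_pos hq hs).le]
  have := sigM_sq hc hc1 hγ h
  field_simp at this
  linear_combination -qM c u w * this

variable {E : Type*} [NormedAddCommGroup E] [NormedSpace ℝ E] {U W : E → ℝ} {z e : E} {β η : ℝ}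

theorem hasDirDeriv_qM (hc : 0 < c) (hc1 : c < 1) (h : 0 < U z ^ 2 + W z ^ 2)
    (hU : HasDirDeriv U z e β) (hW : HasDirDeriv W z e η) :
    HasDirDeriv (fun z => qM c (U z) (W z)) z e
      (((1 - c ^ 2) * U z * β + W z * η) / qM c (U z) (W z)) := by
  have hq := qM_pos hc hc1 h
  refine ((((hU.pow 2).add (hW.pow 2)).sub ((hU.const_mul c).pow 2)).sqrt
    (qM_arg_pos hc hc1 h).ne').congr_val ?_
  change _ / (2 * qM c (U z) (W z)) = _
  field_simp
  push_cast
  ring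

/-- `dK = K/B · ((u + g c q) du + w dw)`. -/
theorem hasDirDeriv_KM (hc : 0 < c) (hc1 : c < 1) (hγ : γ ∈ Set.Ioo (-2 : ℝ) 2)
    (h : 0 < U z ^ 2 + W z ^ 2) (hU : HasDirDeriv U z e β) (hW : HasDirDeriv W z e η) :
    HasDirDeriv (fun z => KM c γ (U z) (W z)) z e
      (KM c γ (U z) (W z) / BM c γ (U z) (W z) *
        ((U z + γ * c * qM c (U z) (W z)) * β + W z * η)) := by
  have hq := qM_pos hc hc1 h
  refine (hasDirDeriv_KFun hγ (hU.const_mul c) (hasDirDeriv_qM hc hc1 h hU hW) hq).congr_val ?_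
  unfold KM BM
  field_simp
  ring

theorem hasDirDeriv_BM (hc : 0 < c) (hc1 : c < 1) (h : 0 < U z ^ 2 + W z ^ 2)
    (hU : HasDirDeriv U z e β) (hW : HasDirDeriv W z e η) :
    HasDirDeriv (fun z => BM c γ (U z) (W z)) z e
      (2 * U z * β + 2 * W z * η + γ * c * (β * qM c (U z) (W z)
        + U z * (((1 - c ^ 2) * U z * β + W z * η) / qM c (U z) (W z)))) := by
  have hq := qM_pos hc hc1 h
  refine (hasDirDeriv_BFun (hU.const_mul c) (hasDirDeriv_qM hc hc1 h hU hW)).congr_val ?_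
  field_simp
  ring

theorem hasDirDeriv_nuM (hc : 0 < c) (hc1 : c < 1) (h : 0 < U z ^ 2 + W z ^ 2)
    (hU : HasDirDeriv U z e β) (hW : HasDirDeriv W z e η) :
    HasDirDeriv (fun z => nuM c γ (U z) (W z)) z e
      (((1 - c ^ 2) * U z * β + W z * η) / qM c (U z) (W z) + (1 - c ^ 2) * (γ * c) * β) :=
  (hasDirDeriv_nuFun c (hU.const_mul c) (hasDirDeriv_qM hc hc1 h hU hW)).congr_val (by ring)

theorem hasDirDeriv_sigM (hc : 0 < c) (hc1 : c < 1) (hγ : γ ∈ Set.Ioo (-2 : ℝ) 2)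
    (h : 0 < U z ^ 2 + W z ^ 2) (hU : HasDirDeriv U z e β) (hW : HasDirDeriv W z e η) :
    HasDirDeriv (fun z => sigM c γ (U z) (W z)) z e
      (sigM c γ (U z) (W z) * (1 / 2) *
        ((((1 - c ^ 2) * U z * β + W z * η) / qM c (U z) (W z) + (1 - c ^ 2) * (γ * c) * β) /
          nuM c γ (U z) (W z)
        - ((1 - c ^ 2) * U z * β + W z * η) / qM c (U z) (W z) / qM c (U z) (W z))) := by
  have hq := qM_pos hc hc1 h
  have hν := nuM_pos hc hc1 hγ h
  have hs := sigM_pos hc hc1 hγ h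
  have hs2 := sigM_sq hc hc1 hγ h
  refine (((hasDirDeriv_nuM hc hc1 h hU hW).div (hasDirDeriv_qM hc hc1 h hU hW)
    hq.ne').sqrt (div_pos hν hq).ne').congr_val ?_
  change _ / (2 * sigM c γ (U z) (W z)) = _
  generalize ((1 - c ^ 2) * U z * β + W z * η) / qM c (U z) (W z) = q'
  generalize q' + (1 - c ^ 2) * (γ * c) * β = ν'
  rw [div_eq_iff (by positivity)]
  have : sigM c γ (U z) (W z) * (1 / 2) * (ν' / nuM c γ (U z) (W z) - q' / qM c (U z) (W z)) *
    (2 * sigM c γ (U z) (W z)) = sigM c γ (U z) (W z) ^ 2 *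
      (ν' / nuM c γ (U z) (W z) - q' / qM c (U z) (W z)) := by ring
  rw [this, hs2]
  field_simp

/-- First part of `K ∂l_j/∂y^i = m_i m_j`: the component of `l` along `b̃`. -/
theorem hasDirDeriv_lCoef_u (hc : 0 < c) (hc1 : c < 1) (hγ : γ ∈ Set.Ioo (-2 : ℝ) 2)
    (h : 0 < U z ^ 2 + W z ^ 2) (hU : HasDirDeriv U z e β) (hW : HasDirDeriv W z e η) :
    HasDirDeriv (fun z => KM c γ (U z) (W z) / BM c γ (U z) (W z) *
        (U z + γ * c * qM c (U z) (W z))) z e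
      (-(mCoef c γ (U z) (W z) * W z) * (mCoef c γ (U z) (W z) * (U z * η - W z * β)) /
        KM c γ (U z) (W z)) := by
  have hq := qM_pos hc hc1 h
  have hν := nuM_pos hc hc1 hγ h
  have hB := BM_pos hc hc1 hγ h
  have hK := KM_pos hc hc1 hγ h
  refine (((hasDirDeriv_KM hc hc1 hγ h hU hW).div (hasDirDeriv_BM hc hc1 h hU hW) hB.ne').mul
    (hU.add ((hasDirDeriv_qM hc hc1 h hU hW).const_mul (γ * c)))).congr_val ?_
  have e1 : -(mCoef c γ (U z) (W z) * W z) * (mCoef c γ (U z) (W z) * (U z * η - W z * β)) /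
      KM c γ (U z) (W z) = -(sigM c γ (U z) (W z) ^ 2 * W z * (U z * η - W z * β) *
        KM c γ (U z) (W z) / BM c γ (U z) (W z) ^ 2) := by
    unfold mCoef; field_simp
  rw [e1, sigM_sq hc hc1 hγ h]
  -- What remains is rational in `u`, `w`, `q`, and holds modulo the relations `f1`, `f2`, `f3`.
  have f1 := qM_sq hc hc1 h
  have f2 := BM_eq (γ := γ) hc hc1 h
  have f3 := nuM_eq c γ (U z) (W z)
  generalize 1 - c ^ 2 = ε at *
  generalize qM c (U z) (W z) = q at *
  generalize BM c γ (U z) (W z) = B at *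
  generalize nuM c γ (U z) (W z) = ν at *
  generalize KM c γ (U z) (W z) = K at *
  generalize U z = u at *
  generalize W z = w at *
  field_simp
  subst f2 f3
  grind

/-- Second part of `K ∂l_j/∂y^i = m_i m_j`: the component of `l` along `n`. -/
theorem hasDirDeriv_lCoef_w (hc : 0 < c) (hc1 : c < 1) (hγ : γ ∈ Set.Ioo (-2 : ℝ) 2)
    (h : 0 < U z ^ 2 + W z ^ 2) (hU : HasDirDeriv U z e β) (hW : HasDirDeriv W z e η) :
    HasDirDeriv (fun z => KM c γ (U z) (W z) / BM c γ (U z) (W z) * W z) z e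
      (mCoef c γ (U z) (W z) * U z * (mCoef c γ (U z) (W z) * (U z * η - W z * β)) /
        KM c γ (U z) (W z)) := by
  have hq := qM_pos hc hc1 h
  have hν := nuM_pos hc hc1 hγ h
  have hB := BM_pos hc hc1 hγ h
  have hK := KM_pos hc hc1 hγ h
  refine (((hasDirDeriv_KM hc hc1 hγ h hU hW).div (hasDirDeriv_BM hc hc1 h hU hW) hB.ne').mul
    hW).congr_val ?_
  have e1 : mCoef c γ (U z) (W z) * U z * (mCoef c γ (U z) (W z) * (U z * η - W z * β)) /
      KM c γ (U z) (W z) = sigM c γ (U z) (W z) ^ 2 * U z * (U z * η - W z * β) *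
        KM c γ (U z) (W z) / BM c γ (U z) (W z) ^ 2 := by
    unfold mCoef; field_simp
  rw [e1, sigM_sq hc hc1 hγ h]
  have f1 := qM_sq hc hc1 h
  have f2 := BM_eq (γ := γ) hc hc1 h
  have f3 := nuM_eq c γ (U z) (W z)
  generalize 1 - c ^ 2 = ε at *
  generalize qM c (U z) (W z) = q at *
  generalize BM c γ (U z) (W z) = B at *
  generalize nuM c γ (U z) (W z) = ν at *
  generalize KM c γ (U z) (W z) = K at *
  generalize U z = u at *
  generalize W z = w at *
  field_simp
  subst f2 f3
  grind

/-- The logarithmic derivative `D` of the coefficient of `m`. The two identities are the components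
along `n` and `b̃` of `K ∂m_i/∂y^j = -l_i m_j + I m_i m_j`. -/
theorem hasDirDeriv_mCoef (hc : 0 < c) (hc1 : c < 1) (hγ : γ ∈ Set.Ioo (-2 : ℝ) 2)
    (h : 0 < U z ^ 2 + W z ^ 2) (hU : HasDirDeriv U z e β) (hW : HasDirDeriv W z e η) :
    ∃ D : ℝ, HasDirDeriv (fun z => mCoef c γ (U z) (W z)) z e (mCoef c γ (U z) (W z) * D) ∧
      KM c γ (U z) (W z) * (W z * D + η) = mCoef c γ (U z) (W z) * (U z * η - W z * β) *
        ((U z + γ * c * qM c (U z) (W z)) / sigM c γ (U z) (W z)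
          + IM c γ (U z) (W z) * W z) ∧
      KM c γ (U z) (W z) * (U z * D + β) = mCoef c γ (U z) (W z) * (U z * η - W z * β) *
        (-(W z / sigM c γ (U z) (W z)) + IM c γ (U z) (W z) * U z) := by
  have hq := qM_pos hc hc1 h
  have hν := nuM_pos hc hc1 hγ h
  have hB := BM_pos hc hc1 hγ h
  have hK := KM_pos hc hc1 hγ h
  have hs := sigM_pos hc hc1 hγ h
  refine ⟨(1 / 2) * ((((1 - c ^ 2) * U z * β + W z * η) / qM c (U z) (W z)
      + (1 - c ^ 2) * (γ * c) * β) / nuM c γ (U z) (W z)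
        - ((1 - c ^ 2) * U z * β + W z * η) / qM c (U z) (W z) / qM c (U z) (W z))
      + ((U z + γ * c * qM c (U z) (W z)) * β + W z * η) / BM c γ (U z) (W z)
      - (2 * U z * β + 2 * W z * η + γ * c * (β * qM c (U z) (W z)
        + U z * (((1 - c ^ 2) * U z * β + W z * η) / qM c (U z) (W z)))) /
          BM c γ (U z) (W z), ?_, ?_, ?_⟩
  · refine ((hasDirDeriv_sigM hc hc1 hγ h hU hW).mul
      ((hasDirDeriv_KM hc hc1 hγ h hU hW).div (hasDirDeriv_BM hc hc1 h hU hW) hB.ne')).congr_val ?_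
    unfold mCoef
    field_simp
    ring
  all_goals
    rw [IM, sqrt_q_mul_nu hc hc1 hγ h, invXFun]
    change _ = _ * (_ + -(c / 2) * (W z * (γ * (2 + (1 - c ^ 2) * BM c γ (U z) (W z) /
      (qM c (U z) (W z) * nuM c γ (U z) (W z))) / _)) * _)
    unfold mCoef
    have f1 := qM_sq hc hc1 h
    have f2 := BM_eq (γ := γ) hc hc1 h
    have f3 := nuM_eq c γ (U z) (W z)
    generalize 1 - c ^ 2 = ε at *
    generalize qM c (U z) (W z) = q at *
    generalize BM c γ (U z) (W z) = B at *
    generalize nuM c γ (U z) (W z) = ν at *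
    generalize KM c γ (U z) (W z) = K at *
    generalize sigM c γ (U z) (W z) = σ at *
    generalize U z = u at *
    generalize W z = w at *
    field_simp
    subst f2 f3
    grind

theorem hasDirDeriv_IM (hc : 0 < c) (hc1 : c < 1) (hγ : γ ∈ Set.Ioo (-2 : ℝ) 2)
    (h : 0 < U z ^ 2 + W z ^ 2) (hU : HasDirDeriv U z e β) (hW : HasDirDeriv W z e η) :
    HasDirDeriv (fun z => IM c γ (U z) (W z)) z e (IThM c γ (U z) (W z) *
      (mCoef c γ (U z) (W z) * (U z * η - W z * β)) / KM c γ (U z) (W z)) := by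
  have hq := qM_pos hc hc1 h
  have hν := nuM_pos hc hc1 hγ h
  have hB := BM_pos hc hc1 hγ h
  have hK := KM_pos hc hc1 hγ h
  have hs := sigM_pos hc hc1 hγ h
  have hs2 := sigM_sq hc hc1 hγ h
  have hqd := hasDirDeriv_qM hc hc1 h hU hW
  have hνd := hasDirDeriv_nuM (γ := γ) hc hc1 h hU hW
  have hBd := hasDirDeriv_BM (γ := γ) hc hc1 h hU hW
  have hX :=
    (hasDirDeriv_const 2).add ((hBd.const_mul (1 - c ^ 2)).div (hqd.mul hνd) (mul_pos hq hν).ne')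
  refine ((hW.mul ((hX.const_mul γ).div ((hqd.mul hνd).sqrt (mul_pos hq hν).ne')
    (Real.sqrt_pos.2 (mul_pos hq hν)).ne')).const_mul (-(c / 2))).congr_val ?_
  rw [sqrt_q_mul_nu hc hc1 hγ h]
  unfold mCoef IThM
  have f1 := qM_sq hc hc1 h
  have f2 := BM_eq (γ := γ) hc hc1 h
  have f3 := nuM_eq c γ (U z) (W z)
  generalize 1 - c ^ 2 = ε at *
  generalize qM c (U z) (W z) = q at *
  generalize BM c γ (U z) (W z) = B at *
  generalize nuM c γ (U z) (W z) = ν at *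
  generalize KM c γ (U z) (W z) = K at *
  generalize sigM c γ (U z) (W z) = σ at *
  generalize U z = u at *
  generalize W z = w at *
  -- Eliminating `ν` in favour of `σ` leaves no square roots other than `σ` and `q`.
  have hν' : ν = σ ^ 2 * q := by rw [hs2]; field_simp
  rw [hν']
  field_simp
  rw [hν'] at f3
  clear hX hBd hνd hqd
  subst f2
  grind

end Model

end Finsleroid

namespace Finsleroid

/-! ### The angle in frame coordinates -/

/-- The polar angle in `(α - π, α + π)` of the point `(u, w)` of the plane. -/
noncomputable def polM (α u w : ℝ) : ℝ :=
  α + (⟨u * Real.cos α + w * Real.sin α, w * Real.cos α - u * Real.sin α⟩ : ℂ).arg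

/-- The plane without the origin and the ray opposite to the direction `α`. -/
def slitM (α u w : ℝ) : Prop :=
  (⟨u * Real.cos α + w * Real.sin α, w * Real.cos α - u * Real.sin α⟩ : ℂ) ∈ Complex.slitPlane

/-- The coordinates in `polM` and `slitM` are those of `(u, w)` rotated by the angle `-α`. -/
theorem rot_sq (α u w : ℝ) : (u * Real.cos α + w * Real.sin α) ^ 2
    + (w * Real.cos α - u * Real.sin α) ^ 2 = u ^ 2 + w ^ 2 := by
  linear_combination (u ^ 2 + w ^ 2) * Real.cos_sq_add_sin_sq α

theorem slitM_pos {α u w : ℝ} (h : slitM α u w) : 0 < u ^ 2 + w ^ 2 := by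
  rw [← rot_sq α]
  rcases Complex.mem_slitPlane_iff.1 h with h | h
  · have h : 0 < u * Real.cos α + w * Real.sin α := h
    positivity
  · have h : w * Real.cos α - u * Real.sin α ≠ 0 := h
    positivity

theorem cos_sin_polM (α : ℝ) {u w : ℝ} (h : 0 < u ^ 2 + w ^ 2) :
    Real.cos (polM α u w) = u / √(u ^ 2 + w ^ 2) ∧
      Real.sin (polM α u w) = w / √(u ^ 2 + w ^ 2) := by
  have hn : ‖(⟨u * Real.cos α + w * Real.sin α, w * Real.cos α - u * Real.sin α⟩ : ℂ)‖ =
      √(u ^ 2 + w ^ 2) := by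
    rw [← rot_sq α, Complex.norm_def, Complex.normSq_mk]; congr 1; ring
  have hr := Real.sqrt_pos.2 h
  have h0 : (⟨u * Real.cos α + w * Real.sin α, w * Real.cos α - u * Real.sin α⟩ : ℂ) ≠ 0 := by
    rw [← norm_pos_iff, hn]; exact hr
  have hcs := Real.cos_sq_add_sin_sq α
  constructor
  · rw [polM, Real.cos_add, Complex.cos_arg h0, Complex.sin_arg, hn]
    field_simp
    linear_combination u * hcs
  · rw [polM, Real.sin_add, Complex.cos_arg h0, Complex.sin_arg, hn]
    field_simp
    linear_combination w * hcs

theorem angleDensity_polM {c γ : ℝ} (hc : 0 < c) (hc1 : c < 1) (α : ℝ) {u w : ℝ}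
    (h : 0 < u ^ 2 + w ^ 2) :
    angleDensity c γ (polM α u w) = sigM c γ u w * (u ^ 2 + w ^ 2) / BM c γ u w := by
  have hq := qM_pos hc hc1 h
  have hr := Real.sqrt_pos.2 h
  have hr2 := Real.sq_sqrt h.le
  have e1 : √(1 - (c * (u / √(u ^ 2 + w ^ 2))) ^ 2) = qM c u w / √(u ^ 2 + w ^ 2) := by
    rw [qM, ← Real.sqrt_div' _ h.le]
    congr 1
    rw [mul_pow, div_pow, hr2]
    field_simp
  unfold angleDensity
  rw [(cos_sin_polM α h).1, e1]
  have e2 : nuFun c γ (c * (u / √(u ^ 2 + w ^ 2))) (qM c u w / √(u ^ 2 + w ^ 2)) /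
      (qM c u w / √(u ^ 2 + w ^ 2)) = nuM c γ u w / qM c u w := by
    unfold nuM nuFun; field_simp
  have e3 : BFun γ (c * (u / √(u ^ 2 + w ^ 2))) (qM c u w / √(u ^ 2 + w ^ 2)) =
      BM c γ u w / (u ^ 2 + w ^ 2) := by
    rw [BM, BFun, BFun]; field_simp; rw [hr2]
  rw [e2, e3, ← sigM]
  field_simp

section Model

variable {E : Type*} [NormedAddCommGroup E] [NormedSpace ℝ E] {U W : E → ℝ} {z e : E} {β η : ℝ}
  {c γ : ℝ}

theorem hasDirDeriv_polM (α : ℝ) (h : slitM α (U z) (W z))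
    (hU : HasDirDeriv U z e β) (hW : HasDirDeriv W z e η) :
    HasDirDeriv (fun z => polM α (U z) (W z)) z e
      ((U z * η - W z * β) / (U z ^ 2 + W z ^ 2)) := by
  refine ((hasDirDeriv_const α).add (((hU.mul_const (Real.cos α)).add
    (hW.mul_const (Real.sin α))).arg ((hW.mul_const (Real.cos α)).sub
      (hU.mul_const (Real.sin α))) h)).congr_val ?_
  rw [rot_sq, zero_add]
  congr 1
  linear_combination (U z * η - W z * β) * Real.cos_sq_add_sin_sq α

/-- `K dθ = m`. -/
theorem hasDirDeriv_angle (hc : 0 < c) (hc1 : c < 1) (hγ : γ ∈ Set.Ioo (-2 : ℝ) 2) (α : ℝ)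
    (h : slitM α (U z) (W z)) (hU : HasDirDeriv U z e β) (hW : HasDirDeriv W z e η) :
    HasDirDeriv (fun z => angleLift c γ (polM α (U z) (W z))) z e
      (mCoef c γ (U z) (W z) * (U z * η - W z * β) / KM c γ (U z) (W z)) := by
  have hp := slitM_pos h
  have hK := KM_pos hc hc1 hγ hp
  refine ((hasDirDeriv_polM α h hU hW).comp_hasDerivAt
    (hasDerivAt_angleLift hc hc1 hγ _)).congr_val ?_
  rw [angleDensity_polM hc hc1 α hp]
  unfold mCoef
  field_simp

theorem contDiffAt_polM (α : ℝ) (h : slitM α (U z) (W z)) (hU : ContDiffAt ℝ ∞ U z)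
    (hW : ContDiffAt ℝ ∞ W z) : ContDiffAt ℝ ∞ (fun z => polM α (U z) (W z)) z :=
  contDiffAt_const.add (contDiffAt_arg ((hU.mul contDiffAt_const).add (hW.mul contDiffAt_const))
    ((hW.mul contDiffAt_const).sub (hU.mul contDiffAt_const)) h)

theorem polM_add_two_pi (α u w : ℝ) : polM (α + 2 * Real.pi) u w = polM α u w + 2 * Real.pi := by
  unfold polM; rw [Real.cos_add_two_pi, Real.sin_add_two_pi]; ring

theorem slitM_add_two_pi {α u w : ℝ} (h : slitM α u w) : slitM (α + 2 * Real.pi) u w := by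
  unfold slitM; rw [Real.cos_add_two_pi, Real.sin_add_two_pi]; exact h

/-- Two determinations of the polar angle differ by a number of full turns. -/
theorem polM_eq_add_int_mul (α α' : ℝ) {u w : ℝ} (h : 0 < u ^ 2 + w ^ 2) :
    ∃ k : ℤ, polM α' u w = polM α u w + k * (2 * Real.pi) := by
  have h1 := cos_sin_polM α h
  have h2 := cos_sin_polM α' h
  have h3 := (Real.Angle.angle_eq_iff_two_pi_dvd_sub (θ := polM α' u w) (ψ := polM α u w)).1
    (Real.Angle.cos_sin_inj (h2.1.trans h1.1.symm) (h2.2.trans h1.2.symm))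
  obtain ⟨k, hk⟩ := h3
  exact ⟨k, by linarith⟩

/-- Every point of the punctured plane is in the domain of the branch around its own direction. -/
theorem slitM_of_polar {u w : ℝ} (h : 0 < u ^ 2 + w ^ 2) : slitM (polM 0 u w) u w := by
  have h1 := cos_sin_polM 0 h
  have hr := Real.sqrt_pos.2 h
  unfold slitM
  rw [h1.1, h1.2, Complex.mem_slitPlane_iff]
  left
  have : u * (u / √(u ^ 2 + w ^ 2)) + w * (w / √(u ^ 2 + w ^ 2)) =
      (u ^ 2 + w ^ 2) / √(u ^ 2 + w ^ 2) := by ring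
  change 0 < u * (u / √(u ^ 2 + w ^ 2)) + w * (w / √(u ^ 2 + w ^ 2))
  rw [this]
  positivity

end Model

end Finsleroid

namespace FinsleroidSpace

variable (s : FinsleroidSpace) {x y : Pt} {γ : ℝ}

/-! ### Translation to frame coordinates -/

theorem q_eq (hx : x ∈ s.Ω) (y : Pt) : s.q x y = qM s.c (s.btForm x y) (s.nForm x y) := by
  rw [q, s.Ssq_eq hx, b_eq, qM]

theorem KFam_eq (hx : x ∈ s.Ω) (γ : ℝ) (y : Pt) :
    s.KFam γ x y = KM s.c γ (s.btForm x y) (s.nForm x y) := by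
  rw [KFam, s.q_eq hx, b_eq, KM]

theorem B_eq (hx : x ∈ s.Ω) (y : Pt) :
    s.B x y = BM s.c (s.g x) (s.btForm x y) (s.nForm x y) := by
  rw [B, s.q_eq hx, b_eq, BM]

theorem nu_eq (hx : x ∈ s.Ω) (y : Pt) :
    s.nu x y = nuM s.c (s.g x) (s.btForm x y) (s.nForm x y) := by
  rw [nu, s.q_eq hx, b_eq, nuM]

theorem TFam_eq (hx : x ∈ s.Ω) (γ : ℝ) (y : Pt) :
    s.TFam γ x y = 1 / s.c * sigM s.c γ (s.btForm x y) (s.nForm x y) *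
      (KM s.c γ (s.btForm x y) (s.nForm x y) ^ 2 / BM s.c γ (s.btForm x y) (s.nForm x y)) := by
  rw [TFam, s.q_eq hx, b_eq, s.KFam_eq hx, sigM, nuM, BM]

theorem KFam_pos (hγ : γ ∈ Set.Ioo (-2 : ℝ) 2) (hx : x ∈ s.Ω) (hy : y ≠ 0) :
    0 < s.KFam γ x y := by
  rw [s.KFam_eq hx]
  exact KM_pos s.c_pos s.c_lt_one hγ (s.Ssq_pos hx hy)

theorem mLowFam_eq (hγ : γ ∈ Set.Ioo (-2 : ℝ) 2) (hx : x ∈ s.Ω) (hy : y ≠ 0) (i : Fin 2) :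
    s.mLowFam i γ x y = mCoef s.c γ (s.btForm x y) (s.nForm x y) *
      (s.btForm x y * s.n x i - s.nForm x y * s.bt x i) := by
  have hc := s.c_pos.ne'
  have hK := (KM_pos s.c_pos s.c_lt_one hγ (s.Ssq_pos hx hy)).ne'
  have hB := (BM_pos s.c_pos s.c_lt_one hγ (s.Ssq_pos hx hy)).ne'
  rw [mLowFam, s.KFam_eq hx, s.TFam_eq hx, b_eq, bLow, mCoef]
  field_simp

theorem xFam_eq (hx : x ∈ s.Ω) (γ : ℝ) (y : Pt) :
    s.xFam γ x y = γ * invXFun s.c γ (s.c * s.btForm x y) (qM s.c (s.btForm x y) (s.nForm x y)) /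
      √(qM s.c (s.btForm x y) (s.nForm x y) * nuM s.c γ (s.btForm x y) (s.nForm x y)) := by
  rw [xFam, s.q_eq hx, b_eq, nuM]

/-- The main scalar `I`, with the charge as a parameter. -/
noncomputable def IFam (γ : ℝ) (x y : Pt) : ℝ := -(s.c / 2) * (s.nForm x y * s.xFam γ x y)

theorem IFam_eq (hx : x ∈ s.Ω) (γ : ℝ) (y : Pt) :
    s.IFam γ x y = IM s.c γ (s.btForm x y) (s.nForm x y) := by
  rw [IFam, s.xFam_eq hx, IM]

theorem I_eq (x y : Pt) : s.I x y = s.IFam (s.g x) x y := by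
  rw [I, IFam, xFam, invX, nu]; ring

theorem θFam_eq (α γ : ℝ) (x y : Pt) :
    s.θFam α γ x y = angleLift s.c γ (polM α (s.btForm x y) (s.nForm x y)) ∧
      (y ∈ s.sector α x ↔ slitM α (s.btForm x y) (s.nForm x y)) := by
  have h : s.frameCoord α x y = ⟨s.btForm x y * Real.cos α + s.nForm x y * Real.sin α,
      s.nForm x y * Real.cos α - s.btForm x y * Real.sin α⟩ := by
    have : -(Complex.I * (α : ℂ)) = ((-α : ℝ) : ℂ) * Complex.I := by push_cast; ring
    rw [frameCoord, this, Complex.exp_mul_I, ← Complex.ofReal_cos, ← Complex.ofReal_sin,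
      Real.cos_neg, Real.sin_neg]
    apply Complex.ext
    · simp [Complex.cos_ofReal_re, Complex.sin_ofReal_re]
    · simp [Complex.cos_ofReal_re, Complex.sin_ofReal_re]; ring
  rw [θFam, polar, sector, Set.mem_ofPred_eq, h]
  exact ⟨rfl, Iff.rfl⟩

theorem sector_ne_zero {α : ℝ} (hy : y ∈ s.sector α x) : y ≠ 0 := by
  rintro rfl
  have := slitM_pos ((s.θFam_eq α 0 x 0).2.1 hy)
  simp [btForm, nForm] at this

/-! ### Derivatives in `y` -/

section VerticalDerivatives

variable (hγ : γ ∈ Set.Ioo (-2 : ℝ) 2) (hx : x ∈ s.Ω) (hy : y ≠ 0)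

include hγ hx hy

theorem lLowFam_eq (i : Fin 2) :
    s.lLowFam i γ x y = KM s.c γ (s.btForm x y) (s.nForm x y) /
      BM s.c γ (s.btForm x y) (s.nForm x y) * ((s.btForm x y
        + γ * s.c * qM s.c (s.btForm x y) (s.nForm x y)) * s.bt x i + s.nForm x y * s.n x i) := by
  refine ((hasDirDeriv_KM s.c_pos s.c_lt_one hγ (s.Ssq_pos hx hy)
    (s.btForm_hasDirDeriv_snd x y i) (s.nForm_hasDirDeriv_snd x y i)).congr_fun ?_).pd
  exact Filter.Eventually.of_forall fun y' => s.KFam_eq hx γ y'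

theorem KFam_hasDirDeriv (i : Fin 2) :
    HasDirDeriv (s.KFam γ x) y (Pi.single i 1) (s.lLowFam i γ x y) := by
  rw [s.lLowFam_eq hγ hx hy]
  refine ((hasDirDeriv_KM s.c_pos s.c_lt_one hγ (s.Ssq_pos hx hy)
    (s.btForm_hasDirDeriv_snd x y i) (s.nForm_hasDirDeriv_snd x y i)).congr_fun ?_)
  exact Filter.Eventually.of_forall fun y' => s.KFam_eq hx γ y'

theorem lLowFam_hasDirDeriv (i j : Fin 2) :
    HasDirDeriv (s.lLowFam i γ x) y (Pi.single j 1)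
      (s.mLowFam i γ x y * s.mLowFam j γ x y / s.KFam γ x y) := by
  have hp := s.Ssq_pos hx hy
  have hU := s.btForm_hasDirDeriv_snd x y j
  have hW := s.nForm_hasDirDeriv_snd x y j
  have h1 := (((hasDirDeriv_lCoef_u s.c_pos s.c_lt_one hγ hp hU hW).mul_const (s.bt x i)).add
    ((hasDirDeriv_lCoef_w s.c_pos s.c_lt_one hγ hp hU hW).mul_const (s.n x i)))
  refine (h1.congr_val ?_).congr_fun ?_
  · rw [s.mLowFam_eq hγ hx hy, s.mLowFam_eq hγ hx hy, s.KFam_eq hx]; ring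
  · filter_upwards [isOpen_ne.mem_nhds hy] with y' hy'
    rw [s.lLowFam_eq hγ hx hy']; ring

theorem mLowFam_hasDirDeriv (i j : Fin 2) :
    HasDirDeriv (s.mLowFam i γ x) y (Pi.single j 1)
      ((-s.lLowFam i γ x y * s.mLowFam j γ x y
        + s.IFam γ x y * s.mLowFam i γ x y * s.mLowFam j γ x y) / s.KFam γ x y) := by
  have hp := s.Ssq_pos hx hy
  have hU := s.btForm_hasDirDeriv_snd x y j
  have hW := s.nForm_hasDirDeriv_snd x y j
  obtain ⟨D, hD, h1, h2⟩ := hasDirDeriv_mCoef s.c_pos s.c_lt_one hγ hp hU hW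
  have hd := hD.mul ((hU.mul_const (s.n x i)).sub (hW.mul_const (s.bt x i)))
  refine (hd.congr_val ?_).congr_fun ?_
  · have hK := KM_pos s.c_pos s.c_lt_one hγ hp
    have hB := BM_pos s.c_pos s.c_lt_one hγ hp
    have hs := sigM_pos s.c_pos s.c_lt_one hγ hp
    rw [s.mLowFam_eq hγ hx hy, s.mLowFam_eq hγ hx hy, s.KFam_eq hx, s.IFam_eq hx,
      s.lLowFam_eq hγ hx hy, eq_div_iff hK.ne']
    have e1 : KM s.c γ (s.btForm x y) (s.nForm x y) / BM s.c γ (s.btForm x y) (s.nForm x y) =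
        mCoef s.c γ (s.btForm x y) (s.nForm x y) / sigM s.c γ (s.btForm x y) (s.nForm x y) := by
      unfold mCoef; field_simp
    rw [e1]
    linear_combination mCoef s.c γ (s.btForm x y) (s.nForm x y) * s.n x i * h2
      - mCoef s.c γ (s.btForm x y) (s.nForm x y) * s.bt x i * h1
  · filter_upwards [isOpen_ne.mem_nhds hy] with y' hy'
    rw [s.mLowFam_eq hγ hx hy']

theorem IFam_hasDirDeriv (j : Fin 2) :
    HasDirDeriv (s.IFam γ x) y (Pi.single j 1)
      (IThM s.c γ (s.btForm x y) (s.nForm x y) * s.mLowFam j γ x y / s.KFam γ x y) := by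
  rw [s.mLowFam_eq hγ hx hy, s.KFam_eq hx]
  refine (hasDirDeriv_IM s.c_pos s.c_lt_one hγ (s.Ssq_pos hx hy)
    (s.btForm_hasDirDeriv_snd x y j) (s.nForm_hasDirDeriv_snd x y j)).congr_fun ?_
  exact Filter.Eventually.of_forall fun y' => s.IFam_eq hx γ y'

omit hy in
theorem θFam_hasDirDeriv {α : ℝ} (hα : y ∈ s.sector α x) (j : Fin 2) :
    HasDirDeriv (s.θFam α γ x) y (Pi.single j 1) (s.mLowFam j γ x y / s.KFam γ x y) := by
  rw [s.mLowFam_eq hγ hx (s.sector_ne_zero hα), s.KFam_eq hx]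
  refine (hasDirDeriv_angle s.c_pos s.c_lt_one hγ α ((s.θFam_eq α γ x y).2.1 hα)
    (s.btForm_hasDirDeriv_snd x y j) (s.nForm_hasDirDeriv_snd x y j)).congr_fun ?_
  exact Filter.Eventually.of_forall fun y' => (s.θFam_eq α γ x y').1

end VerticalDerivatives

end FinsleroidSpace

namespace Finsleroid

/-! ### Homogeneity -/

theorem fFun_smul {γ b q r : ℝ} (hγ : γ ∈ Set.Ioo (-2 : ℝ) 2) (hq : 0 < q) (hr : 0 < r) :
    fFun γ (r * b) (r * q) = fFun γ b q := by
  rw [fFun_eq_arg hγ (mul_pos hr hq), fFun_eq_arg hγ hq]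
  congr 1
  rw [← Complex.arg_real_mul ⟨LFun γ b q, hFun γ * b⟩ hr]
  congr 1
  apply Complex.ext <;> simp [LFun] <;> ring

theorem KFun_smul {γ b q r : ℝ} (hγ : γ ∈ Set.Ioo (-2 : ℝ) 2) (hq : 0 < q) (hr : 0 < r) :
    KFun γ (r * b) (r * q) = r * KFun γ b q := by
  have : BFun γ (r * b) (r * q) = r ^ 2 * BFun γ b q := by unfold BFun; ring
  rw [KFun, KFun, fFun_smul hγ hq hr, this, Real.sqrt_mul (sq_nonneg r), Real.sqrt_sq hr.le]
  ring

theorem KM_smul {c γ u w r : ℝ} (hc : 0 < c) (hc1 : c < 1) (hγ : γ ∈ Set.Ioo (-2 : ℝ) 2)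
    (h : 0 < u ^ 2 + w ^ 2) (hr : 0 < r) : KM c γ (r * u) (r * w) = r * KM c γ u w := by
  have e : qM c (r * u) (r * w) = r * qM c u w := by
    have : (r * u) ^ 2 + (r * w) ^ 2 - (c * (r * u)) ^ 2 =
      r ^ 2 * (u ^ 2 + w ^ 2 - (c * u) ^ 2) := by ring
    rw [qM, this, Real.sqrt_mul (sq_nonneg r), Real.sqrt_sq hr.le, qM]
  rw [KM, KM, e, ← KFun_smul hγ (qM_pos hc hc1 h) hr]
  congr 1
  ring

theorem polM_smul {α u w r : ℝ} (hr : 0 < r) : polM α (r * u) (r * w) = polM α u w := by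
  unfold polM
  congr 1
  rw [← Complex.arg_real_mul ⟨u * Real.cos α + w * Real.sin α, w * Real.cos α - u * Real.sin α⟩ hr]
  congr 1
  apply Complex.ext <;> simp <;> ring

end Finsleroid

namespace FinsleroidSpace

variable (s : FinsleroidSpace) {x y : Pt} {γ : ℝ} {α : ℝ}

/-! ### Smooth families -/

section Families

variable {W : Set (Pt × Pt)} {F : ℝ → Pt → Pt → ℝ}

theorem smoothOn_atCharge (hW : ∀ z ∈ W, z.1 ∈ s.Ω) (hF : FamSmoothOn F W) :
    SmoothOn (s.atCharge F) W := by
  have h : ContDiffOn ℝ ∞ (fun z : Pt × Pt => (s.g z.1, z.1, z.2)) W :=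
    ContDiffOn.prodMk (s.g_smooth.comp contDiffOn_fst hW) contDiffOn_id
  exact ContDiffOn.comp hF h fun z hz => ⟨s.g_mem _ (hW z hz), hz⟩

theorem smoothOn_pd_g (hW : ∀ z ∈ W, z.1 ∈ s.Ω) (n : Fin 2) :
    SmoothOn (fun x _ => pd s.g n x) W :=
  smoothOn_of_fst (contDiffOn_pd s.isOpen_Ω s.g_smooth n) hW

theorem smoothOn_dStar (hW : ∀ z ∈ W, z.1 ∈ s.Ω) (hWo : IsOpen W) (hF : FamSmoothOn F W)
    (n : Fin 2) : SmoothOn (s.dStar F n) W :=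
  (s.smoothOn_pd_g hW n).mul (s.smoothOn_atCharge hW (hF.deriv_charge hWo))

/-- Differentiation in `y` commutes with `∂*_n`. -/
theorem dStar_hasDirDeriv (hW : ∀ z ∈ W, z.1 ∈ s.Ω) (hWo : IsOpen W) (hF : FamSmoothOn F W)
    (hz : (x, y) ∈ W) (n m : Fin 2) :
    HasDirDeriv (s.dStar F n x) y (Pi.single m 1)
      (s.dStar (fun γ x y => pd (F γ x) m y) n x y) :=
  (hF.hasDirDeriv_deriv_charge hWo (s.g_mem x (hW _ hz)) hz m).const_mul _

/-- The total derivative in `x` is `∂*_n` plus the derivative at a fixed value of the charge. -/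
theorem atCharge_hasDirDeriv_fst (hW : ∀ z ∈ W, z.1 ∈ s.Ω) (hWo : IsOpen W) (hF : FamSmoothOn F W)
    (hz : (x, y) ∈ W) (n : Fin 2) {v : ℝ}
    (hv : HasDirDeriv (fun x' => F (s.g x) x' y) x (Pi.single n 1) v) :
    HasDirDeriv (fun x' => s.atCharge F x' y) x (Pi.single n 1) (s.dStar F n x y + v) := by
  have hx := hW _ hz
  have hg : DifferentiableAt ℝ s.g x :=
    (s.g_smooth.contDiffAt (s.isOpen_Ω.mem_nhds hx)).differentiableAt (by simp)
  have hγ := s.g_mem x hx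
  refine (hasDirDeriv_of_hasFDerivAt_comp (F := fun z : ℝ × Pt × Pt => F z.1 z.2.1 z.2.2)
    (φ := fun x' => (s.g x', x', y)) ((hF.contDiffAt hWo hγ hz).differentiableAt (by simp))
    (hg.hasFDerivAt.prodMk ((hasFDerivAt_id x).prodMk (hasFDerivAt_const y x)))).congr_val ?_
  have h1 := (hF.hasDirDeriv_charge hWo hγ hz).2
  have h2 := (hF.hasDirDeriv_fst hWo hγ hz (Pi.single n 1)).unique hv
  rw [dStar, deriv, h1, ← h2, ← smul_eq_mul, ← map_smul, ← map_add]
  congr 1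
  simp [pd]

theorem contDiffAt_frame {z : ℝ × Pt × Pt} (hx : z.2.1 ∈ s.Ω) :
    ContDiffAt ℝ ∞ (fun z : ℝ × Pt × Pt => s.btForm z.2.1 z.2.2) z ∧
      ContDiffAt ℝ ∞ (fun z : ℝ × Pt × Pt => s.nForm z.2.1 z.2.2) z := by
  have hz : (z.2.1, z.2.2) ∈ {z : Pt × Pt | z.1 ∈ s.Ω} := hx
  have ho : IsOpen {z : Pt × Pt | z.1 ∈ s.Ω} := s.isOpen_Ω.preimage continuous_fst
  have h1 : SmoothOn s.btForm {z : Pt × Pt | z.1 ∈ s.Ω} := s.smoothOn_btForm fun _ h => h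
  have h2 : SmoothOn s.nForm {z : Pt × Pt | z.1 ∈ s.Ω} := s.smoothOn_nForm fun _ h => h
  exact ⟨ContDiffAt.comp (g := fun z : Pt × Pt => s.btForm z.1 z.2) z (h1.contDiffAt ho hz)
      contDiffAt_snd,
    ContDiffAt.comp (g := fun z : Pt × Pt => s.nForm z.1 z.2) z (h2.contDiffAt ho hz)
      contDiffAt_snd⟩

theorem slitBundle_fst : ∀ z ∈ s.slitBundle, z.1 ∈ s.Ω := fun _ h => h.1

theorem branchDomain_fst (α : ℝ) : ∀ z ∈ s.branchDomain α, z.1 ∈ s.Ω := fun _ h => h.1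

theorem branchDomain_subset (α : ℝ) : s.branchDomain α ⊆ s.slitBundle :=
  fun _ h => ⟨h.1, s.sector_ne_zero h.2⟩

theorem isOpen_branchDomain (α : ℝ) : IsOpen (s.branchDomain α) := by
  have ho : IsOpen {z : Pt × Pt | z.1 ∈ s.Ω} := s.isOpen_Ω.preimage continuous_fst
  have h1 : ContinuousOn (fun z : Pt × Pt => s.btForm z.1 z.2) {z : Pt × Pt | z.1 ∈ s.Ω} :=
    ContDiffOn.continuousOn (s.smoothOn_btForm fun _ h => h)
  have h2 : ContinuousOn (fun z : Pt × Pt => s.nForm z.1 z.2) {z : Pt × Pt | z.1 ∈ s.Ω} :=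
    ContDiffOn.continuousOn (s.smoothOn_nForm fun _ h => h)
  have h3 : ContinuousOn (fun z : Pt × Pt => s.frameCoord α z.1 z.2)
      {z : Pt × Pt | z.1 ∈ s.Ω} :=
    ((Complex.continuous_ofReal.comp_continuousOn h1).add (continuousOn_const.mul
      (Complex.continuous_ofReal.comp_continuousOn h2))).mul continuousOn_const
  exact h3.isOpen_inter_preimage ho Complex.isOpen_slitPlane

theorem contDiffAt_q {z : ℝ × Pt × Pt} (hx : z.2.1 ∈ s.Ω) (hy : z.2.2 ≠ 0) :
    ContDiffAt ℝ ∞ (fun z : ℝ × Pt × Pt => s.q z.2.1 z.2.2) z ∧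
      ContDiffAt ℝ ∞ (fun z : ℝ × Pt × Pt => s.b z.2.1 z.2.2) z ∧ 0 < s.q z.2.1 z.2.2 := by
  obtain ⟨hU, hV⟩ := s.contDiffAt_frame hx
  have hp := s.Ssq_pos hx hy
  refine ⟨?_, ?_, ?_⟩
  · have h : ContDiffAt ℝ ∞ (fun z : ℝ × Pt × Pt =>
        qM s.c (s.btForm z.2.1 z.2.2) (s.nForm z.2.1 z.2.2)) z :=
      (((hU.pow 2).add (hV.pow 2)).sub ((contDiffAt_const.mul hU).pow 2)).sqrt
        (qM_arg_pos s.c_pos s.c_lt_one hp).ne'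
    refine h.congr_of_eventuallyEq ?_
    filter_upwards [(s.isOpen_Ω.preimage (continuous_fst.comp continuous_snd)).mem_nhds hx]
      with z' hz' using s.q_eq hz' _
  · simp only [b_eq]
    exact contDiffAt_const.mul hU
  · rw [s.q_eq hx]; exact qM_pos s.c_pos s.c_lt_one hp

theorem nuFun_frame_pos (hγ : γ ∈ Set.Ioo (-2 : ℝ) 2) (hx : x ∈ s.Ω) (hy : y ≠ 0) :
    0 < nuFun s.c γ (s.b x y) (s.q x y) := by
  rw [s.q_eq hx, b_eq]
  exact nuM_pos s.c_pos s.c_lt_one hγ (s.Ssq_pos hx hy)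

theorem famSmoothOn_KFam : FamSmoothOn s.KFam s.slitBundle := fun _ hz =>
  have h := s.contDiffAt_q hz.2.1 hz.2.2
  (contDiffAt_KFun contDiffAt_fst h.2.1 h.1 hz.1 h.2.2).contDiffWithinAt

theorem famSmoothOn_TFam : FamSmoothOn s.TFam s.slitBundle := fun z hz => by
  have h := s.contDiffAt_q hz.2.1 hz.2.2
  have hν := s.nuFun_frame_pos hz.1 hz.2.1 hz.2.2
  have hB := BFun_pos (b := s.b z.2.1 z.2.2) hz.1 h.2.2
  refine ContDiffAt.contDiffWithinAt (ContDiffAt.mul (contDiffAt_const.mul (ContDiffAt.sqrt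
    ((contDiffAt_nuFun _ contDiffAt_fst h.2.1 h.1).div h.1 h.2.2.ne') (div_pos hν h.2.2).ne')) ?_)
  exact ((contDiffAt_KFun contDiffAt_fst h.2.1 h.1 hz.1 h.2.2).pow 2).div
    (contDiffAt_BFun contDiffAt_fst h.2.1 h.1) hB.ne'

theorem famSmoothOn_xFam : FamSmoothOn s.xFam s.slitBundle := fun z hz => by
  have h := s.contDiffAt_q hz.2.1 hz.2.2
  have hν := s.nuFun_frame_pos hz.1 hz.2.1 hz.2.2
  have hqν := h.1.mul (contDiffAt_nuFun s.c contDiffAt_fst h.2.1 h.1)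
  refine ContDiffAt.contDiffWithinAt (ContDiffAt.div (contDiffAt_fst.mul (contDiffAt_const.add
    ((contDiffAt_const.mul (contDiffAt_BFun contDiffAt_fst h.2.1 h.1)).div hqν
      (mul_pos h.2.2 hν).ne'))) (hqν.sqrt (mul_pos h.2.2 hν).ne')
      (Real.sqrt_pos.2 (mul_pos h.2.2 hν)).ne')

theorem famSmoothOn_of_smoothOn {F : Pt → Pt → ℝ} (h : SmoothOn F W) :
    FamSmoothOn (fun _ => F) W :=
  ContDiffOn.comp (g := fun z : Pt × Pt => F z.1 z.2) h contDiffOn_snd fun _ hz => hz.2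

theorem famSmoothOn_IFam : FamSmoothOn s.IFam s.slitBundle :=
  contDiffOn_const.mul (ContDiffOn.mul
    (famSmoothOn_of_smoothOn (s.smoothOn_nForm s.slitBundle_fst)) s.famSmoothOn_xFam)

theorem famSmoothOn_mLowFam (i : Fin 2) : FamSmoothOn (s.mLowFam i) s.slitBundle := by
  have h1 := s.smoothOn_btForm s.slitBundle_fst
  have h2 := s.smoothOn_nForm s.slitBundle_fst
  have h3 : SmoothOn (fun x y => s.b x y * s.n x i - s.nForm x y * s.bLow x i) s.slitBundle := by
    simp only [b_eq, bLow]
    exact (((smoothOn_const _).mul h1).mul (smoothOn_of_fst (s.n_smooth i) s.slitBundle_fst)).sub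
      (h2.mul ((smoothOn_const _).mul (smoothOn_of_fst (s.bt_smooth i) s.slitBundle_fst)))
  exact ContDiffOn.mul (ContDiffOn.mul (contDiffOn_const.div s.famSmoothOn_KFam
    fun z hz => (s.KFam_pos hz.1 hz.2.1 hz.2.2).ne') s.famSmoothOn_TFam)
    (famSmoothOn_of_smoothOn h3)

theorem famSmoothOn_lLowFam (i : Fin 2) : FamSmoothOn (s.lLowFam i) s.slitBundle :=
  s.famSmoothOn_KFam.pd_snd s.isOpen_slitBundle i

theorem famSmoothOn_θFam (α : ℝ) : FamSmoothOn (s.θFam α) (s.branchDomain α) := fun z hz => by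
  obtain ⟨hU, hV⟩ := s.contDiffAt_frame hz.2.1
  have h := contDiffAt_angleLift s.c_pos s.c_lt_one contDiffAt_fst
    (contDiffAt_polM α ((s.θFam_eq α z.1 _ _).2.1 hz.2.2) hU hV) hz.1
  exact (h.congr_of_eventuallyEq
    (Filter.Eventually.of_forall fun z => (s.θFam_eq α _ _ _).1)).contDiffWithinAt

end Families

end FinsleroidSpace

namespace FinsleroidSpace

variable (s : FinsleroidSpace) {x y : Pt} {α : ℝ}

/-! ### The Finsler frame -/

section FinslerFrame

variable (hx : x ∈ s.Ω) (hy : y ≠ 0)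

include hx hy

theorem K_pos : 0 < s.K x y := s.KFam_pos (s.g_mem x hx) hx hy

theorem lLow_eq (i : Fin 2) :
    s.lLow i x y = s.K x y / s.B x y * ((s.btForm x y + s.g x * s.c * s.q x y) * s.bt x i
      + s.nForm x y * s.n x i) := by
  have h := s.lLowFam_eq (s.g_mem x hx) hx hy i
  rw [← s.KFam_eq hx, ← s.B_eq hx, ← s.q_eq hx] at h
  exact h

theorem pos_facts : 0 < s.q x y ∧ 0 < s.B x y ∧ 0 < s.nu x y ∧ 0 < √(s.nu x y / s.q x y) := by
  have h := s.Ssq_pos hx hy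
  rw [s.q_eq hx, s.B_eq hx, s.nu_eq hx]
  exact ⟨qM_pos s.c_pos s.c_lt_one h, BM_pos s.c_pos s.c_lt_one (s.g_mem x hx) h,
    nuM_pos s.c_pos s.c_lt_one (s.g_mem x hx) h, sigM_pos s.c_pos s.c_lt_one (s.g_mem x hx) h⟩

theorem B_expand : s.B x y = s.btForm x y ^ 2 + s.nForm x y ^ 2
    + (s.g x * s.c) * s.btForm x y * s.q x y := by
  rw [s.B_eq hx, s.q_eq hx, BM_eq s.c_pos s.c_lt_one (s.Ssq_pos hx hy)]

theorem mLow_eq (i : Fin 2) :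
    s.mLow i x y = √(s.nu x y / s.q x y) * (s.K x y / s.B x y) *
      (s.btForm x y * s.n x i - s.nForm x y * s.bt x i) := by
  have h := s.mLowFam_eq (s.g_mem x hx) hx hy i
  rw [mCoef, sigM, ← s.KFam_eq hx, ← s.B_eq hx, ← s.q_eq hx, ← s.nu_eq hx] at h
  exact h

/-- Euler's identity for `K`. -/
theorem sum_lLow_lUp : ∑ k, s.lLow k x y * s.lUp k x y = 1 := by
  have hK := s.K_pos hx hy
  obtain ⟨hq, hB, hν, hs⟩ := s.pos_facts hx hy
  have hB' := s.B_expand hx hy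
  simp only [Fin.sum_univ_two, s.lLow_eq hx hy, lUp]
  have e : s.K x y / s.B x y * ((s.btForm x y + s.g x * s.c * s.q x y) * s.bt x 0 +
      s.nForm x y * s.n x 0) * (y 0 / s.K x y) + s.K x y / s.B x y *
      ((s.btForm x y + s.g x * s.c * s.q x y) * s.bt x 1 + s.nForm x y * s.n x 1) *
      (y 1 / s.K x y) = ((s.btForm x y + s.g x * s.c * s.q x y) * (s.bt x 0 * y 0 + s.bt x 1 * y 1)
        + s.nForm x y * (s.n x 0 * y 0 + s.n x 1 * y 1)) / s.B x y := by
    field_simp; ring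
  have e1 : s.bt x 0 * y 0 + s.bt x 1 * y 1 = s.btForm x y := by rw [btForm, Fin.sum_univ_two]
  have e2 : s.n x 0 * y 0 + s.n x 1 * y 1 = s.nForm x y := by rw [nForm, Fin.sum_univ_two]
  rw [e, e1, e2, div_eq_one_iff_eq hB.ne', hB']
  ring

theorem sum_mLow_lUp : ∑ k, s.mLow k x y * s.lUp k x y = 0 := by
  simp only [Fin.sum_univ_two, s.mLow_eq hx hy, lUp, btForm, nForm]
  ring

/-- The vector dual to `m_k`, in terms of the orthonormal frame. It is `m^k` by `mUp_eq`. -/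
theorem sum_low_mVec :
    ∑ k, s.lLow k x y * ((-s.nForm x y * s.btUp x k
      + (s.btForm x y + s.g x * s.c * s.q x y) * s.nUp x k) /
        (s.K x y * √(s.nu x y / s.q x y))) = 0 ∧
    ∑ k, s.mLow k x y * ((-s.nForm x y * s.btUp x k
      + (s.btForm x y + s.g x * s.c * s.q x y) * s.nUp x k) /
        (s.K x y * √(s.nu x y / s.q x y))) = 1 := by
  have hK := s.K_pos hx hy
  obtain ⟨hq, hB, hν, hs⟩ := s.pos_facts hx hy
  have hB' := s.B_expand hx hy
  have g1 := s.bt_btUp hx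
  have g2 := s.n_nUp hx
  have g3 := s.bt_nUp hx
  have g4 := s.n_btUp hx
  simp only [Fin.sum_univ_two, s.mLow_eq hx hy, s.lLow_eq hx hy]
  generalize √(s.nu x y / s.q x y) = σ at *
  generalize s.btForm x y = u at *
  generalize s.nForm x y = w at *
  generalize s.g x * s.c = δ at *
  generalize s.q x y = q at *
  generalize s.B x y = B at *
  generalize s.K x y = K at *
  constructor
  · field_simp
    linear_combination (u + δ * q) * (-w) * g1 + w * (u + δ * q) * g2
      + (u + δ * q) ^ 2 * g3 - w ^ 2 * g4
  · field_simp
    rw [hB']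
    linear_combination w ^ 2 * g1 + u * (u + δ * q) * g2 - w * (u + δ * q) * g3 - u * w * g4

theorem yLow_hasDirDeriv (i j : Fin 2) :
    HasDirDeriv (s.yLow i x) y (Pi.single j 1)
      (s.lLow i x y * s.lLow j x y + s.mLow i x y * s.mLow j x y) := by
  have hK : s.KFam (s.g x) x y ≠ 0 := (s.K_pos hx hy).ne'
  refine ((s.KFam_hasDirDeriv (s.g_mem x hx) hx hy j).mul
    (s.lLowFam_hasDirDeriv (s.g_mem x hx) hx hy i j)).congr_val ?_
  rw [lLow, mLow, lLow, mLow, atCharge, atCharge, atCharge, atCharge]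
  field_simp

theorem gMat_eq (i j : Fin 2) :
    s.gMat x y i j = s.lLow i x y * s.lLow j x y + s.mLow i x y * s.mLow j x y :=
  (s.yLow_hasDirDeriv hx hy i j).pd

theorem gMat_inv_eq (i j : Fin 2) :
    (s.gMat x y)⁻¹ i j = s.lUp i x y * s.lUp j x y + (-s.nForm x y * s.btUp x i
      + (s.btForm x y + s.g x * s.c * s.q x y) * s.nUp x i) /
        (s.K x y * √(s.nu x y / s.q x y)) * ((-s.nForm x y * s.btUp x j
      + (s.btForm x y + s.g x * s.c * s.q x y) * s.nUp x j) /
        (s.K x y * √(s.nu x y / s.q x y))) :=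
  dual_inv (M := fun k => (-s.nForm x y * s.btUp x k
      + (s.btForm x y + s.g x * s.c * s.q x y) * s.nUp x k) /
        (s.K x y * √(s.nu x y / s.q x y))) (s.sum_lLow_lUp hx hy) (s.sum_low_mVec hx hy).1
    (s.sum_mLow_lUp hx hy) (s.sum_low_mVec hx hy).2 (s.gMat_eq hx hy) i j

theorem mUp_eq (k : Fin 2) :
    s.mUp k x y = (-s.nForm x y * s.btUp x k
      + (s.btForm x y + s.g x * s.c * s.q x y) * s.nUp x k) /
        (s.K x y * √(s.nu x y / s.q x y)) := by
  have h1 := s.sum_mLow_lUp hx hy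
  have h2 := (s.sum_low_mVec hx hy).2
  simp only [mUp, s.gMat_inv_eq hx hy, Fin.sum_univ_two] at *
  generalize (-s.nForm x y * s.btUp x k + (s.btForm x y + s.g x * s.c * s.q x y) * s.nUp x k) /
        (s.K x y * √(s.nu x y / s.q x y)) = Mk
  linear_combination s.lUp k x y * h1 + Mk * h2

theorem sum_lLow_mUp : ∑ k, s.lLow k x y * s.mUp k x y = 0 := by
  simp only [s.mUp_eq hx hy]; exact (s.sum_low_mVec hx hy).1

theorem sum_mLow_mUp : ∑ k, s.mLow k x y * s.mUp k x y = 1 := by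
  simp only [s.mUp_eq hx hy]; exact (s.sum_low_mVec hx hy).2

theorem finsler_complete (i j : Fin 2) :
    s.lUp i x y * s.lLow j x y + s.mUp i x y * s.mLow j x y = if i = j then 1 else 0 :=
  dual_complete (M := fun k => s.mUp k x y) (s.sum_lLow_lUp hx hy) (s.sum_lLow_mUp hx hy)
    (s.sum_mLow_lUp hx hy) (s.sum_mLow_mUp hx hy) i j

theorem gMat_posDef : (s.gMat x y).PosDef := by
  refine Matrix.PosDef.of_dotProduct_mulVec_pos ?_ fun v hv => ?_
  · ext i j
    simp only [Matrix.conjTranspose_apply, star_trivial, s.gMat_eq hx hy]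
    ring
  · have e : star v ⬝ᵥ (s.gMat x y).mulVec v = (s.lLow 0 x y * v 0 + s.lLow 1 x y * v 1) ^ 2
        + (s.mLow 0 x y * v 0 + s.mLow 1 x y * v 1) ^ 2 := by
      simp only [dotProduct, Matrix.mulVec, Fin.sum_univ_two, s.gMat_eq hx hy, star_trivial]
      ring
    rw [e]
    by_contra h
    have h1 : s.lLow 0 x y * v 0 + s.lLow 1 x y * v 1 = 0 := by
      nlinarith [sq_nonneg (s.lLow 0 x y * v 0 + s.lLow 1 x y * v 1),
        sq_nonneg (s.mLow 0 x y * v 0 + s.mLow 1 x y * v 1)]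
    have h2 : s.mLow 0 x y * v 0 + s.mLow 1 x y * v 1 = 0 := by
      nlinarith [sq_nonneg (s.lLow 0 x y * v 0 + s.lLow 1 x y * v 1),
        sq_nonneg (s.mLow 0 x y * v 0 + s.mLow 1 x y * v 1)]
    refine hv (funext fun k => ?_)
    have f0 := s.finsler_complete hx hy k 0
    have f1 := s.finsler_complete hx hy k 1
    have h3 : v k = v 0 * (if k = 0 then 1 else 0) + v 1 * if k = 1 then 1 else 0 := by
      fin_cases k <;> simp
    rw [h3, ← f0, ← f1, Pi.zero_apply]
    linear_combination s.lUp k x y * h1 + s.mUp k x y * h2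

theorem gMat_det : (s.gMat x y).det =
    (s.lLow 0 x y * s.mLow 1 x y - s.lLow 1 x y * s.mLow 0 x y) ^ 2 := by
  simp only [Matrix.det_fin_two, s.gMat_eq hx hy]; ring

/-- The area form of `g_{ij}` in terms of that of the background metric. -/
theorem low_wedge (i j : Fin 2) :
    s.lLow i x y * s.mLow j x y - s.lLow j x y * s.mLow i x y =
      s.T x y * (s.bLow x i * s.n x j - s.bLow x j * s.n x i) := by
  have hc := s.c_pos
  obtain ⟨hq, hB, hν, hs⟩ := s.pos_facts hx hy
  have hB' := s.B_expand hx hy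
  have hT : s.T x y = 1 / s.c * √(s.nu x y / s.q x y) * (s.K x y ^ 2 / s.B x y) := rfl
  rw [hT]
  simp only [s.lLow_eq hx hy, s.mLow_eq hx hy, bLow]
  field_simp
  rw [hB']
  ring

/-- For a positively oriented frame, `m_k` is `l^k` rotated by the area form of `g_{ij}`. -/
theorem mLow_eq_sqrt_det (ho : 0 < s.bt x 0 * s.n x 1 - s.bt x 1 * s.n x 0) :
    s.mLow 0 x y = -√(s.gMat x y).det * s.lUp 1 x y ∧
      s.mLow 1 x y = √(s.gMat x y).det * s.lUp 0 x y := by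
  have hc := s.c_pos
  have hK := s.K_pos hx hy
  obtain ⟨hq, hB, hν, hs⟩ := s.pos_facts hx hy
  have hT : 0 < s.T x y := by
    have : s.T x y = 1 / s.c * √(s.nu x y / s.q x y) * (s.K x y ^ 2 / s.B x y) := rfl
    rw [this]; positivity
  have h1 := s.low_wedge hx hy 0 1
  have hpos : 0 < s.lLow 0 x y * s.mLow 1 x y - s.lLow 1 x y * s.mLow 0 x y := by
    rw [h1]
    refine mul_pos hT ?_
    simp only [bLow]
    nlinarith
  rw [s.gMat_det hx hy, Real.sqrt_sq hpos.le]
  have h2 := s.sum_lLow_lUp hx hy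
  have h3 := s.sum_mLow_lUp hx hy
  rw [Fin.sum_univ_two] at h2 h3
  constructor
  · linear_combination -s.mLow 0 x y * h2 + s.lLow 0 x y * h3
  · linear_combination -s.mLow 1 x y * h2 + s.lLow 1 x y * h3

theorem lLow_hasDirDeriv (i j : Fin 2) :
    HasDirDeriv (s.lLow i x) y (Pi.single j 1) (s.mLow i x y * s.mLow j x y / s.K x y) :=
  s.lLowFam_hasDirDeriv (s.g_mem x hx) hx hy i j

theorem K_hasDirDeriv (j : Fin 2) : HasDirDeriv (s.K x) y (Pi.single j 1) (s.lLow j x y) :=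
  s.KFam_hasDirDeriv (s.g_mem x hx) hx hy j

theorem mLow_hasDirDeriv (i j : Fin 2) :
    HasDirDeriv (s.mLow i x) y (Pi.single j 1)
      ((-s.lLow i x y * s.mLow j x y + s.I x y * s.mLow i x y * s.mLow j x y) / s.K x y) := by
  rw [I_eq]
  exact s.mLowFam_hasDirDeriv (s.g_mem x hx) hx hy i j

/-- The Cartan tensor has one independent component. -/
theorem gMat_hasDirDeriv (i j k : Fin 2) :
    HasDirDeriv (fun y' => s.gMat x y' i j) y (Pi.single k 1)
      (2 * s.I x y * s.mLow i x y * s.mLow j x y * s.mLow k x y / s.K x y) := by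
  have hK := s.K_pos hx hy
  refine ((((s.lLow_hasDirDeriv hx hy i k).mul (s.lLow_hasDirDeriv hx hy j k)).add
    ((s.mLow_hasDirDeriv hx hy i k).mul (s.mLow_hasDirDeriv hx hy j k))).congr_val ?_).congr_fun ?_
  · field_simp; ring
  · filter_upwards [isOpen_ne.mem_nhds hy] with y' hy' using s.gMat_eq hx hy' i j

theorem A_eq (i j k : Fin 2) :
    s.A i j k x y = s.I x y * s.mLow i x y * s.mLow j x y * s.mLow k x y := by
  have hK := s.K_pos hx hy
  rw [A, (s.gMat_hasDirDeriv hx hy i j k).pd]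
  field_simp

theorem lUp_hasDirDeriv (k j : Fin 2) :
    HasDirDeriv (s.lUp k x) y (Pi.single j 1) (s.mUp k x y * s.mLow j x y / s.K x y) := by
  have hK := s.K_pos hx hy
  refine ((hasDirDeriv_coord j k y).div (s.K_hasDirDeriv hx hy j) hK.ne').congr_val ?_
  rw [← s.finsler_complete hx hy k j, lUp]
  field_simp
  ring

end FinslerFrame

/-! ### Smoothness of the Finsler objects -/

theorem smoothOn_K : SmoothOn s.K s.slitBundle :=
  s.smoothOn_atCharge s.slitBundle_fst s.famSmoothOn_KFam

theorem smoothOn_T : SmoothOn s.T s.slitBundle :=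
  s.smoothOn_atCharge s.slitBundle_fst s.famSmoothOn_TFam

theorem smoothOn_I : SmoothOn s.I s.slitBundle :=
  (s.smoothOn_atCharge s.slitBundle_fst s.famSmoothOn_IFam).congr fun z _ => s.I_eq z.1 z.2

theorem smoothOn_lLow (k : Fin 2) : SmoothOn (s.lLow k) s.slitBundle :=
  s.smoothOn_atCharge s.slitBundle_fst (s.famSmoothOn_lLowFam k)

theorem smoothOn_mLow (k : Fin 2) : SmoothOn (s.mLow k) s.slitBundle :=
  s.smoothOn_atCharge s.slitBundle_fst (s.famSmoothOn_mLowFam k)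

theorem smoothOn_lUp (k : Fin 2) : SmoothOn (s.lUp k) s.slitBundle :=
  (smoothOn_coord k).div s.smoothOn_K fun _ hz => (s.K_pos hz.1 hz.2).ne'

theorem smoothOn_gMat (i j : Fin 2) : SmoothOn (fun x y => s.gMat x y i j) s.slitBundle :=
  (s.smoothOn_K.mul (s.smoothOn_K.pd_snd s.isOpen_slitBundle i)).pd_snd s.isOpen_slitBundle j

theorem smoothOn_gMat_inv (i j : Fin 2) :
    SmoothOn (fun x y => (s.gMat x y)⁻¹ i j) s.slitBundle :=
  contDiffOn_inv_entry (A := fun z : Pt × Pt => s.gMat z.1 z.2) s.smoothOn_gMat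
    (fun _ hz => (s.gMat_posDef hz.1 hz.2).det_pos.ne') i j

theorem smoothOn_mUp (k : Fin 2) : SmoothOn (s.mUp k) s.slitBundle :=
  SmoothOn.sum _ fun n _ => (s.smoothOn_gMat_inv k n).mul (s.smoothOn_mLow n)

theorem smoothOn_A (i j k : Fin 2) : SmoothOn (s.A i j k) s.slitBundle :=
  s.smoothOn_K.mul ((smoothOn_const _).mul
    ((s.smoothOn_gMat i j).pd_snd s.isOpen_slitBundle k))

/-- Differentiation of the duality relations `l_k m^k = 0`, `m_k m^k = 1`. -/
theorem mUp_hasDirDeriv (hx : x ∈ s.Ω) (hy : y ≠ 0) (k j : Fin 2) :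
    HasDirDeriv (s.mUp k x) y (Pi.single j 1)
      ((-s.lUp k x y * s.mLow j x y - s.I x y * s.mUp k x y * s.mLow j x y) / s.K x y) := by
  have hz : (x, y) ∈ s.slitBundle := ⟨hx, hy⟩
  have hK := s.K_pos hx hy
  have hd := fun i => hasDirDeriv_pd (n := j)
    ((s.smoothOn_mUp i).differentiableAt_snd s.isOpen_slitBundle hz)
  have hl : ∑ i, (s.mLow i x y * s.mLow j x y / s.K x y * s.mUp i x y
      + s.lLow i x y * pd (s.mUp i x) j y) = 0 :=
    (HasDirDeriv.sum Finset.univ fun i _ => (s.lLow_hasDirDeriv hx hy i j).mul (hd i)).unique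
      ((hasDirDeriv_const 0).congr_fun (by
        filter_upwards [isOpen_ne.mem_nhds hy] with y' hy' using s.sum_lLow_mUp hx hy'))
  have hm : ∑ i, ((-s.lLow i x y * s.mLow j x y + s.I x y * s.mLow i x y * s.mLow j x y) /
      s.K x y * s.mUp i x y + s.mLow i x y * pd (s.mUp i x) j y) = 0 :=
    (HasDirDeriv.sum Finset.univ fun i _ => (s.mLow_hasDirDeriv hx hy i j).mul (hd i)).unique
      ((hasDirDeriv_const 1).congr_fun (by
        filter_upwards [isOpen_ne.mem_nhds hy] with y' hy' using s.sum_mLow_mUp hx hy'))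
  refine (hd k).congr_val ?_
  have h1 := s.sum_lLow_mUp hx hy
  have h2 := s.sum_mLow_mUp hx hy
  rw [Fin.sum_univ_two] at hl hm h1 h2
  have h3 : pd (s.mUp k x) j y = pd (s.mUp 0 x) j y * (if k = 0 then 1 else 0)
      + pd (s.mUp 1 x) j y * if k = 1 then 1 else 0 := by fin_cases k <;> simp
  rw [h3, ← s.finsler_complete hx hy k 0, ← s.finsler_complete hx hy k 1, eq_div_iff hK.ne']
  field_simp at hl hm
  linear_combination s.lUp k x y * hl + s.mUp k x y * hm
    + (s.mUp k x y * s.mLow j x y) * h1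
    - (s.lUp k x y * s.mLow j x y + s.mUp k x y * s.I x y * s.mLow j x y) * h2

/-! ### Derivatives in `x` -/

section HorizontalDerivatives

variable (hx : x ∈ s.Ω)

include hx

theorem K_hasDirDeriv_fst (hy : y ≠ 0) (n : Fin 2) :
    HasDirDeriv (fun x' => s.K x' y) x (Pi.single n 1)
      (s.dStar s.KFam n x y + s.K x y / s.B x y * s.g x * s.nForm x y * s.q x y * s.p n x
          + ∑ k, ∑ j, s.christoffel k n j x * y j * s.lLow k x y) := by
  have hc := s.c_pos
  have hγ := s.g_mem x hx
  obtain ⟨hq, hB, hν, hs⟩ := s.pos_facts hx hy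
  have hv : HasDirDeriv (fun x' => s.KFam (s.g x) x' y) x (Pi.single n 1) _ :=
    (hasDirDeriv_KM (U := fun x' => s.btForm x' y) (W := fun x' => s.nForm x' y) s.c_pos
      s.c_lt_one hγ (s.Ssq_pos hx hy) (s.btForm_hasDirDeriv_fst hx y n)
      (s.nForm_hasDirDeriv_fst hx y n)).congr_fun (by
        filter_upwards [s.isOpen_Ω.mem_nhds hx] with x' hx' using s.KFam_eq hx' _ y)
  refine (s.atCharge_hasDirDeriv_fst s.slitBundle_fst s.isOpen_slitBundle s.famSmoothOn_KFam
    (⟨hx, hy⟩ : (x, y) ∈ s.slitBundle) n hv).congr_val ?_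
  rw [← s.KFam_eq hx, ← s.B_eq hx, ← s.q_eq hx]
  change s.dStar s.KFam n x y + s.K x y / s.B x y * _ = _
  simp only [Fin.sum_univ_two, s.lLow_eq hx hy]
  field_simp
  ring

theorem θ_hasDirDeriv_fst (hα : y ∈ s.sector α x) (n : Fin 2) :
    HasDirDeriv (fun x' => s.θ α x' y) x (Pi.single n 1)
      (s.dStarθ α n x y - 1 / s.K x y ^ 2 * s.T x y * s.Ssq x y * s.p n x
          + ∑ k, ∑ j, s.christoffel k n j x * y j * (s.mLow k x y / s.K x y)) := by
  have hc := s.c_pos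
  have hγ := s.g_mem x hx
  have hy := s.sector_ne_zero hα
  have hK := s.K_pos hx hy
  obtain ⟨hq, hB, hν, hs⟩ := s.pos_facts hx hy
  have hv : HasDirDeriv (fun x' => s.θFam α (s.g x) x' y) x (Pi.single n 1) _ :=
    (hasDirDeriv_angle (U := fun x' => s.btForm x' y) (W := fun x' => s.nForm x' y) s.c_pos
      s.c_lt_one hγ α ((s.θFam_eq α (s.g x) x y).2.1 hα) (s.btForm_hasDirDeriv_fst hx y n)
      (s.nForm_hasDirDeriv_fst hx y n)).congr_fun (Filter.Eventually.of_forall fun x' => (s.θFam_eq α _ x' y).1)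
  refine (s.atCharge_hasDirDeriv_fst (s.branchDomain_fst α) (s.isOpen_branchDomain α)
    (s.famSmoothOn_θFam α) (⟨hx, hα⟩ : (x, y) ∈ s.branchDomain α) n hv).congr_val ?_
  have hT : s.T x y = 1 / s.c * √(s.nu x y / s.q x y) * (s.K x y ^ 2 / s.B x y) := rfl
  rw [mCoef, sigM, ← s.KFam_eq hx, ← s.B_eq hx, ← s.q_eq hx, ← s.nu_eq hx, hT, s.Ssq_eq hx]
  change s.dStarθ α n x y + √(s.nu x y / s.q x y) * (s.K x y / s.B x y) * _ / s.K x y = _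
  simp only [Fin.sum_univ_two, s.mLow_eq hx hy]
  field_simp
  ring

end HorizontalDerivatives

end FinsleroidSpace

namespace FinsleroidSpace

variable (s : FinsleroidSpace) {x y : Pt} (C₁ : ℝ) {α : ℝ}

/-! ### The connection coefficients -/

section Connection

variable (hx : x ∈ s.Ω)

include hx

/-- The rotation field of the orthonormal frame, resolved along `l^k` and `m^k`. -/
theorem rotation_eq (hy : y ≠ 0) (k : Fin 2) :
    1 / s.c * (s.btForm x y * s.nUp x k - s.nForm x y * s.btUp x k) =
      s.K x y * (-(s.g x * s.nForm x y * s.q x y / s.B x y) * s.lUp k x y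
        + 1 / s.c * √(s.nu x y / s.q x y) * (s.Ssq x y / s.B x y) * s.mUp k x y) := by
  have hc := s.c_pos
  have hK := s.K_pos hx hy
  obtain ⟨hq, hB, hν, hs⟩ := s.pos_facts hx hy
  rw [s.mUp_eq hx hy, lUp, s.Ssq_eq hx]
  field_simp
  rw [s.B_expand hx hy, s.frame_expansion hx y k]
  ring

/-- The connection coefficients: a rotation, a term along `m^k` proportional to `P*_n`, the term
`-l^k ∂*_n K`, and the Riemannian connection. -/
theorem N_eq (hα : y ∈ s.sector α x) (k n : Fin 2) :
    s.N C₁ α k n x y =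
      1 / s.c * (s.btForm x y * s.nUp x k - s.nForm x y * s.btUp x k) * s.p n x
        - s.lUp k x y * s.dStar s.KFam n x y - s.K x y * s.mUp k x y * s.PStar C₁ α n x y
        - ∑ j, s.christoffel k n j x * y j := by
  have hy := s.sector_ne_zero hα
  have hc := s.c_pos
  have hK := s.K_pos hx hy
  obtain ⟨hq, hB, hν, hs⟩ := s.pos_facts hx hy
  have e : √(s.q x y / s.nu x y) = 1 / √(s.nu x y / s.q x y) := by
    rw [← inv_div, Real.sqrt_inv, one_div]
  rw [N, PStar, U, B₁, b_eq, bUp, e, s.mUp_eq hx hy]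
  field_simp
  ring

theorem N_eq_frame (hα : y ∈ s.sector α x) (k n : Fin 2) :
    s.N C₁ α k n x y =
        -(s.g x * s.nForm x y * s.q x y / s.B x y * s.lUp k x y
            + (C₁ - 1 / s.c * √(s.nu x y / s.q x y) * (s.Ssq x y / s.B x y)) * s.mUp k x y)
            * s.K x y * s.p n x
          - s.lUp k x y * s.dStar s.KFam n x y
          - s.K x y * s.mUp k x y * s.dStarθ α n x y
          - ∑ j, s.christoffel k n j x * y j := by
  rw [s.N_eq C₁ hx hα, s.rotation_eq hx (s.sector_ne_zero hα), PStar]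
  ring

theorem θ_hasDirDeriv (hα : y ∈ s.sector α x) (j : Fin 2) :
    HasDirDeriv (s.θ α x) y (Pi.single j 1) (s.mLow j x y / s.K x y) :=
  s.θFam_hasDirDeriv (s.g_mem x hx) hx hα j

/-- The connection coefficients express that `K` is parallel and that `θ` changes at the rate
`k_n`. -/
theorem N_eq_gradient (hα : y ∈ s.sector α x) (k n : Fin 2) :
    s.N C₁ α k n x y = -s.lUp k x y * pd (fun x' => s.K x' y) n x
      - s.K x y * s.mUp k x y * (pd (fun x' => s.θ α x' y) n x - s.kField C₁ n x) := by
  have hy := s.sector_ne_zero hα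
  have hc := s.c_pos
  have hK := s.K_pos hx hy
  obtain ⟨hq, hB, hν, hs⟩ := s.pos_facts hx hy
  have hT : s.T x y = 1 / s.c * √(s.nu x y / s.q x y) * (s.K x y ^ 2 / s.B x y) := rfl
  have h0 := s.finsler_complete hx hy k 0
  have h1 := s.finsler_complete hx hy k 1
  have e : ∑ j, s.christoffel k n j x * y j =
      (∑ j, s.christoffel 0 n j x * y j) * (if k = 0 then 1 else 0)
        + (∑ j, s.christoffel 1 n j x * y j) * if k = 1 then 1 else 0 := by
    fin_cases k <;> simp
  rw [s.N_eq_frame C₁ hx hα, (s.K_hasDirDeriv_fst hx hy n).pd, (s.θ_hasDirDeriv_fst hx hα n).pd,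
    hT, kField, e, ← h0, ← h1]
  simp only [Fin.sum_univ_two]
  field_simp
  ring

theorem sum_lLow_N (hα : y ∈ s.sector α x) (n : Fin 2) :
    ∑ k, s.N C₁ α k n x y * s.lLow k x y = -pd (fun x' => s.K x' y) n x := by
  have hy := s.sector_ne_zero hα
  have h1 := s.sum_lLow_lUp hx hy
  have h2 := s.sum_lLow_mUp hx hy
  simp only [s.N_eq_gradient C₁ hx hα, Fin.sum_univ_two] at *
  linear_combination -pd (fun x' => s.K x' y) n x * h1
    - s.K x y * (pd (fun x' => s.θ α x' y) n x - s.kField C₁ n x) * h2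

theorem sum_mLow_N (hα : y ∈ s.sector α x) (n : Fin 2) :
    ∑ k, s.N C₁ α k n x y * s.mLow k x y =
      -s.K x y * (pd (fun x' => s.θ α x' y) n x - s.kField C₁ n x) := by
  have hy := s.sector_ne_zero hα
  have h1 := s.sum_mLow_lUp hx hy
  have h2 := s.sum_mLow_mUp hx hy
  simp only [s.N_eq_gradient C₁ hx hα, Fin.sum_univ_two] at *
  linear_combination -pd (fun x' => s.K x' y) n x * h1
    - s.K x y * (pd (fun x' => s.θ α x' y) n x - s.kField C₁ n x) * h2

theorem d_K (hα : y ∈ s.sector α x) (n : Fin 2) : s.d C₁ α n s.K x y = 0 := by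
  have h := s.sum_lLow_N C₁ hx hα n
  have hy := s.sector_ne_zero hα
  rw [d]
  simp only [(s.K_hasDirDeriv hx hy _).pd]
  rw [h]; ring

theorem d_θ (hα : y ∈ s.sector α x) (n : Fin 2) :
    s.d C₁ α n (s.θ α) x y = s.kField C₁ n x := by
  have h := s.sum_mLow_N C₁ hx hα n
  have hK := s.K_pos hx (s.sector_ne_zero hα)
  rw [d]
  simp only [(s.θ_hasDirDeriv hx hα _).pd, ← mul_div_assoc]
  rw [← Finset.sum_div, h]
  field_simp
  ring

/-! ### The operator `∂*` as a derivation -/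

omit hx in
theorem dStar_of_hasDirDeriv {F : ℝ → Pt → Pt → ℝ} {v : ℝ} (n : Fin 2)
    (h : HasDirDeriv (fun γ => F γ x y) (s.g x) 1 v) : s.dStar F n x y = pd s.g n x * v := by
  rw [dStar, h.deriv]

theorem eventually_charge : ∀ᶠ γ in nhds (s.g x), γ ∈ Set.Ioo (-2 : ℝ) 2 :=
  isOpen_Ioo.mem_nhds (s.g_mem x hx)

section Slit

variable (hy : y ≠ 0)

include hy

theorem charge_hasDirDeriv {F : ℝ → Pt → Pt → ℝ} (hF : FamSmoothOn F s.slitBundle) :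
    HasDirDeriv (fun γ => F γ x y) (s.g x) 1 (deriv (fun γ => F γ x y) (s.g x)) :=
  ⟨hF.differentiableAt_charge s.isOpen_slitBundle (s.g_mem x hx)
    (⟨hx, hy⟩ : (x, y) ∈ s.slitBundle), rfl⟩

theorem dStar_pd_lLowFam (n i j : Fin 2) :
    s.dStar (fun γ x y => pd (s.lLowFam i γ x) j y) n x y =
      (s.dStar (s.mLowFam i) n x y * s.mLow j x y + s.mLow i x y * s.dStar (s.mLowFam j) n x y)
        / s.K x y - s.mLow i x y * s.mLow j x y * s.dStar s.KFam n x y / s.K x y ^ 2 := by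
  have hK : s.KFam (s.g x) x y ≠ 0 := (s.K_pos hx hy).ne'
  have h := (((s.charge_hasDirDeriv hx hy (s.famSmoothOn_mLowFam i)).mul
    (s.charge_hasDirDeriv hx hy (s.famSmoothOn_mLowFam j))).div
      (s.charge_hasDirDeriv hx hy s.famSmoothOn_KFam) hK).congr_fun
        (f₂ := fun γ => pd (s.lLowFam i γ x) j y) (by
          filter_upwards [s.eventually_charge hx] with γ hγ
          exact (s.lLowFam_hasDirDeriv hγ hx hy i j).pd)
  rw [s.dStar_of_hasDirDeriv n h]
  simp only [dStar, mLow, K, atCharge]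
  field_simp

theorem dStar_pd_mLowFam (n i j : Fin 2) :
    s.dStar (fun γ x y => pd (s.mLowFam i γ x) j y) n x y =
      (-(s.dStar (s.lLowFam i) n x y * s.mLow j x y + s.lLow i x y * s.dStar (s.mLowFam j) n x y)
        + s.dStar s.IFam n x y * s.mLow i x y * s.mLow j x y
        + s.I x y * (s.dStar (s.mLowFam i) n x y * s.mLow j x y
          + s.mLow i x y * s.dStar (s.mLowFam j) n x y)) / s.K x y
      - (-s.lLow i x y * s.mLow j x y + s.I x y * s.mLow i x y * s.mLow j x y) *
        s.dStar s.KFam n x y / s.K x y ^ 2 := by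
  have hK : s.KFam (s.g x) x y ≠ 0 := (s.K_pos hx hy).ne'
  have h := ((((s.charge_hasDirDeriv hx hy (s.famSmoothOn_lLowFam i)).neg.mul
    (s.charge_hasDirDeriv hx hy (s.famSmoothOn_mLowFam j))).add
      (((s.charge_hasDirDeriv hx hy s.famSmoothOn_IFam).mul
        (s.charge_hasDirDeriv hx hy (s.famSmoothOn_mLowFam i))).mul
          (s.charge_hasDirDeriv hx hy (s.famSmoothOn_mLowFam j)))).div
      (s.charge_hasDirDeriv hx hy s.famSmoothOn_KFam) hK).congr_fun
        (f₂ := fun γ => pd (s.mLowFam i γ x) j y) (by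
          filter_upwards [s.eventually_charge hx] with γ hγ
          exact (s.mLowFam_hasDirDeriv hγ hx hy i j).pd)
  rw [s.dStar_of_hasDirDeriv n h, I_eq]
  simp only [dStar, mLow, lLow, K, atCharge]
  field_simp
  ring

end Slit

theorem dStar_pd_θFam (hα : y ∈ s.sector α x) (n j : Fin 2) :
    s.dStar (fun γ x y => pd (s.θFam α γ x) j y) n x y =
      s.dStar (s.mLowFam j) n x y / s.K x y
        - s.mLow j x y * s.dStar s.KFam n x y / s.K x y ^ 2 := by
  have hy := s.sector_ne_zero hα
  have hK : s.KFam (s.g x) x y ≠ 0 := (s.K_pos hx hy).ne'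
  have h := ((s.charge_hasDirDeriv hx hy (s.famSmoothOn_mLowFam j)).div
      (s.charge_hasDirDeriv hx hy s.famSmoothOn_KFam) hK).congr_fun
        (f₂ := fun γ => pd (s.θFam α γ x) j y) (by
          filter_upwards [s.eventually_charge hx] with γ hγ
          exact (s.θFam_hasDirDeriv hγ hx hα j).pd)
  rw [s.dStar_of_hasDirDeriv n h]
  simp only [dStar, mLow, K, atCharge]
  field_simp

theorem dStar_IFam (hy : y ≠ 0) (n : Fin 2) :
    s.dStar s.IFam n x y = -(s.c / 2) * (s.nForm x y * s.dStar s.xFam n x y) := by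
  have h : HasDirDeriv (fun γ => s.IFam γ x y) (s.g x) 1 _ :=
    ((s.charge_hasDirDeriv hx hy s.famSmoothOn_xFam).const_mul (s.nForm x y)).const_mul (-(s.c / 2))
  rw [s.dStar_of_hasDirDeriv n h, dStar]
  ring

theorem eventually_sector (hα : y ∈ s.sector α x) : ∀ᶠ y' in nhds y, y' ∈ s.sector α x := by
  filter_upwards [eventually_snd (s.isOpen_branchDomain α)
    (⟨hx, hα⟩ : (x, y) ∈ s.branchDomain α)] with y' hy' using hy'.2

theorem dStarθ_hasDirDeriv (hα : y ∈ s.sector α x) (n j : Fin 2) :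
    HasDirDeriv (s.dStarθ α n x) y (Pi.single j 1) (s.dStar (s.mLowFam j) n x y / s.K x y
        - s.mLow j x y * s.dStar s.KFam n x y / s.K x y ^ 2) :=
  (s.dStar_hasDirDeriv (s.branchDomain_fst α) (s.isOpen_branchDomain α) (s.famSmoothOn_θFam α)
    (⟨hx, hα⟩ : (x, y) ∈ s.branchDomain α) n j).congr_val (s.dStar_pd_θFam hx hα n j)

theorem PStar_hasDirDeriv (hα : y ∈ s.sector α x) (n j : Fin 2) :
    HasDirDeriv (s.PStar C₁ α n x) y (Pi.single j 1) (s.dStar (s.mLowFam j) n x y / s.K x y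
        - s.mLow j x y * s.dStar s.KFam n x y / s.K x y ^ 2) :=
  ((s.dStarθ_hasDirDeriv hx hα n j).add (hasDirDeriv_const _)).congr_val (add_zero _)

theorem N_hasDirDeriv (hα : y ∈ s.sector α x) (k n m : Fin 2) :
    HasDirDeriv (s.N C₁ α k n x) y (Pi.single m 1)
      ((-s.lLow m x y * s.mUp k x y + s.lUp k x y * s.mLow m x y
            + s.I x y * s.mUp k x y * s.mLow m x y) * s.PStar C₁ α n x y
          - s.lUp k x y * s.dStar (s.lLowFam m) n x y
          - s.mUp k x y * s.dStar (s.mLowFam m) n x y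
          + 1 / s.c ^ 2 * (s.bLow x m * s.nUp x k - s.n x m * s.bUp x k) * s.p n x
          - s.christoffel k n m x) := by
  have hy := s.sector_ne_zero hα
  have hc := s.c_pos
  have hK := s.K_pos hx hy
  have h1 := ((((s.btForm_hasDirDeriv_snd x y m).mul_const (s.nUp x k)).sub
    ((s.nForm_hasDirDeriv_snd x y m).mul_const (s.btUp x k))).const_mul (1 / s.c)).mul_const
      (s.p n x)
  have h2 := (s.lUp_hasDirDeriv hx hy k m).mul (s.dStar_hasDirDeriv s.slitBundle_fst
    s.isOpen_slitBundle s.famSmoothOn_KFam (⟨hx, hy⟩ : (x, y) ∈ s.slitBundle) n m)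
  have h3 := ((s.K_hasDirDeriv hx hy m).mul (s.mUp_hasDirDeriv hx hy k m)).mul
    (s.PStar_hasDirDeriv C₁ hx hα n m)
  have h4 : HasDirDeriv (fun y => ∑ j, s.christoffel k n j x * y j) y (Pi.single m 1)
      (s.christoffel k n m x) :=
    (HasDirDeriv.sum Finset.univ fun j _ =>
      (hasDirDeriv_coord m j y).const_mul (s.christoffel k n j x)).congr_val (by simp)
  refine ((((h1.sub h2).sub h3).sub h4).congr_val ?_).congr_fun ?_
  · rw [show (fun γ x y => pd (s.KFam γ x) m y) = s.lLowFam m from rfl, bLow, bUp]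
    field_simp
    ring
  · filter_upwards [s.eventually_sector hx hα] with y' hy' using s.N_eq C₁ hx hy' k n

/-- `Z_n` is the derivative of `I` along the angle times `P*_n`, minus `∂*_n I`. -/
theorem Zn_eq (hy : y ≠ 0) (n : Fin 2) :
    s.Zn C₁ α n x y = IThM s.c (s.g x) (s.btForm x y) (s.nForm x y) * s.PStar C₁ α n x y
      - s.dStar s.IFam n x y := by
  rw [s.dStar_IFam hx hy, Zn, IThM, ← s.B_eq hx, ← s.q_eq hx, ← s.nu_eq hx, b_eq]
  ring

theorem N1_eq (hα : y ∈ s.sector α x) (k n m : Fin 2) :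
    s.N1 C₁ α k n m x y =
      (-s.lLow m x y * s.mUp k x y + s.lUp k x y * s.mLow m x y
            + s.I x y * s.mUp k x y * s.mLow m x y) * s.PStar C₁ α n x y
          - s.lUp k x y * s.dStar (s.lLowFam m) n x y
          - s.mUp k x y * s.dStar (s.mLowFam m) n x y
          + 1 / s.c ^ 2 * (s.bLow x m * s.nUp x k - s.n x m * s.bUp x k) * s.p n x
          - s.christoffel k n m x := (s.N_hasDirDeriv C₁ hx hα k n m).pd

/-- In the second derivative of the connection coefficients all terms cancel except those along
`m^k m_m m_i`. -/
theorem N1_hasDirDeriv (hα : y ∈ s.sector α x) (k n m i : Fin 2) :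
    HasDirDeriv (s.N1 C₁ α k n m x) y (Pi.single i 1)
      (1 / s.K x y * s.Zn C₁ α n x y * s.mUp k x y * s.mLow m x y * s.mLow i x y) := by
  have hy := s.sector_ne_zero hα
  have hz : (x, y) ∈ s.slitBundle := ⟨hx, hy⟩
  have hK := s.K_pos hx hy
  have hI : HasDirDeriv (s.I x) y (Pi.single i 1)
      (IThM s.c (s.g x) (s.btForm x y) (s.nForm x y) * s.mLow i x y / s.K x y) :=
    (s.IFam_hasDirDeriv (s.g_mem x hx) hx hy i).congr_fun
      (Filter.Eventually.of_forall fun y' => s.I_eq x y')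
  have hl := s.lLow_hasDirDeriv hx hy m i
  have hm := s.mLow_hasDirDeriv hx hy m i
  have hL := s.lUp_hasDirDeriv hx hy k i
  have hM := s.mUp_hasDirDeriv hx hy k i
  have h1 := ((((hl.neg).mul hM).add (hL.mul hm)).add ((hI.mul hM).mul hm)).mul
    (s.PStar_hasDirDeriv C₁ hx hα n i)
  have h2 := hL.mul ((s.dStar_hasDirDeriv s.slitBundle_fst s.isOpen_slitBundle
    (s.famSmoothOn_lLowFam m) hz n i).congr_val (s.dStar_pd_lLowFam hx hy n m i))
  have h3 := hM.mul ((s.dStar_hasDirDeriv s.slitBundle_fst s.isOpen_slitBundle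
    (s.famSmoothOn_mLowFam m) hz n i).congr_val (s.dStar_pd_mLowFam hx hy n m i))
  refine (((((h1.sub h2).sub h3).add (hasDirDeriv_const (1 / s.c ^ 2 * (s.bLow x m * s.nUp x k
    - s.n x m * s.bUp x k) * s.p n x))).sub (hasDirDeriv_const
      (s.christoffel k n m x))).congr_val ?_).congr_fun ?_
  · rw [s.Zn_eq C₁ hx hy]
    field_simp
    ring
  · filter_upwards [s.eventually_sector hx hα] with y' hy' using s.N1_eq C₁ hx hy' k n m

theorem N2_eq (hα : y ∈ s.sector α x) (k n m i : Fin 2) :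
    s.N2 C₁ α k n m i x y =
      1 / s.K x y * s.Zn C₁ α n x y * s.mUp k x y * s.mLow m x y * s.mLow i x y :=
  (s.N1_hasDirDeriv C₁ hx hα k n m i).pd

theorem sum_yLow_N2 (hα : y ∈ s.sector α x) (n m i : Fin 2) :
    ∑ k, s.yLow k x y * s.N2 C₁ α k n m i x y = 0 := by
  have hy := s.sector_ne_zero hα
  have h := s.sum_lLow_mUp hx hy
  have e : ∀ k, s.yLow k x y = s.K x y * s.lLow k x y := fun _ => rfl
  simp only [s.N2_eq C₁ hx hα, e, Fin.sum_univ_two] at *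
  linear_combination s.K x y * (1 / s.K x y * s.Zn C₁ α n x y * s.mLow m x y * s.mLow i x y) * h

end Connection

/-! ### Smoothness of the connection and of the curvature -/

section Smoothness

variable (α)

theorem smoothOn_q : SmoothOn s.q s.slitBundle := by
  have h1 := s.smoothOn_btForm s.slitBundle_fst
  have h2 := s.smoothOn_nForm s.slitBundle_fst
  refine ((((h1.pow 2).add (h2.pow 2)).sub (((smoothOn_const s.c).mul h1).pow 2)).sqrt
    fun z hz => ?_).congr fun z hz => s.q_eq hz.1 z.2
  exact (qM_arg_pos s.c_pos s.c_lt_one (s.Ssq_pos hz.1 hz.2)).ne'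

theorem smoothOn_b : SmoothOn s.b s.slitBundle :=
  ((smoothOn_const s.c).mul (s.smoothOn_btForm s.slitBundle_fst)).congr
    fun z _ => s.b_eq z.1 z.2

theorem smoothOn_g : SmoothOn (fun x _ => s.g x) s.slitBundle :=
  smoothOn_of_fst s.g_smooth s.slitBundle_fst

theorem smoothOn_B : SmoothOn s.B s.slitBundle :=
  ((s.smoothOn_b.pow 2).add ((s.smoothOn_g.mul s.smoothOn_b).mul s.smoothOn_q)).add
    (s.smoothOn_q.pow 2)

theorem smoothOn_nu : SmoothOn s.nu s.slitBundle :=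
  s.smoothOn_q.add (((smoothOn_const _).mul s.smoothOn_g).mul s.smoothOn_b)

theorem smoothOn_U : SmoothOn (s.U C₁) s.slitBundle :=
  (smoothOn_const _).mul ((s.smoothOn_q.div s.smoothOn_nu fun _ hz =>
    (s.pos_facts hz.1 hz.2).2.2.1.ne').sqrt fun _ hz =>
      (div_pos (s.pos_facts hz.1 hz.2).1 (s.pos_facts hz.1 hz.2).2.2.1).ne')

theorem smoothOn_θ : SmoothOn (s.θ α) (s.branchDomain α) :=
  s.smoothOn_atCharge (s.branchDomain_fst α) (s.famSmoothOn_θFam α)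

theorem smoothOn_dStarθ (n : Fin 2) : SmoothOn (s.dStarθ α n) (s.branchDomain α) :=
  s.smoothOn_dStar (s.branchDomain_fst α) (s.isOpen_branchDomain α) (s.famSmoothOn_θFam α) n

theorem smoothOn_p (n : Fin 2) : SmoothOn (fun x _ => s.p n x) (s.branchDomain α) :=
  smoothOn_of_fst (s.contDiffOn_p n) (s.branchDomain_fst α)

theorem smoothOn_Zn (n : Fin 2) : SmoothOn (s.Zn C₁ α n) (s.branchDomain α) := by
  have hq := s.smoothOn_q.mono (s.branchDomain_subset α)
  have hν := s.smoothOn_nu.mono (s.branchDomain_subset α)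
  have hb := s.smoothOn_b.mono (s.branchDomain_subset α)
  have hB := s.smoothOn_B.mono (s.branchDomain_subset α)
  have hg := s.smoothOn_g.mono (s.branchDomain_subset α)
  have hn := s.smoothOn_nForm (s.branchDomain_fst α)
  have hX := (s.smoothOn_dStar s.slitBundle_fst s.isOpen_slitBundle s.famSmoothOn_xFam n).mono
    (s.branchDomain_subset α)
  refine SmoothOn.add (SmoothOn.mul (SmoothOn.mul (SmoothOn.mul (SmoothOn.mul (SmoothOn.mul
    (SmoothOn.mul (smoothOn_const _) hg) (smoothOn_const _)) (hB.pow 2))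
    ((smoothOn_const 1).div ((hq.pow 3).mul (hν.pow 3)) fun z hz => ?_))
    (SmoothOn.add (((smoothOn_const 2).mul hb).mul hν) ((hg.mul (smoothOn_const _)).mul
      (hn.pow 2)))) ((s.smoothOn_dStarθ α n).add ((smoothOn_const C₁).mul (s.smoothOn_p α n))))
    ((((smoothOn_const _).mul hn).mul (smoothOn_const _)).mul hX)
  have h := s.pos_facts hz.1 (s.sector_ne_zero hz.2)
  exact (mul_pos (pow_pos h.1 3) (pow_pos h.2.2.1 3)).ne'

theorem smoothOn_N (k n : Fin 2) : SmoothOn (s.N C₁ α k n) (s.branchDomain α) := by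
  have hsub := s.branchDomain_subset α
  have hfst := s.branchDomain_fst α
  have hb := s.smoothOn_b.mono hsub
  have hn := s.smoothOn_nForm hfst
  have hU := (s.smoothOn_U C₁).mono hsub
  have hB₁ : SmoothOn s.B₁ (s.branchDomain α) := (smoothOn_const _).mul
    (hb.add (((s.smoothOn_g.mono hsub).mul (smoothOn_const _)).mul (s.smoothOn_q.mono hsub)))
  have hK := s.smoothOn_K.mono hsub
  have hdK := (s.smoothOn_dStar s.slitBundle_fst s.isOpen_slitBundle s.famSmoothOn_KFam n).mono hsub
  exact SmoothOn.sub (SmoothOn.sub (SmoothOn.sub (SmoothOn.mul (SmoothOn.add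
    ((((smoothOn_const _).mul hb).sub ((hU.mul (smoothOn_const _)).mul hB₁)).mul
      (smoothOn_of_fst (s.contDiffOn_nUp k) hfst))
    ((hn.mul (hU.sub (smoothOn_const _))).mul ((smoothOn_const s.c).mul
      (smoothOn_of_fst (s.contDiffOn_btUp k) hfst)))) (s.smoothOn_p α n))
    (((s.smoothOn_lUp k).mono hsub).mul hdK))
    ((hK.mul ((s.smoothOn_mUp k).mono hsub)).mul (s.smoothOn_dStarθ α n)))
    (SmoothOn.sum _ fun j _ => (smoothOn_of_fst (s.contDiffOn_christoffel k n j) hfst).mul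
      (smoothOn_coord j))

theorem smoothOn_d {F : Pt → Pt → ℝ} (hF : SmoothOn F (s.branchDomain α)) (n : Fin 2) :
    SmoothOn (s.d C₁ α n F) (s.branchDomain α) :=
  (hF.pd_fst (s.isOpen_branchDomain α) n).add (SmoothOn.sum _ fun k _ =>
    (s.smoothOn_N C₁ α k n).mul (hF.pd_snd (s.isOpen_branchDomain α) k))

theorem smoothOn_N1 (k n m : Fin 2) : SmoothOn (s.N1 C₁ α k n m) (s.branchDomain α) :=
  (s.smoothOn_N C₁ α k n).pd_snd (s.isOpen_branchDomain α) m

theorem smoothOn_N2 (k n m i : Fin 2) : SmoothOn (s.N2 C₁ α k n m i) (s.branchDomain α) :=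
  (s.smoothOn_N1 C₁ α k n m).pd_snd (s.isOpen_branchDomain α) i

theorem smoothOn_MUp (n i j : Fin 2) : SmoothOn (s.MUp C₁ α n i j) (s.branchDomain α) :=
  (s.smoothOn_d C₁ α (s.smoothOn_N C₁ α n j) i).sub (s.smoothOn_d C₁ α (s.smoothOn_N C₁ α n i) j)

theorem smoothOn_E (k n i j : Fin 2) : SmoothOn (s.E C₁ α k n i j) (s.branchDomain α) := by
  have hD : ∀ k i n, SmoothOn (s.D C₁ α k i n) (s.branchDomain α) := fun k i n =>
    (s.smoothOn_N1 C₁ α k i n).neg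
  exact (((s.smoothOn_d C₁ α (hD n j k) i).sub (s.smoothOn_d C₁ α (hD n i k) j)).add
    (SmoothOn.sum _ fun m _ => (hD m j k).mul (hD n i m))).sub
    (SmoothOn.sum _ fun m _ => (hD m i k).mul (hD n j m))

theorem smoothOn_rho (k n i j : Fin 2) : SmoothOn (s.rho C₁ α k n i j) (s.branchDomain α) := by
  have hsub := s.branchDomain_subset α
  refine (s.smoothOn_E C₁ α k n i j).sub (SmoothOn.sum _ fun h _ =>
    (s.smoothOn_MUp C₁ α h i j).mul (SmoothOn.sum _ fun l _ => ?_))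
  exact ((s.smoothOn_gMat_inv n l).mono hsub).mul ((smoothOn_const _).mul
    (((s.smoothOn_gMat l h).pd_snd s.isOpen_slitBundle k).mono hsub))

theorem smoothOn_rhoLow (k n i j : Fin 2) :
    SmoothOn (s.rhoLow C₁ α k n i j) (s.branchDomain α) :=
  SmoothOn.sum _ fun m _ => ((s.smoothOn_gMat n m).mono (s.branchDomain_subset α)).mul
    (s.smoothOn_rho C₁ α k m i j)

end Smoothness

end FinsleroidSpace

namespace FinsleroidSpace

variable (s : FinsleroidSpace) {x y : Pt} (C₁ : ℝ) {α : ℝ}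

/-! ### The curvature -/

section Curvature

variable {F : Pt → Pt → ℝ}

theorem d_congr {F' : Pt → Pt → ℝ} (h : ∀ z ∈ s.branchDomain α, F z.1 z.2 = F' z.1 z.2)
    (hz : (x, y) ∈ s.branchDomain α) (i : Fin 2) : s.d C₁ α i F x y = s.d C₁ α i F' x y := by
  rw [d, d, pd_fst_congr (s.isOpen_branchDomain α) hz h]
  simp only [pd_snd_congr (s.isOpen_branchDomain α) hz h]

theorem d_hasDirDeriv_fst (hF : SmoothOn F (s.branchDomain α)) (hz : (x, y) ∈ s.branchDomain α)
    (i j : Fin 2) :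
    HasDirDeriv (fun x' => s.d C₁ α j F x' y) x (Pi.single i 1)
      (pd (fun x' => pd (fun x'' => F x'' y) j x') i x
        + ∑ k, (pd (fun x' => s.N C₁ α k j x' y) i x * pd (F x) k y
          + s.N C₁ α k j x y * pd (fun x' => pd (F x') k y) i x)) := by
  have ho := s.isOpen_branchDomain α
  exact (hasDirDeriv_pd ((hF.pd_fst ho j).differentiableAt_fst ho hz)).add
    (HasDirDeriv.sum Finset.univ fun k _ =>
      (hasDirDeriv_pd ((s.smoothOn_N C₁ α k j).differentiableAt_fst ho hz)).mul
        (hasDirDeriv_pd ((hF.pd_snd ho k).differentiableAt_fst ho hz)))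

theorem d_hasDirDeriv_snd (hF : SmoothOn F (s.branchDomain α)) (hz : (x, y) ∈ s.branchDomain α)
    (m j : Fin 2) :
    HasDirDeriv (s.d C₁ α j F x) y (Pi.single m 1)
      (pd (fun y' => pd (fun x' => F x' y') j x) m y
        + ∑ k, (s.N1 C₁ α k j m x y * pd (F x) k y
          + s.N C₁ α k j x y * pd (fun y' => pd (F x) k y') m y)) := by
  have ho := s.isOpen_branchDomain α
  exact (hasDirDeriv_pd ((hF.pd_fst ho j).differentiableAt_snd ho hz)).add
    (HasDirDeriv.sum Finset.univ fun k _ =>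
      (hasDirDeriv_pd ((s.smoothOn_N C₁ α k j).differentiableAt_snd ho hz)).mul
        (hasDirDeriv_pd ((hF.pd_snd ho k).differentiableAt_snd ho hz)))

/-- The commutator of the operators `d_i`, `d_j` is the vertical vector field `M^k_{ij}`. -/
theorem d_commutator (hF : SmoothOn F (s.branchDomain α)) (hz : (x, y) ∈ s.branchDomain α)
    (i j : Fin 2) :
    s.d C₁ α i (s.d C₁ α j F) x y - s.d C₁ α j (s.d C₁ α i F) x y =
      ∑ k, s.MUp C₁ α k i j x y * pd (F x) k y := by
  have ho := s.isOpen_branchDomain α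
  have e1 := hF.pd_fst_fst ho hz i j
  have e2 := hF.pd_fst_snd ho hz
  have e3 := hF.pd_snd_snd ho hz 0 1
  rw [d, d, (s.d_hasDirDeriv_fst C₁ hF hz i j).pd, (s.d_hasDirDeriv_fst C₁ hF hz j i).pd]
  simp only [(s.d_hasDirDeriv_snd C₁ hF hz _ _).pd, MUp, Fin.sum_univ_two, e1, e2, e3]
  rw [d, d, d, d]
  simp only [Fin.sum_univ_two, N1]
  ring

/-- The commutator of `d_i` and `∂/∂y^k`. -/
theorem d_pd_snd (hF : SmoothOn F (s.branchDomain α)) (hz : (x, y) ∈ s.branchDomain α)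
    (k i : Fin 2) :
    HasDirDeriv (s.d C₁ α i F x) y (Pi.single k 1)
      (s.d C₁ α i (fun x y => pd (F x) k y) x y
        + ∑ m, s.N1 C₁ α m i k x y * pd (F x) m y) := by
  have ho := s.isOpen_branchDomain α
  refine (s.d_hasDirDeriv_snd C₁ hF hz k i).congr_val ?_
  have e3 := hF.pd_snd_snd ho hz k
  rw [d, hF.pd_fst_snd ho hz]
  simp only [Fin.sum_univ_two, e3]
  ring

theorem d_neg (hF : SmoothOn F (s.branchDomain α)) (hz : (x, y) ∈ s.branchDomain α)
    (i : Fin 2) : s.d C₁ α i (fun x y => -F x y) x y = -s.d C₁ α i F x y := by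
  have ho := s.isOpen_branchDomain α
  have h1 := (hasDirDeriv_pd (n := i) (hF.differentiableAt_fst ho hz)).neg.pd
  have h2 := fun k => (hasDirDeriv_pd (n := k) (hF.differentiableAt_snd ho hz)).neg.pd
  rw [d, d, h1]
  simp only [h2, Fin.sum_univ_two]
  ring

/-- The curvature part `E` is minus the vertical derivative of `M^n_{ij}`. -/
theorem E_eq (hz : (x, y) ∈ s.branchDomain α) (k n i j : Fin 2) :
    s.E C₁ α k n i j x y = -pd (s.MUp C₁ α n i j x) k y := by
  have h1 := (s.d_pd_snd C₁ (s.smoothOn_N C₁ α n j) hz k i).sub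
    (s.d_pd_snd C₁ (s.smoothOn_N C₁ α n i) hz k j)
  have h2 : pd (s.MUp C₁ α n i j x) k y = _ := h1.pd
  have h3 : ∀ i j, s.d C₁ α i (s.D C₁ α n j k) x y = -s.d C₁ α i (s.N1 C₁ α n j k) x y :=
    fun i j => s.d_neg C₁ (s.smoothOn_N1 C₁ α n j k) hz i
  rw [h2, E, h3, h3]
  simp only [D, Fin.sum_univ_two]
  change _ = -(s.d C₁ α i (s.N1 C₁ α n j k) x y + (s.N1 C₁ α 0 i k x y * s.N1 C₁ α n j 0 x y
    + s.N1 C₁ α 1 i k x y * s.N1 C₁ α n j 1 x y) - (s.d C₁ α j (s.N1 C₁ α n i k) x y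
    + (s.N1 C₁ α 0 j k x y * s.N1 C₁ α n i 0 x y + s.N1 C₁ α 1 j k x y * s.N1 C₁ α n i 1 x y)))
  ring

variable (hx : x ∈ s.Ω) (hα : y ∈ s.sector α x)

include hx hα

/-- The commutator of `d_i`, `d_j` applied to `K`, which they annihilate. -/
theorem sum_MUp_lLow (i j : Fin 2) : ∑ k, s.MUp C₁ α k i j x y * s.lLow k x y = 0 := by
  have hz : (x, y) ∈ s.branchDomain α := ⟨hx, hα⟩
  have h := s.d_commutator C₁ (s.smoothOn_K.mono (s.branchDomain_subset α)) hz i j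
  have h0 : ∀ i j, s.d C₁ α i (s.d C₁ α j s.K) x y = 0 := fun i j => by
    rw [s.d_congr C₁ (F' := fun _ _ => 0) (fun z hz => s.d_K C₁ hz.1 hz.2 j) hz, d]
    simp [pd]
  rw [h0, h0, sub_zero] at h
  simp only [(s.K_hasDirDeriv hx (s.sector_ne_zero hα) _).pd] at h
  exact h.symm

/-- The commutator of `d_i`, `d_j` applied to `θ`, for which `d_n θ = k_n` depends on `x` alone. -/
theorem sum_MUp_mLow (i j : Fin 2) :
    ∑ k, s.MUp C₁ α k i j x y * s.mLow k x y = s.K x y * s.Mij C₁ i j x := by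
  have hz : (x, y) ∈ s.branchDomain α := ⟨hx, hα⟩
  have hK := s.K_pos hx (s.sector_ne_zero hα)
  have h := s.d_commutator C₁ (s.smoothOn_θ α) hz i j
  have h0 : ∀ i j, s.d C₁ α i (s.d C₁ α j (s.θ α)) x y = pd (s.kField C₁ j) i x := fun i j => by
    rw [s.d_congr C₁ (F' := fun x _ => s.kField C₁ j x) (fun z hz => s.d_θ C₁ hz.1 hz.2 j) hz, d]
    have : ∀ k, pd (fun _ : Pt => s.kField C₁ j x) k y = 0 := fun k => by simp [pd]
    simp [this]
  rw [h0, h0] at h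
  simp only [(s.θ_hasDirDeriv hx hα _).pd, ← mul_div_assoc] at h
  rw [← Finset.sum_div] at h
  rw [Mij, h]
  field_simp

theorem MUp_eq (n i j : Fin 2) :
    s.MUp C₁ α n i j x y = s.K x y * s.mUp n x y * s.Mij C₁ i j x := by
  have hy := s.sector_ne_zero hα
  have h1 := s.sum_MUp_lLow C₁ hx hα i j
  have h2 := s.sum_MUp_mLow C₁ hx hα i j
  rw [Fin.sum_univ_two] at h1 h2
  have h3 : s.MUp C₁ α n i j x y = s.MUp C₁ α 0 i j x y * (if n = 0 then 1 else 0)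
      + s.MUp C₁ α 1 i j x y * if n = 1 then 1 else 0 := by fin_cases n <;> simp
  rw [h3, ← s.finsler_complete hx hy n 0, ← s.finsler_complete hx hy n 1]
  linear_combination s.lUp n x y * h1 + s.mUp n x y * h2

theorem E_eq_frame (k n i j : Fin 2) :
    s.E C₁ α k n i j x y = (s.lUp n x y * s.mLow k x y - s.lLow k x y * s.mUp n x y
      + s.I x y * s.mUp n x y * s.mLow k x y) * s.Mij C₁ i j x := by
  have hy := s.sector_ne_zero hα
  have hK := s.K_pos hx hy
  rw [s.E_eq C₁ ⟨hx, hα⟩]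
  have h : HasDirDeriv (s.MUp C₁ α n i j x) y (Pi.single k 1) _ :=
    (((s.K_hasDirDeriv hx hy k).mul (s.mUp_hasDirDeriv hx hy n k)).mul_const
      (s.Mij C₁ i j x)).congr_fun (by
        filter_upwards [s.eventually_sector hx hα] with y' hy' using s.MUp_eq C₁ hx hy' n i j)
  rw [h.pd]
  field_simp
  ring

omit hα in
theorem cartanUp_eq (hy : y ≠ 0) (n h k : Fin 2) :
    s.cartanUp n h k x y = s.I x y * s.mUp n x y * s.mLow h x y * s.mLow k x y / s.K x y := by
  simp only [cartanUp, (s.gMat_hasDirDeriv hx hy _ _ _).pd, mUp, Fin.sum_univ_two]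
  ring

theorem rho_eq (k n i j : Fin 2) :
    s.rho C₁ α k n i j x y =
      (s.lUp n x y * s.mLow k x y - s.lLow k x y * s.mUp n x y) * s.Mij C₁ i j x := by
  have hy := s.sector_ne_zero hα
  have hK := s.K_pos hx hy
  have h := s.sum_mLow_mUp hx hy
  rw [rho, s.E_eq_frame C₁ hx hα]
  simp only [s.MUp_eq C₁ hx hα, s.cartanUp_eq hx hy, Fin.sum_univ_two] at *
  field_simp
  linear_combination -(s.Mij C₁ i j x * s.I x y * s.mUp n x y * s.mLow k x y) * h

theorem rhoLow_eq (k n i j : Fin 2) :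
    s.rhoLow C₁ α k n i j x y =
      s.T x y * (s.bLow x n * s.n x k - s.bLow x k * s.n x n) * s.Mij C₁ i j x := by
  have hy := s.sector_ne_zero hα
  have h1 := s.sum_lLow_lUp hx hy
  have h2 := s.sum_mLow_lUp hx hy
  have h3 := s.sum_lLow_mUp hx hy
  have h4 := s.sum_mLow_mUp hx hy
  rw [rhoLow, ← s.low_wedge hx hy]
  simp only [s.rho_eq C₁ hx hα, s.gMat_eq hx hy, Fin.sum_univ_two] at *
  linear_combination (s.lLow n x y * s.mLow k x y * s.Mij C₁ i j x) * h1
    + (s.mLow n x y * s.mLow k x y * s.Mij C₁ i j x) * h2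
    - (s.lLow n x y * s.lLow k x y * s.Mij C₁ i j x) * h3
    - (s.mLow n x y * s.lLow k x y * s.Mij C₁ i j x) * h4

end Curvature

/-! ### The branches of the angle -/

theorem bUp_forms (hx : x ∈ s.Ω) :
    s.btForm x (s.bUp x) = s.c ∧ s.nForm x (s.bUp x) = 0 := by
  have g1 := s.bt_btUp hx
  have g4 := s.n_btUp hx
  simp only [btForm, nForm, bUp, Fin.sum_univ_two]
  exact ⟨by linear_combination s.c * g1, by linear_combination s.c * g4⟩

theorem bUp_mem_sector (hx : x ∈ s.Ω) : s.bUp x ∈ s.sector 0 x := by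
  rw [(s.θFam_eq 0 0 x _).2, (s.bUp_forms hx).1, (s.bUp_forms hx).2, slitM,
    Complex.mem_slitPlane_iff]
  left
  simpa using s.c_pos

theorem θ_bUp (hx : x ∈ s.Ω) : s.θ 0 x (s.bUp x) = 0 := by
  have h : polM 0 s.c 0 = 0 := by
    have : (⟨s.c, 0⟩ : ℂ).arg = 0 := by
      rw [Complex.arg_eq_zero_iff]; exact ⟨s.c_pos.le, rfl⟩
    simpa [polM] using this
  rw [θ, atCharge, (s.θFam_eq 0 _ x _).1, (s.bUp_forms hx).1, (s.bUp_forms hx).2, h,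
    angleLift_zero]

theorem θ_smul {r : ℝ} (hr : 0 < r) : s.θ α x (r • y) = s.θ α x y := by
  have h1 : s.btForm x (r • y) = r * s.btForm x y := by
    simp only [btForm, Fin.sum_univ_two, Pi.smul_apply, smul_eq_mul]; ring
  have h2 : s.nForm x (r • y) = r * s.nForm x y := by
    simp only [nForm, Fin.sum_univ_two, Pi.smul_apply, smul_eq_mul]; ring
  rw [θ, atCharge, atCharge, (s.θFam_eq α _ x _).1, (s.θFam_eq α _ x _).1, h1, h2, polM_smul hr]

theorem K_smul (hx : x ∈ s.Ω) (hy : y ≠ 0) {r : ℝ} (hr : 0 < r) :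
    s.K x (r • y) = r * s.K x y := by
  have h1 : s.btForm x (r • y) = r * s.btForm x y := by
    simp only [btForm, Fin.sum_univ_two, Pi.smul_apply, smul_eq_mul]; ring
  have h2 : s.nForm x (r • y) = r * s.nForm x y := by
    simp only [nForm, Fin.sum_univ_two, Pi.smul_apply, smul_eq_mul]; ring
  rw [K, atCharge, atCharge, s.KFam_eq hx, s.KFam_eq hx, h1, h2,
    KM_smul s.c_pos s.c_lt_one (s.g_mem x hx) (s.Ssq_pos hx hy) hr]

theorem sector_add_two_pi (hα : y ∈ s.sector α x) : y ∈ s.sector (α + 2 * Real.pi) x :=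
  (s.θFam_eq _ 0 x y).2.2 (slitM_add_two_pi ((s.θFam_eq α 0 x y).2.1 hα))

theorem θ_add_two_pi (hx : x ∈ s.Ω) :
    s.θ (α + 2 * Real.pi) x y = s.θ α x y + s.θmax x := by
  rw [θ, atCharge, θ, atCharge, (s.θFam_eq _ _ x y).1, (s.θFam_eq α _ x y).1, polM_add_two_pi,
    angleLift_add_two_pi s.c_pos s.c_lt_one (s.g_mem x hx), θmax]

/-! ### Single-valuedness -/

section SingleValued

variable (hx : x ∈ s.Ω)

include hx

theorem angleLift_charge_hasDirDeriv (τ : ℝ) :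
    HasDirDeriv (fun γ => angleLift s.c γ τ) (s.g x) 1
      (deriv (fun γ => angleLift s.c γ τ) (s.g x)) :=
  ⟨(contDiffAt_angleLift s.c_pos s.c_lt_one contDiffAt_id contDiffAt_const
    (s.g_mem x hx)).differentiableAt (by simp), rfl⟩

theorem pd_θmax (n : Fin 2) :
    pd s.θmax n x = pd s.g n x * deriv (fun γ => angleLift s.c γ (2 * Real.pi)) (s.g x) := by
  have hg := hasDirDeriv_pd (n := n)
    ((s.g_smooth.contDiffAt (s.isOpen_Ω.mem_nhds hx)).differentiableAt (by simp))
  have h := (s.angleLift_charge_hasDirDeriv hx (2 * Real.pi)).1.hasDerivAt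
  rw [mul_comm]
  exact (hg.comp_hasDerivAt h).pd

omit hx in
theorem dStarθ_eq (α : ℝ) (n : Fin 2) (y : Pt) :
    s.dStarθ α n x y = pd s.g n x *
      deriv (fun γ => angleLift s.c γ (polM α (s.btForm x y) (s.nForm x y))) (s.g x) := by
  rw [dStarθ, dStar]
  simp only [fun γ => (s.θFam_eq α γ x y).1]

/-- Two determinations of `∂*_n θ` differ by a multiple of the derivative of the full angle. -/
theorem dStarθ_branch {α α' : ℝ} (n : Fin 2) {k : ℤ}
    (hk : polM α' (s.btForm x y) (s.nForm x y) =
      polM α (s.btForm x y) (s.nForm x y) + k * (2 * Real.pi)) :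
    s.dStarθ α' n x y = s.dStarθ α n x y + k * pd s.θmax n x := by
  rw [s.dStarθ_eq, s.dStarθ_eq, hk, s.pd_θmax hx]
  have h := ((s.angleLift_charge_hasDirDeriv hx (polM α (s.btForm x y) (s.nForm x y))).add
    ((s.angleLift_charge_hasDirDeriv hx (2 * Real.pi)).const_mul (k : ℝ))).congr_fun
      (f₂ := fun γ => angleLift s.c γ (polM α (s.btForm x y) (s.nForm x y) + k * (2 * Real.pi)))
      (by
        filter_upwards [s.eventually_charge hx] with γ hγ
        exact angleLift_add_int_mul s.c_pos s.c_lt_one hγ _ k)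
  rw [h.deriv]
  ring

theorem dStarθ_add_two_pi (α : ℝ) (n : Fin 2) (y : Pt) :
    s.dStarθ (α + 2 * Real.pi) n x y = s.dStarθ α n x y + pd s.θmax n x := by
  simpa using s.dStarθ_branch hx (α := α) (α' := α + 2 * Real.pi) (k := 1) n
    (by rw [polM_add_two_pi]; push_cast; ring)

theorem dStarθ_eq_of_pd_θmax {n : Fin 2} (h : pd s.θmax n x = 0) (hy : y ≠ 0) (α α' : ℝ) :
    s.dStarθ α' n x y = s.dStarθ α n x y := by
  obtain ⟨k, hk⟩ := polM_eq_add_int_mul α α' (s.Ssq_pos hx hy)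
  rw [s.dStarθ_branch hx n hk, h, mul_zero, add_zero]

omit hx in
theorem contDiffAt_of_smoothOn_branch {F : Pt → Pt → ℝ} (hF : SmoothOn F (s.branchDomain α))
    (hx : x ∈ s.Ω) (hα : y ∈ s.sector α x) : ContDiffAt ℝ ∞ (F x) y :=
  ContDiffAt.comp (g := fun z : Pt × Pt => F z.1 z.2) y
    (hF.contDiffAt (s.isOpen_branchDomain α) (⟨hx, hα⟩ : (x, y) ∈ s.branchDomain α))
    (contDiffAt_const.prodMk contDiffAt_id)

/-- Smooth functions on the sectors that do not depend on the branch are glued together. -/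
theorem exists_glue {F : ℝ → Pt → Pt → ℝ} (hF : ∀ α, SmoothOn (F α) (s.branchDomain α))
    (h : ∀ α α' y, y ∈ s.sector α x → y ∈ s.sector α' x → F α x y = F α' x y) :
    ∃ D : Pt → ℝ, ContDiffOn ℝ ∞ D {0}ᶜ ∧ ∀ α, ∀ y ∈ s.sector α x, F α x y = D y := by
  -- At `y` the branch centred at the direction of `y` itself is chosen.
  set β : Pt → ℝ := fun y => polM 0 (s.btForm x y) (s.nForm x y) with hβ
  have hmem : ∀ y : Pt, y ≠ 0 → y ∈ s.sector (β y) x := fun y hy =>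
    (s.θFam_eq _ 0 x y).2.2 (slitM_of_polar (s.Ssq_pos hx hy))
  refine ⟨fun y => F (β y) x y, fun y hy => ?_, fun α y hα =>
    h α _ y hα (hmem y (s.sector_ne_zero hα))⟩
  have hα := hmem y hy
  refine ((s.contDiffAt_of_smoothOn_branch (hF (β y)) hx hα).congr_of_eventuallyEq
    ?_).contDiffWithinAt
  filter_upwards [s.eventually_sector hx hα] with y' hy'
  exact h _ _ y' (hmem y' (s.sector_ne_zero hy')) hy'

theorem singleValued_θ (n : Fin 2) :
    (∃ D : Pt → ℝ, ContDiffOn ℝ ∞ D {0}ᶜ ∧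
      ∀ α : ℝ, ∀ y ∈ s.sector α x, pd (fun x' => s.θ α x' y) n x = D y) ↔
        pd s.θmax n x = 0 := by
  constructor
  · rintro ⟨D, -, hD⟩
    -- Compare the branches with `α = 0` and `α = 2π` at `b^i`.
    have hb := s.bUp_mem_sector hx
    have h1 := (hD 0 _ hb).trans (hD _ _ (s.sector_add_two_pi hb)).symm
    rw [(s.θ_hasDirDeriv_fst hx hb n).pd,
      (s.θ_hasDirDeriv_fst hx (s.sector_add_two_pi hb) n).pd, s.dStarθ_add_two_pi hx] at h1
    linarith
  · intro h
    refine s.exists_glue hx (F := fun α x y => pd (fun x' => s.θ α x' y) n x)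
      (fun α => (s.smoothOn_θ α).pd_fst (s.isOpen_branchDomain α) n) fun α α' y hα hα' => ?_
    rw [(s.θ_hasDirDeriv_fst hx hα n).pd, (s.θ_hasDirDeriv_fst hx hα' n).pd,
      s.dStarθ_eq_of_pd_θmax hx h (s.sector_ne_zero hα) α α']

theorem singleValued_N (n : Fin 2) :
    (∃ D : Fin 2 → Pt → ℝ, (∀ k, ContDiffOn ℝ ∞ (D k) {0}ᶜ) ∧
      ∀ α : ℝ, ∀ y ∈ s.sector α x, ∀ k, s.N C₁ α k n x y = D k y) ↔
        pd s.θmax n x = 0 := by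
  constructor
  · rintro ⟨D, -, hD⟩
    have hb := s.bUp_mem_sector hx
    have hb0 := s.sector_ne_zero hb
    have hK := s.K_pos hx hb0
    have h1 := fun k => (hD 0 _ hb k).trans (hD _ _ (s.sector_add_two_pi hb) k).symm
    simp only [s.N_eq C₁ hx hb, s.N_eq C₁ hx (s.sector_add_two_pi hb), PStar,
      s.dStarθ_add_two_pi hx] at h1
    have h2 := s.sum_mLow_mUp hx hb0
    rw [Fin.sum_univ_two] at h2
    -- Only the term along `m^k` depends on the branch; contract with `m_k`.
    have h3 : s.K x (s.bUp x) * pd s.θmax n x = 0 := by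
      linear_combination s.mLow 0 x (s.bUp x) * h1 0 + s.mLow 1 x (s.bUp x) * h1 1
        - s.K x (s.bUp x) * pd s.θmax n x * h2
    exact (mul_eq_zero.1 h3).resolve_left hK.ne'
  · intro h
    have key := fun k => s.exists_glue hx (F := fun α => s.N C₁ α k n)
      (fun α => s.smoothOn_N C₁ α k n) fun α α' y hα hα' => by
        rw [s.N_eq C₁ hx hα, s.N_eq C₁ hx hα', PStar, PStar,
          s.dStarθ_eq_of_pd_θmax hx h (s.sector_ne_zero hα) α α']
    choose D hD using key
    exact ⟨D, fun k => (hD k).1, fun α y hα k => (hD k).2 α y hα⟩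

end SingleValued

end FinsleroidSpace

theorem mainTheorem4 (s : FinsleroidSpace) (C₁ : ℝ) :
    -- The metric function is a positive definite Finsler metric function on the slit bundle.
    (∀ x ∈ s.Ω, ∀ y : Pt, y ≠ 0 →
      0 < s.q x y ∧ 0 < s.B x y ∧ 0 < s.nu x y ∧ 0 < s.K x y ∧
      (∀ r : ℝ, 0 < r → s.K x (r • y) = r * s.K x y) ∧
      (s.gMat x y).PosDef ∧
      (∀ i j, s.gMat x y i j = s.lLow i x y * s.lLow j x y + s.mLow i x y * s.mLow j x y) ∧
      (0 < s.bt x 0 * s.n x 1 - s.bt x 1 * s.n x 0 →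
        s.mLow 0 x y = -√(s.gMat x y).det * s.lUp 1 x y ∧
        s.mLow 1 x y = √(s.gMat x y).det * s.lUp 0 x y) ∧
      (∀ i j k, s.A i j k x y = s.I x y * s.mLow i x y * s.mLow j x y * s.mLow k x y)) ∧
    -- Objects that do not involve the angle function are smooth on the slit bundle.
    (SmoothOn s.K s.slitBundle ∧ SmoothOn s.T s.slitBundle ∧ SmoothOn s.I s.slitBundle ∧
      (∀ k, SmoothOn (s.lUp k) s.slitBundle ∧ SmoothOn (s.lLow k) s.slitBundle ∧
        SmoothOn (s.mUp k) s.slitBundle ∧ SmoothOn (s.mLow k) s.slitBundle) ∧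
      (∀ i j, SmoothOn (fun x y => s.gMat x y i j) s.slitBundle ∧
        SmoothOn (fun x y => (s.gMat x y)⁻¹ i j) s.slitBundle) ∧
      (∀ i j k, SmoothOn (s.A i j k) s.slitBundle) ∧
      (∀ n, SmoothOn (fun x y => pd (fun x' => s.K x' y) n x) s.slitBundle ∧
        SmoothOn (s.dStar s.KFam n) s.slitBundle)) ∧
    -- Each branch of the angle function and everything built with it is smooth on its domain.
    (∀ α : ℝ,
      SmoothOn (s.θ α) (s.branchDomain α) ∧
      (∀ n, SmoothOn (fun x y => pd (fun x' => s.θ α x' y) n x) (s.branchDomain α) ∧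
        SmoothOn (s.dStarθ α n) (s.branchDomain α) ∧
        SmoothOn (s.Zn C₁ α n) (s.branchDomain α)) ∧
      (∀ k n, SmoothOn (s.N C₁ α k n) (s.branchDomain α)) ∧
      (∀ k n m, SmoothOn (s.N1 C₁ α k n m) (s.branchDomain α)) ∧
      (∀ k n m i, SmoothOn (s.N2 C₁ α k n m i) (s.branchDomain α)) ∧
      (∀ n i j, SmoothOn (s.MUp C₁ α n i j) (s.branchDomain α)) ∧
      (∀ k n i j, SmoothOn (s.rho C₁ α k n i j) (s.branchDomain α) ∧
        SmoothOn (s.rhoLow C₁ α k n i j) (s.branchDomain α))) ∧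
    -- The branches are the determinations of the angle function.
    (∀ x ∈ s.Ω, s.bUp x ∈ s.sector 0 x ∧ s.θ 0 x (s.bUp x) = 0 ∧ 0 < s.θmax x) ∧
    (∀ α : ℝ, ∀ x ∈ s.Ω, ∀ y ∈ s.sector α x,
      (∀ n, s.K x y * pd (s.θ α x) n y = s.mLow n x y) ∧
      (∀ r : ℝ, 0 < r → s.θ α x (r • y) = s.θ α x y) ∧
      y ∈ s.sector (α + 2 * Real.pi) x ∧
      s.θ (α + 2 * Real.pi) x y = s.θ α x y + s.θmax x) ∧
    -- The identities for the connection coefficients.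
    (∀ α : ℝ, ∀ x ∈ s.Ω, ∀ y ∈ s.sector α x, ∀ n : Fin 2,
      pd (fun x' => s.K x' y) n x =
        s.dStar s.KFam n x y + s.K x y / s.B x y * s.g x * s.nForm x y * s.q x y * s.p n x
          + ∑ k, ∑ j, s.christoffel k n j x * y j * s.lLow k x y ∧
      pd (fun x' => s.θ α x' y) n x =
        s.dStarθ α n x y - 1 / s.K x y ^ 2 * s.T x y * s.Ssq x y * s.p n x
          + ∑ k, ∑ j, s.christoffel k n j x * y j * pd (s.θ α x) k y ∧
      (∀ k, s.N C₁ α k n x y =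
        -s.lUp k x y * pd (fun x' => s.K x' y) n x
          - s.K x y * s.mUp k x y * (pd (fun x' => s.θ α x' y) n x - s.kField C₁ n x)) ∧
      s.d C₁ α n s.K x y = 0 ∧
      s.d C₁ α n (s.θ α) x y = -C₁ * s.p n x ∧
      (∀ k, s.N C₁ α k n x y =
        -(s.g x * s.nForm x y * s.q x y / s.B x y * s.lUp k x y
            + (C₁ - 1 / s.c * √(s.nu x y / s.q x y) * (s.Ssq x y / s.B x y)) * s.mUp k x y)
            * s.K x y * s.p n x
          - s.lUp k x y * s.dStar s.KFam n x y
          - s.K x y * s.mUp k x y * s.dStarθ α n x y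
          - ∑ j, s.christoffel k n j x * y j) ∧
      (∀ k m, s.N1 C₁ α k n m x y =
        (-s.lLow m x y * s.mUp k x y + s.lUp k x y * s.mLow m x y
            + s.I x y * s.mUp k x y * s.mLow m x y) * s.PStar C₁ α n x y
          - s.lUp k x y * s.dStar (s.lLowFam m) n x y
          - s.mUp k x y * s.dStar (s.mLowFam m) n x y
          + 1 / s.c ^ 2 * (s.bLow x m * s.nUp x k - s.n x m * s.bUp x k) * s.p n x
          - s.christoffel k n m x) ∧
      (∀ k m i, s.N2 C₁ α k n m i x y =
        1 / s.K x y * s.Zn C₁ α n x y * s.mUp k x y * s.mLow m x y * s.mLow i x y) ∧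
      (∀ m i, ∑ k, s.yLow k x y * s.N2 C₁ α k n m i x y = 0)) ∧
    -- The curvature.
    (∀ α : ℝ, ∀ x ∈ s.Ω, ∀ y ∈ s.sector α x, ∀ i j : Fin 2,
      (∀ n, s.MUp C₁ α n i j x y = s.K x y * s.mUp n x y * s.Mij C₁ i j x) ∧
      (∀ k n, s.rho C₁ α k n i j x y =
        (s.lUp n x y * s.mLow k x y - s.lLow k x y * s.mUp n x y) * s.Mij C₁ i j x) ∧
      (∀ k n, s.rhoLow C₁ α k n i j x y =
        s.T x y * (s.bLow x n * s.n x k - s.bLow x k * s.n x n) * s.Mij C₁ i j x)) ∧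
    -- Single-valuedness on the whole punctured tangent space.
    (∀ x ∈ s.Ω, ∀ n : Fin 2,
      (pd s.g n x = 0 → pd s.θmax n x = 0) ∧
      ((∃ D : Pt → ℝ, ContDiffOn ℝ ∞ D {0}ᶜ ∧
          ∀ α : ℝ, ∀ y ∈ s.sector α x, pd (fun x' => s.θ α x' y) n x = D y) ↔
        pd s.θmax n x = 0) ∧
      ((∃ D : Fin 2 → Pt → ℝ, (∀ k, ContDiffOn ℝ ∞ (D k) {0}ᶜ) ∧
          ∀ α : ℝ, ∀ y ∈ s.sector α x, ∀ k, s.N C₁ α k n x y = D k y) ↔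
        pd s.θmax n x = 0)) := by
  refine ⟨fun x hx y hy => ?_, ?_, fun α => ?_, fun x hx => ?_, fun α x hx y hα => ?_,
    fun α x hx y hα n => ?_, fun α x hx y hα i j => ?_, fun x hx n => ?_⟩
  · obtain ⟨hq, hB, hν, -⟩ := s.pos_facts hx hy
    exact ⟨hq, hB, hν, s.K_pos hx hy, fun r hr => s.K_smul hx hy hr, s.gMat_posDef hx hy,
      s.gMat_eq hx hy, s.mLow_eq_sqrt_det hx hy, s.A_eq hx hy⟩
  · exact ⟨s.smoothOn_K, s.smoothOn_T, s.smoothOn_I,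
      fun k => ⟨s.smoothOn_lUp k, s.smoothOn_lLow k, s.smoothOn_mUp k, s.smoothOn_mLow k⟩,
      fun i j => ⟨s.smoothOn_gMat i j, s.smoothOn_gMat_inv i j⟩, s.smoothOn_A,
      fun n => ⟨s.smoothOn_K.pd_fst s.isOpen_slitBundle n,
        s.smoothOn_dStar s.slitBundle_fst s.isOpen_slitBundle s.famSmoothOn_KFam n⟩⟩
  · exact ⟨s.smoothOn_θ α, fun n => ⟨(s.smoothOn_θ α).pd_fst (s.isOpen_branchDomain α) n,
        s.smoothOn_dStarθ α n, s.smoothOn_Zn C₁ α n⟩, s.smoothOn_N C₁ α, s.smoothOn_N1 C₁ α,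
      s.smoothOn_N2 C₁ α, s.smoothOn_MUp C₁ α,
      fun k n i j => ⟨s.smoothOn_rho C₁ α k n i j, s.smoothOn_rhoLow C₁ α k n i j⟩⟩
  · exact ⟨s.bUp_mem_sector hx, s.θ_bUp hx,
      angleLift_two_pi_pos s.c_pos s.c_lt_one (s.g_mem x hx)⟩
  · have hK := s.K_pos hx (s.sector_ne_zero hα)
    refine ⟨fun n => ?_, fun r hr => s.θ_smul hr, s.sector_add_two_pi hα, s.θ_add_two_pi hx⟩
    rw [(s.θ_hasDirDeriv hx hα n).pd]
    field_simp
  · have hy := s.sector_ne_zero hα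
    refine ⟨(s.K_hasDirDeriv_fst hx hy n).pd, ?_, fun k => s.N_eq_gradient C₁ hx hα k n,
      s.d_K C₁ hx hα n, s.d_θ C₁ hx hα n, fun k => s.N_eq_frame C₁ hx hα k n,
      fun k m => s.N1_eq C₁ hx hα k n m, fun k m i => s.N2_eq C₁ hx hα k n m i,
      s.sum_yLow_N2 C₁ hx hα n⟩
    rw [(s.θ_hasDirDeriv_fst hx hα n).pd]
    simp only [(s.θ_hasDirDeriv hx hα _).pd]
  · exact ⟨fun n => s.MUp_eq C₁ hx hα n i j, fun k n => s.rho_eq C₁ hx hα k n i j,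
      fun k n => s.rhoLow_eq C₁ hx hα k n i j⟩
  · refine ⟨fun h => ?_, s.singleValued_θ hx n, s.singleValued_N C₁ hx n⟩
    rw [s.pd_θmax hx, h, zero_mul]
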